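/- Let $0<\alpha\le 1$, $r=\frac{1-\alpha}{2}$, and let $p_1,p_2,p_3\in\mathbb R^2$ be the corners of an equilateral triangle of side length $1$, say $p_1=(0,0)$, $p_2=(\frac12,\frac{\sqrt3}{2})$, $p_3=(1,0)$. Put $F_i(x)=r(x-p_i)+p_i$ for $i=1,2,3$, and let $F_4,F_5,F_6$ be the maps $x\mapsto A_i(x-p_i)+p_i$, where $p_4,p_5,p_6$ are the midpoints of the sides $[p_2,p_3]$, $[p_3,p_1]$, $[p_1,p_2]$ and $A_i$ is $\alpha$ times the orthogonal projection onto the direction of that side. Let $X\subset\mathbb R^2$ be the Hanoi attractor, that is, the smallest nonempty compact set mapped into itself by $F_1,\dots,F_6$; for $\alpha<1$ it is the unique nonempty compact set with $X=\bigcup_{i=1}^6F_i(X)$, and for $\alpha=1$ it is the boundary of the triangle. For a finite word $w$ in the letters $1,2,3$ let $F_w=F_{w_1}\circ\dots\circ F_{w_n}$. The line segments of $X$ are the sides $F_w([p_i,p_j])$ of its triangular cells and the joining segments $F_w(F_k(X))$, $k=4,5,6$, which have length $\alpha r^{|w|}$. The joining segments are contained in the sides and cover each side up to a set of length zero. Let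 $H^1(X)$ be the set of continuous $u:X\to\mathbb R$ whose restriction to every line segment of $X$ belongs to the Sobolev space $H^1$ of that segment and for which $\mathscr E(u,u)<\infty$, where $$\mathscr E(u,v)=\int_X u'v'\,dx:=\sum_{w}\sum_{k=4}^{6}\int_{F_w(F_k(X))}u'v'\,dx ,$$ with derivatives and integrals taken with respect to arc length. A resistance form on $X$ is a pair $(\mathcal E,\mathcal D)$ such that (1) $\mathcal D$ is a linear subspace of the functions $X\to\mathbb R$ that contains the constants, $\mathcal E$ is a nonnegative symmetric bilinear form on $\mathcal D$, and $\mathcal E(u,u)=0$ if and only if $u$ is constant; (2) $\mathcal D$ modulo constants is a Hilbert space with inner product $\mathcal E$; (3) $\mathcal D$ separates points; (4) $\sup\{(u(p)-u(q))^2/\mathcal E(u,u):u\in\mathcal D,\ \mathcal E(u,u)\ne0\}<\infty$ for all $p,q\in X$; (5) if $u\in\mathcal D$ then $\bar u=\max(0,\min(u,1))\in\mathcal D$ and $\mathcal E(\bar u,\bar u)\le\mathcal E(u,u)$. Such a pair is said to satisfy the scaling relation $$\mathcal E(u,u)=\sum_{i=1}^3 r^{-1}\,\mathcal E(u\circ F_i,u\circ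 F_i)+\sum_{i=4}^6\int_{F_i(X)}(u')^2\,dx \qquad (*)$$ if this holds for every continuous $u:X\to\mathbb R$ as an identity in $[0,\infty]$: one has $u\in\mathcal D$ if and only if $u\circ F_i\in\mathcal D$ for $i=1,2,3$ and $u$ is $H^1$ on the three segments $F_4(X),F_5(X),F_6(X)$, and then $(*)$ holds. (For $\alpha=1$ the functions $u\circ F_i$, $i\le3$, are constant and the first sum is read as $0$.) **Theorem.** $(\mathscr E,H^1(X))$ is a resistance form on $X$, it satisfies the scaling relation $(*)$, and it is the only resistance form on $X$ with these properties whose domain consists of continuous functions: if $(\mathcal E,\mathcal D)$ is a resistance form on $X$ with $\mathcal D\subset C(X)$ that satisfies $(*)$, then $\mathcal D=H^1(X)$ and $\mathcal E=\mathscr E$ on $\mathcal D\times\mathcal D$. -/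

import Mathlib

open Set Filter Topology MeasureTheory
open scoped ContDiff

noncomputable section

namespace Hanoi

/-! ### Resistance forms -/

/-- `(E, D)` is a resistance form on the set `X`; `E` only matters on `D × D`.
Since `E u u = 0` exactly for constant `u ∈ D`, the field `complete` says that the quotient of `D`
by the constants is complete (hence a Hilbert space) for the inner product induced by `E`. -/
structure IsResistanceForm {X : Type*} (E : (X → ℝ) → (X → ℝ) → ℝ) (D : Set (X → ℝ)) : Prop where
  const_mem : ∀ c : ℝ, (fun _ : X => c) ∈ D
  add_mem : ∀ u ∈ D, ∀ v ∈ D, u + v ∈ D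
  smul_mem : ∀ (c : ℝ), ∀ u ∈ D, c • u ∈ D
  symm : ∀ u ∈ D, ∀ v ∈ D, E u v = E v u
  add_left : ∀ u ∈ D, ∀ v ∈ D, ∀ w ∈ D, E (u + v) w = E u w + E v w
  smul_left : ∀ (c : ℝ), ∀ u ∈ D, ∀ v ∈ D, E (c • u) v = c * E u v
  nonneg : ∀ u ∈ D, 0 ≤ E u u
  eq_zero_iff : ∀ u ∈ D, E u u = 0 ↔ ∃ c : ℝ, ∀ x, u x = c
  complete : ∀ s : ℕ → X → ℝ, (∀ n, s n ∈ D) →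
    (∀ ε > 0, ∃ N, ∀ m ≥ N, ∀ n ≥ N, E (s m - s n) (s m - s n) < ε) →
    ∃ u ∈ D, Tendsto (fun n => E (s n - u) (s n - u)) atTop (𝓝 0)
  separates : ∀ p q : X, p ≠ q → ∃ u ∈ D, u p ≠ u q
  resistance_finite : ∀ p q : X,
    BddAbove {R : ℝ | ∃ u ∈ D, E u u ≠ 0 ∧ R = (u p - u q) ^ 2 / E u u}
  markov : ∀ u ∈ D, (fun x => max 0 (min (u x) 1)) ∈ D ∧
    E (fun x => max 0 (min (u x) 1)) (fun x => max 0 (min (u x) 1)) ≤ E u u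

/-! ### The Sobolev space `H¹(0, ℓ)` -/

/-- `g ∈ L²(0, ℓ)` is a weak derivative of `f` on the interval `(0, ℓ)`. -/
def IsWeakDeriv (ℓ : ℝ) (f g : ℝ → ℝ) : Prop :=
  MemLp g 2 (volume.restrict (Ioo 0 ℓ)) ∧
    ∀ φ : ℝ → ℝ, ContDiff ℝ ∞ φ → HasCompactSupport φ → tsupport φ ⊆ Ioo 0 ℓ →
      ∫ t in Ioo 0 ℓ, f t * deriv φ t = - ∫ t in Ioo 0 ℓ, g t * φ t

/-- `f ∈ H¹(0, ℓ)`. -/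
def MemH1 (ℓ : ℝ) (f : ℝ → ℝ) : Prop :=
  MemLp f 2 (volume.restrict (Ioo 0 ℓ)) ∧ ∃ g, IsWeakDeriv ℓ f g

open Classical in
/-- The derivative of an element of `H¹(0, ℓ)` (unique up to a null set). -/
def weakDeriv (ℓ : ℝ) (f : ℝ → ℝ) : ℝ → ℝ :=
  if h : ∃ g, IsWeakDeriv ℓ f g then h.choose else 0

/-- `∫₀^ℓ f' g' dt`. -/
def dirichlet (ℓ : ℝ) (f g : ℝ → ℝ) : ℝ :=
  ∫ t in Ioo 0 ℓ, weakDeriv ℓ f t * weakDeriv ℓ g t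

/-! ### The Hanoi attractor -/

/-- The Euclidean plane. -/
abbrev Plane : Type := EuclideanSpace ℝ (Fin 2)

/-- The corners `p₁, p₂, p₃` of an equilateral triangle of side length one. -/
def corner : Fin 3 → Plane :=
  ![!₂[0, 0], !₂[1 / 2, √3 / 2], !₂[1, 0]]

/-- The point `p₄`, `p₅` or `p₆`: the midpoint of the side opposite to the corner `j`
(the side with end points `corner (j + 1)` and `corner (j + 2)`, indices modulo 3). -/
def sideMid (j : Fin 3) : Plane :=
  (1 / 2 : ℝ) • (corner (j + 1) + corner (j + 2))

/-- The scaling factor `r = (1 - α) / 2`. -/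
def ratio (α : ℝ) : ℝ := (1 - α) / 2

/-- The similitudes `F₁, F₂, F₃`. -/
def simil (α : ℝ) (i : Fin 3) (x : Plane) : Plane :=
  ratio α • (x - corner i) + corner i

/-- The matrices `A₄, A₅, A₆`. -/
def flatMatrix (α : ℝ) : Fin 3 → Matrix (Fin 2) (Fin 2) ℝ :=
  ![(α / 4) • !![1, -√3; -√3, 3], α • !![1, 0; 0, 0], (α / 4) • !![1, √3; √3, 3]]

/-- The maps `F₄, F₅, F₆`. -/
def flat (α : ℝ) (j : Fin 3) (x : Plane) : Plane :=
  Matrix.toEuclideanLin (flatMatrix α j) (x - sideMid j) + sideMid j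

/-- `C` is a nonempty compact set that is mapped into itself by `F₁, …, F₆`. -/
def IsForwardInvariant (α : ℝ) (C : Set Plane) : Prop :=
  IsCompact C ∧ C.Nonempty ∧ (∀ i, MapsTo (simil α i) C C) ∧ (∀ j, MapsTo (flat α j) C C)

/-- The Hanoi attractor: the smallest nonempty compact set mapped into itself by `F₁, …, F₆`.
For `0 < α < 1` it is the unique nonempty compact `K` with `K = ⋃ i, Fᵢ(K)`, see
`attractor_spec` and `attractor_unique`. -/
def attractor (α : ℝ) : Set Plane := ⋂₀ {C | IsForwardInvariant α C}

theorem simil_mem {α : ℝ} (i : Fin 3) {x : Plane} (hx : x ∈ attractor α) :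
    simil α i x ∈ attractor α :=
  fun C hC => hC.2.2.1 i (hx C hC)

/-- `Fᵢ` as a self-map of the attractor, `i = 1, 2, 3`. -/
def cellMap (α : ℝ) (i : Fin 3) (x : attractor α) : attractor α :=
  ⟨simil α i x, simil_mem i x.2⟩

/-- `F_w = F_{w₁} ∘ ⋯ ∘ F_{wₙ}` for a word `w` in the letters `1, 2, 3`. -/
def wordMap (α : ℝ) : List (Fin 3) → Plane → Plane
  | [] => id
  | i :: w => simil α i ∘ wordMap α w

/-! ### The line segments of the attractor -/

/-- The unit vector along the side opposite to the corner `j`. -/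
def sideDir (j : Fin 3) : Plane := corner (j + 2) - corner (j + 1)

/-- Arc length parametrization, on `[0, r ^ |w|]`, of a side of the triangle with corners
`F_w(p₁), F_w(p₂), F_w(p₃)`. -/
def sideCurve (α : ℝ) (w : List (Fin 3)) (j : Fin 3) (t : ℝ) : Plane :=
  wordMap α w (corner (j + 1)) + t • sideDir j

/-- Arc length parametrization, on `[0, α * r ^ |w|]`, of the segment that joins the two cells
`F_{w(j+1)}` and `F_{w(j+2)}`, from `F_{w(j+1)}(p_{j+2})` to `F_{w(j+2)}(p_{j+1})`;
it is `F_w` of the segment `F₄(X)`, `F₅(X)` or `F₆(X)`. -/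
def joinCurve (α : ℝ) (w : List (Fin 3)) (j : Fin 3) (t : ℝ) : Plane :=
  wordMap α w (simil α (j + 1) (corner (j + 2))) + t • sideDir j

open Classical in
/-- The function `u` along a curve `γ` in the attractor (`sideCurve_mem` and `joinCurve_mem` show
that the curves above run in the attractor). -/
def along {α : ℝ} (u : attractor α → ℝ) (γ : ℝ → Plane) (t : ℝ) : ℝ :=
  if h : γ t ∈ attractor α then u ⟨γ t, h⟩ else 0

/-- The restriction of `u` to the side `j` of the cell `w`. -/
def onSide {α : ℝ} (u : attractor α → ℝ) (w : List (Fin 3)) (j : Fin 3) : ℝ → ℝ :=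
  along u (sideCurve α w j)

/-- The restriction of `u` to the joining segment `j` of the cell `w`. -/
def onJoin {α : ℝ} (u : attractor α → ℝ) (w : List (Fin 3)) (j : Fin 3) : ℝ → ℝ :=
  along u (joinCurve α w j)

/-- The length of the joining segments of the cell `w`. -/
def joinLength (α : ℝ) (w : List (Fin 3)) : ℝ := α * ratio α ^ w.length

/-- The energy `∫ u' v'` on a joining segment. -/
def joinEnergy {α : ℝ} (u v : attractor α → ℝ) (w : List (Fin 3)) (j : Fin 3) : ℝ :=
  dirichlet (joinLength α w) (onJoin u w j) (onJoin v w j)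

/-! ### The energy form on the attractor -/

/-- `∫_X u' v' dx`. The joining segments do not overlap, and they exhaust each side of each cell
up to a null set of that side, so the sum over them counts every line segment of `X` once. -/
def energy (α : ℝ) (u v : attractor α → ℝ) : ℝ :=
  ∑' e : List (Fin 3) × Fin 3, joinEnergy u v e.1 e.2

/-- `H¹(X)`: continuous functions that are `H¹` on every line segment and have finite energy. -/
def H1 (α : ℝ) : Set (attractor α → ℝ) :=
  {u | Continuous u ∧
    (∀ w j, MemH1 (ratio α ^ w.length) (onSide u w j)) ∧
    (∀ w j, MemH1 (joinLength α w) (onJoin u w j)) ∧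
    Summable fun e : List (Fin 3) × Fin 3 => joinEnergy u u e.1 e.2}

/-- The scaling relation
`E(u,u) = ∑_{i=1}^3 r⁻¹ E(u ∘ Fᵢ, u ∘ Fᵢ) + ∑_{i=4}^6 ∫_{Fᵢ(X)} (u')² dx`
for all continuous `u`, both sides being `∞` where they are not defined: the left side is finite
(`u ∈ D`) if and only if each term on the right is. For `α = 1` the maps `F₁, F₂, F₃` are constant,
and `r⁻¹ E(u ∘ Fᵢ, u ∘ Fᵢ)` is read as `0`. -/
def SatisfiesScaling (α : ℝ) (E : (attractor α → ℝ) → (attractor α → ℝ) → ℝ)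
    (D : Set (attractor α → ℝ)) : Prop :=
  ∀ u : attractor α → ℝ, Continuous u →
    (u ∈ D ↔ (∀ i, u ∘ cellMap α i ∈ D) ∧ ∀ j, MemH1 α (onJoin u [] j)) ∧
    (u ∈ D → E u u = ∑ i, (ratio α)⁻¹ * E (u ∘ cellMap α i) (u ∘ cellMap α i) +
      ∑ j, dirichlet α (onJoin u [] j) (onJoin u [] j))

/-! ### Well-definedness of the attractor and its segments -/

theorem flat_sub (α : ℝ) (j : Fin 3) (x y : Plane) :
    flat α j x - flat α j y = Matrix.toEuclideanLin (flatMatrix α j) (x - y) := by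
  simp only [flat, add_sub_add_right_eq_sub, ← map_sub, sub_sub_sub_cancel_right]

theorem norm_flatMatrix_le {α : ℝ} (hα : 0 ≤ α) (j : Fin 3) (v : Plane) :
    ‖Matrix.toEuclideanLin (flatMatrix α j) v‖ ≤ α * ‖v‖ := by
  have h3 : √3 * √3 = 3 := Real.mul_self_sqrt (by norm_num)
  refine le_of_sq_le_sq ?_ (by positivity)
  rw [mul_pow, EuclideanSpace.norm_sq_eq, EuclideanSpace.norm_sq_eq]
  have key : ∀ s : ℝ, s * s = 3 →
      (α / 4 * (v 0 + s * v 1)) ^ 2 + (α / 4 * (s * v 0 + 3 * v 1)) ^ 2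
        ≤ α ^ 2 * (v 0 ^ 2 + v 1 ^ 2) := by
    intro s hs
    have e : α ^ 2 * (v 0 ^ 2 + v 1 ^ 2) - ((α / 4 * (v 0 + s * v 1)) ^ 2 +
        (α / 4 * (s * v 0 + 3 * v 1)) ^ 2) = (α * (s * v 0 - v 1) / 2) ^ 2 := by
      linear_combination (-(α ^ 2 / 16) * (5 * v 0 ^ 2 + v 1 ^ 2)) * hs
    nlinarith [sq_nonneg (α * (s * v 0 - v 1) / 2)]
  fin_cases j
  · have := key (-√3) (by nlinarith)
    simpa [flatMatrix, Matrix.toLpLin_apply, Matrix.mulVec, dotProduct, Fin.sum_univ_two,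
      mul_add, mul_assoc] using this
  · simp [flatMatrix, Matrix.toLpLin_apply, Matrix.mulVec, dotProduct, Fin.sum_univ_two,
      mul_pow]
    nlinarith [mul_nonneg (sq_nonneg α) (sq_nonneg (v 1))]
  · have := key (√3) h3
    simpa [flatMatrix, Matrix.toLpLin_apply, Matrix.mulVec, dotProduct, Fin.sum_univ_two,
      mul_add, mul_assoc] using this

theorem dist_flat_le {α : ℝ} (hα : 0 ≤ α) (j : Fin 3) (x y : Plane) :
    dist (flat α j x) (flat α j y) ≤ α * dist x y := by
  rw [dist_eq_norm, dist_eq_norm, flat_sub]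
  exact norm_flatMatrix_le hα j _

theorem dist_simil {α : ℝ} (hα : α ≤ 1) (i : Fin 3) (x y : Plane) :
    dist (simil α i x) (simil α i y) = ratio α * dist x y := by
  have h : 0 ≤ ratio α := by unfold ratio; linarith
  simp [simil, dist_smul₀, abs_of_nonneg h]

/-- The point with parameter `t` on the side opposite to the corner `j`. -/
def sidePoint (j : Fin 3) (t : ℝ) : Plane := corner (j + 1) + t • sideDir j

theorem simil_sidePoint_left (α : ℝ) (j : Fin 3) (t : ℝ) :
    simil α (j + 1) (sidePoint j t) = sidePoint j (ratio α * t) := by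
  simp only [simil, sidePoint, sideDir]
  module

theorem simil_sidePoint_right (α : ℝ) (j : Fin 3) (t : ℝ) :
    simil α (j + 2) (sidePoint j t) = sidePoint j (1 - ratio α * (1 - t)) := by
  simp only [simil, sidePoint, sideDir]
  module

theorem flat_sidePoint (α : ℝ) (j : Fin 3) (t : ℝ) :
    flat α j (sidePoint (j + 1) t) = sidePoint j (1 / 2 + α * ((1 - t) / 2)) := by
  have h3 : √3 * √3 = 3 := Real.mul_self_sqrt (by norm_num)
  fin_cases j <;> ext k <;> fin_cases k <;>
    simp [flat, flatMatrix, sidePoint, sideDir, sideMid, corner, Matrix.toLpLin_apply,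
      Matrix.mulVec, dotProduct, Fin.sum_univ_two] <;>
    ring_nf <;> (try simp only [Real.sq_sqrt (show (0:ℝ) ≤ 3 by norm_num)]) <;> ring_nf

theorem flat_sidePoint' (α : ℝ) (j : Fin 3) (t : ℝ) :
    flat α j (sidePoint (j + 2) t) = sidePoint j (1 / 2 - α * (t / 2)) := by
  have h3 : √3 * √3 = 3 := Real.mul_self_sqrt (by norm_num)
  fin_cases j <;> ext k <;> fin_cases k <;>
    simp [flat, flatMatrix, sidePoint, sideDir, sideMid, corner, Matrix.toLpLin_apply,
      Matrix.mulVec, dotProduct, Fin.sum_univ_two] <;>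
    ring_nf <;> (try simp only [Real.sq_sqrt (show (0:ℝ) ≤ 3 by norm_num)]) <;> ring_nf

theorem corner_mem_of_invariant {α : ℝ} (hα₀ : 0 < α) (hα₁ : α ≤ 1) {C : Set Plane}
    (hC : IsForwardInvariant α C) (i : Fin 3) : corner i ∈ C := by
  obtain ⟨hc, ⟨x, hx⟩, hs, -⟩ := hC
  have hr0 : 0 ≤ ratio α := by unfold ratio; linarith
  have hr1 : ratio α < 1 := by unfold ratio; linarith
  have hmem : ∀ n : ℕ, corner i + ratio α ^ n • (x - corner i) ∈ C := by
    intro n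
    induction n with
    | zero => simpa using hx
    | succ n ih =>
      have := hs i ih
      convert this using 1
      simp only [simil, pow_succ']
      module
  refine hc.isClosed.mem_of_tendsto (b := atTop) ?_ (Eventually.of_forall hmem)
  have := (tendsto_pow_atTop_nhds_zero_of_lt_one hr0 hr1).smul_const (x - corner i)
  simpa using this.const_add (corner i)

theorem sidePoint_mem_of_invariant {α : ℝ} (hα₀ : 0 < α) (hα₁ : α ≤ 1) {C : Set Plane}
    (hC : IsForwardInvariant α C) (j : Fin 3) {x : ℝ} (hx : x ∈ Icc (0 : ℝ) 1) :
    sidePoint j x ∈ C := by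
  have hr0 : 0 ≤ ratio α := by unfold ratio; linarith
  have hr2 : ratio α ≤ 1 / 2 := by unfold ratio; linarith
  have hra : 2 * ratio α + α = 1 := by unfold ratio; ring
  have hcr := hC
  obtain ⟨hc, -, hs, hf⟩ := hC
  have key : ∀ n : ℕ, ∀ j : Fin 3, ∀ x ∈ Icc (0 : ℝ) 1,
      ∃ c, sidePoint j c ∈ C ∧ |x - c| ≤ (1 / 2) ^ n := by
    intro n
    induction n with
    | zero =>
      intro j x hx
      refine ⟨0, by simpa [sidePoint] using corner_mem_of_invariant hα₀ hα₁ hcr (j + 1), ?_⟩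
      simp [abs_of_nonneg hx.1, hx.2]
    | succ n ih =>
      intro j x hx
      have hp : (0 : ℝ) ≤ (1 / 2) ^ n := by positivity
      rcases le_total x (ratio α) with h1 | h1
      · rcases hr0.eq_or_lt with h0 | h0
        · refine ⟨0, by simpa [sidePoint] using corner_mem_of_invariant hα₀ hα₁ hcr (j + 1), ?_⟩
          have : x = 0 := le_antisymm (by linarith) hx.1
          simp [this]
        · obtain ⟨c, hcC, hd⟩ := ih j (x / ratio α)
            ⟨div_nonneg hx.1 hr0, (div_le_one h0).2 h1⟩
          refine ⟨ratio α * c, by simpa [simil_sidePoint_left] using hs (j + 1) hcC, ?_⟩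
          have : x - ratio α * c = ratio α * (x / ratio α - c) := by field_simp
          rw [this, abs_mul, abs_of_nonneg hr0, pow_succ']
          exact mul_le_mul hr2 hd (abs_nonneg _) (by norm_num)
      · rcases le_total (1 - ratio α) x with h2 | h2
        · rcases hr0.eq_or_lt with h0 | h0
          · refine ⟨1, by
              simpa [sidePoint, sideDir] using corner_mem_of_invariant hα₀ hα₁ hcr (j + 2), ?_⟩
            have : x = 1 := le_antisymm hx.2 (by linarith)
            simp [this]
          · obtain ⟨c, hcC, hd⟩ := ih j (1 - (1 - x) / ratio α)
              ⟨sub_nonneg.2 ((div_le_one h0).2 (by linarith)),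
                sub_le_self _ (div_nonneg (by linarith [hx.2]) hr0)⟩
            refine ⟨1 - ratio α * (1 - c), by
              simpa [simil_sidePoint_right] using hs (j + 2) hcC, ?_⟩
            have : x - (1 - ratio α * (1 - c)) = ratio α * (1 - (1 - x) / ratio α - c) := by
              field_simp; ring
            rw [this, abs_mul, abs_of_nonneg hr0, pow_succ']
            exact mul_le_mul hr2 hd (abs_nonneg _) (by norm_num)
        · rcases le_total (1 / 2) x with h3 | h3
          · obtain ⟨c, hcC, hd⟩ := ih (j + 1) (1 - 2 * (x - 1 / 2) / α)
              ⟨sub_nonneg.2 ((div_le_one hα₀).2 (by linarith)),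
                sub_le_self _ (div_nonneg (by linarith) hα₀.le)⟩
            refine ⟨1 / 2 + α * ((1 - c) / 2), by simpa [flat_sidePoint] using hf j hcC, ?_⟩
            have : x - (1 / 2 + α * ((1 - c) / 2)) =
                -(α / 2 * (1 - 2 * (x - 1 / 2) / α - c)) := by field_simp; ring
            rw [this, abs_neg, abs_mul, abs_of_nonneg (by linarith), pow_succ']
            exact mul_le_mul (by linarith) hd (abs_nonneg _) (by norm_num)
          · obtain ⟨c, hcC, hd⟩ := ih (j + 2) (2 * (1 / 2 - x) / α)
              ⟨div_nonneg (by linarith) hα₀.le, (div_le_one hα₀).2 (by linarith)⟩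
            refine ⟨1 / 2 - α * (c / 2), by simpa [flat_sidePoint'] using hf j hcC, ?_⟩
            have : x - (1 / 2 - α * (c / 2)) =
                -(α / 2 * (2 * (1 / 2 - x) / α - c)) := by field_simp; ring
            rw [this, abs_neg, abs_mul, abs_of_nonneg (by linarith), pow_succ']
            exact mul_le_mul (by linarith) hd (abs_nonneg _) (by norm_num)
  choose c hcC hd using fun n => key n j x hx
  have hlim : Tendsto c atTop (𝓝 x) := by
    rw [tendsto_iff_dist_tendsto_zero]
    refine squeeze_zero (fun _ => dist_nonneg) (fun n => ?_)
      (tendsto_pow_atTop_nhds_zero_of_lt_one (r := (1 / 2 : ℝ)) (by norm_num) (by norm_num))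
    rw [dist_comm, Real.dist_eq]
    exact hd n
  refine hc.isClosed.mem_of_tendsto (b := atTop) (f := fun n => sidePoint j (c n)) ?_
    (Eventually.of_forall hcC)
  exact (hlim.smul_const (sideDir j)).const_add _

theorem wordMap_add (α : ℝ) (w : List (Fin 3)) (x v : Plane) :
    wordMap α w (x + v) = wordMap α w x + ratio α ^ w.length • v := by
  induction w with
  | nil => simp [wordMap]
  | cons i w ih =>
    simp only [wordMap, Function.comp, ih, simil, List.length_cons, pow_succ']
    module

theorem wordMap_mem {α : ℝ} (w : List (Fin 3)) {x : Plane} (hx : x ∈ attractor α) :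
    wordMap α w x ∈ attractor α := by
  induction w with
  | nil => exact hx
  | cons i w ih => exact simil_mem i ih

theorem sideCurve_mem {α : ℝ} (hα₀ : 0 < α) (hα₁ : α ≤ 1) (w : List (Fin 3)) (j : Fin 3)
    {t : ℝ} (ht : t ∈ Icc 0 (ratio α ^ w.length)) : sideCurve α w j t ∈ attractor α := by
  have hr0 : 0 ≤ ratio α ^ w.length := pow_nonneg (by unfold ratio; linarith) _
  obtain ⟨s, hs, rfl⟩ : ∃ s ∈ Icc (0 : ℝ) 1, t = ratio α ^ w.length * s := by
    rcases hr0.eq_or_lt with h0 | h0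
    · exact ⟨0, by simp, le_antisymm (by simpa [← h0] using ht.2) (by simpa using ht.1)⟩
    · exact ⟨t / ratio α ^ w.length, ⟨div_nonneg ht.1 hr0, (div_le_one h0).2 ht.2⟩,
        by field_simp⟩
  have : sideCurve α w j (ratio α ^ w.length * s) = wordMap α w (sidePoint j s) := by
    rw [sidePoint, wordMap_add, sideCurve, smul_smul]
  rw [this]
  exact wordMap_mem w fun C hC => sidePoint_mem_of_invariant hα₀ hα₁ hC j hs

theorem joinCurve_mem {α : ℝ} (hα₀ : 0 < α) (hα₁ : α ≤ 1) (w : List (Fin 3)) (j : Fin 3)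
    {t : ℝ} (ht : t ∈ Icc 0 (joinLength α w)) : joinCurve α w j t ∈ attractor α := by
  have hr0 : 0 ≤ ratio α ^ w.length := pow_nonneg (by unfold ratio; linarith) _
  have hr : 0 ≤ ratio α := by unfold ratio; linarith
  have hra : 2 * ratio α + α = 1 := by unfold ratio; ring
  have h1 : joinCurve α w j t = sideCurve α w j (ratio α ^ w.length * ratio α + t) := by
    have : simil α (j + 1) (corner (j + 2)) = corner (j + 1) + ratio α • sideDir j := by
      simp only [simil, sideDir]; module
    rw [joinCurve, this, wordMap_add, sideCurve]
    module
  have ht2 : t ≤ α * ratio α ^ w.length := ht.2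
  rw [h1]
  exact sideCurve_mem hα₀ hα₁ w j ⟨add_nonneg (mul_nonneg hr0 hr) ht.1, by nlinarith⟩

theorem exists_forwardInvariant {α : ℝ} (hα₀ : 0 < α) (hα₁ : α ≤ 1) :
    ∃ C, IsForwardInvariant α C := by
  have h3 : √3 * √3 = 3 := Real.mul_self_sqrt (by norm_num)
  have hs : 0 < √3 := by positivity
  let C : Set Plane := {x | 0 ≤ x 1 ∧ x 1 ≤ √3 * x 0 ∧ x 1 ≤ √3 * (1 - x 0)}
  have hcl : IsClosed C := by
    have c0 : Continuous fun x : Plane => x 0 := by fun_prop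
    have c1 : Continuous fun x : Plane => x 1 := by fun_prop
    exact (isClosed_le continuous_const c1).inter ((isClosed_le c1 (continuous_const.mul c0)).inter
      (isClosed_le c1 (continuous_const.mul (continuous_const.sub c0))))
  have hbd : Bornology.IsBounded C := by
    refine (Metric.isBounded_closedBall (x := (0 : Plane)) (r := 3)).subset ?_
    rintro x ⟨h1, h2, h4⟩
    have hx0 : 0 ≤ x 0 := by nlinarith
    have hx1 : x 0 ≤ 1 := by nlinarith
    have hx2 : x 1 ≤ 2 := by nlinarith
    rw [mem_closedBall_zero_iff]
    refine le_of_sq_le_sq ?_ (by norm_num)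
    rw [EuclideanSpace.norm_sq_eq]
    simp [Fin.sum_univ_two]
    nlinarith
  have hz : ∀ x ∈ C, ∃ z : ℝ, x 1 = √3 * z ∧ 0 ≤ z ∧ z ≤ x 0 ∧ z ≤ 1 - x 0 := by
    rintro x ⟨h1, h2, h4⟩
    refine ⟨x 1 / √3, by field_simp, by positivity, ?_, ?_⟩
    · rw [div_le_iff₀ hs]; linarith
    · rw [div_le_iff₀ hs]; linarith
  have hmk : ∀ (x : Plane) (z : ℝ), x 1 = √3 * z → 0 ≤ z → z ≤ x 0 → z ≤ 1 - x 0 → x ∈ C := by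
    intro x z h1 h2 h4 h5
    refine ⟨?_, ?_, ?_⟩
    · rw [h1]; positivity
    · rw [h1]; exact mul_le_mul_of_nonneg_left h4 hs.le
    · rw [h1]; exact mul_le_mul_of_nonneg_left h5 hs.le
  refine ⟨C, Metric.isCompact_of_isClosed_isBounded hcl hbd, ⟨0, by simp [C]⟩, ?_, ?_⟩
  · intro i x hx
    obtain ⟨z, h1, h2, h4, h5⟩ := hz x hx
    fin_cases i
    · refine hmk _ ((1 - α) / 2 * z) ?_ ?_ ?_ ?_ <;>
        (try simp [simil, ratio, corner, h1]) <;> nlinarith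
    · refine hmk _ ((1 - α) / 2 * (z - 1 / 2) + 1 / 2) ?_ ?_ ?_ ?_ <;>
        (try simp [simil, ratio, corner, h1]) <;> nlinarith
    · refine hmk _ ((1 - α) / 2 * z) ?_ ?_ ?_ ?_ <;>
        (try simp [simil, ratio, corner, h1]) <;> nlinarith
  · intro j x hx
    obtain ⟨z, h1, h2, h4, h5⟩ := hz x hx
    have hpos : 0 ≤ α := hα₀.le
    have a1 := mul_nonneg hpos h2
    have a2 := mul_nonneg hpos (sub_nonneg.2 h4)
    have a3 := mul_nonneg hpos (sub_nonneg.2 h5)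
    fin_cases j
    · have e0 : flat α 0 x 0 = α / 4 * ((x 0 - 3 / 4) - 3 * (z - 1 / 4)) + 3 / 4 := by
        simp [flat, flatMatrix, sideMid, corner, Matrix.toLpLin_apply,
          Matrix.mulVec, dotProduct, Fin.sum_univ_two, Matrix.vecHead, Matrix.vecTail, h1]
        linear_combination (-(α / 4) * (z - 1 / 4)) * h3
      have e1 : flat α 0 x 1 = √3 * (α / 4 * (-(x 0 - 3 / 4) + 3 * (z - 1 / 4)) + 1 / 4) := by
        simp [flat, flatMatrix, sideMid, corner, Matrix.toLpLin_apply,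
          Matrix.mulVec, dotProduct, Fin.sum_univ_two, Matrix.vecHead, Matrix.vecTail, h1]
        ring
      exact hmk _ _ e1 (by nlinarith) (by simp only [Fin.zero_eta, e0]; nlinarith)
        (by simp only [Fin.zero_eta, e0]; nlinarith)
    · have e0 : flat α 1 x 0 = α * (x 0 - 1 / 2) + 1 / 2 := by
        simp [flat, flatMatrix, sideMid, corner, Matrix.toLpLin_apply,
          Matrix.mulVec, dotProduct, Fin.sum_univ_two, Matrix.vecHead, Matrix.vecTail]
        ring
      have e1 : flat α 1 x 1 = √3 * 0 := by
        simp [flat, flatMatrix, sideMid, corner, Matrix.toLpLin_apply,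
          Matrix.mulVec, dotProduct, Fin.sum_univ_two, Matrix.vecHead, Matrix.vecTail]
      exact hmk _ _ e1 le_rfl (by simp only [Fin.mk_one, e0]; nlinarith)
        (by simp only [Fin.mk_one, e0]; nlinarith)
    · have e0 : flat α 2 x 0 = α / 4 * ((x 0 - 1 / 4) + 3 * (z - 1 / 4)) + 1 / 4 := by
        simp [flat, flatMatrix, sideMid, corner, Matrix.toLpLin_apply,
          Matrix.mulVec, dotProduct, Fin.sum_univ_two, Matrix.vecHead, Matrix.vecTail, h1]
        linear_combination ((α / 4) * (z - 1 / 4)) * h3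
      have e1 : flat α 2 x 1 = √3 * (α / 4 * ((x 0 - 1 / 4) + 3 * (z - 1 / 4)) + 1 / 4) := by
        simp [flat, flatMatrix, sideMid, corner, Matrix.toLpLin_apply,
          Matrix.mulVec, dotProduct, Fin.sum_univ_two, Matrix.vecHead, Matrix.vecTail, h1]
        ring
      exact hmk _ _ e1 (by nlinarith) (by simp only [Fin.reduceFinMk, e0]; nlinarith)
        (by simp only [Fin.reduceFinMk, e0]; nlinarith)

theorem attractor_isForwardInvariant {α : ℝ} (hα₀ : 0 < α) (hα₁ : α ≤ 1) :
    IsForwardInvariant α (attractor α) := by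
  obtain ⟨C, hC⟩ := exists_forwardInvariant hα₀ hα₁
  refine ⟨hC.1.of_isClosed_subset (isClosed_sInter fun D hD => hD.1.isClosed)
    (sInter_subset_of_mem hC), ⟨corner 0, fun D hD => corner_mem_of_invariant hα₀ hα₁ hD 0⟩,
    fun i x hx => simil_mem i hx, fun j x hx D hD => hD.2.2.2 j (hx D hD)⟩

theorem continuous_simil (α : ℝ) (i : Fin 3) : Continuous (simil α i) := by
  unfold simil; fun_prop

theorem continuous_flat (α : ℝ) (j : Fin 3) : Continuous (flat α j) := by
  have := (Matrix.toEuclideanLin (flatMatrix α j)).continuous_of_finiteDimensional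
  unfold flat; fun_prop

/-- The attractor is a nonempty compact set `K` with `K = ⋃ i, Fᵢ(K)`. -/
theorem attractor_spec {α : ℝ} (hα₀ : 0 < α) (hα₁ : α ≤ 1) :
    IsCompact (attractor α) ∧ (attractor α).Nonempty ∧
      attractor α = (⋃ i, simil α i '' attractor α) ∪ ⋃ j, flat α j '' attractor α := by
  obtain ⟨hc, hne, hs, hf⟩ := attractor_isForwardInvariant hα₀ hα₁
  refine ⟨hc, hne, Subset.antisymm ?_ (union_subset (iUnion_subset fun i => (hs i).image_subset)
    (iUnion_subset fun j => (hf j).image_subset))⟩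
  have hsub : (⋃ i, simil α i '' attractor α) ∪ ⋃ j, flat α j '' attractor α ⊆ attractor α :=
    union_subset (iUnion_subset fun i => (hs i).image_subset)
      (iUnion_subset fun j => (hf j).image_subset)
  refine sInter_subset_of_mem ⟨?_, ?_, ?_, ?_⟩
  · exact (isCompact_iUnion fun i => hc.image (continuous_simil α i)).union
      (isCompact_iUnion fun j => hc.image (continuous_flat α j))
  · exact ⟨_, Or.inl (mem_iUnion.2 ⟨0, mem_image_of_mem _ hne.some_mem⟩)⟩
  · exact fun i x hx => Or.inl (mem_iUnion.2 ⟨i, mem_image_of_mem _ (hsub hx)⟩)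
  · exact fun j x hx => Or.inr (mem_iUnion.2 ⟨j, mem_image_of_mem _ (hsub hx)⟩)

/-- For `0 < α < 1`, the attractor is the only nonempty compact set `K` with `K = ⋃ i, Fᵢ(K)`. -/
theorem attractor_unique {α : ℝ} (hα₀ : 0 < α) (hα₁ : α < 1) {L : Set Plane} (hc : IsCompact L)
    (hne : L.Nonempty) (hL : L = (⋃ i, simil α i '' L) ∪ ⋃ j, flat α j '' L) :
    L = attractor α := by
  obtain ⟨hKc, hKne, hKs, hKf⟩ := attractor_isForwardInvariant hα₀ hα₁.le
  have hLs : ∀ i, MapsTo (simil α i) L L := fun i x hx => by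
    rw [hL]; exact Or.inl (mem_iUnion.2 ⟨i, mem_image_of_mem _ hx⟩)
  have hLf : ∀ j, MapsTo (flat α j) L L := fun j x hx => by
    rw [hL]; exact Or.inr (mem_iUnion.2 ⟨j, mem_image_of_mem _ hx⟩)
  refine Subset.antisymm ?_ (sInter_subset_of_mem ⟨hc, hne, hLs, hLf⟩)
  obtain ⟨x, hx, hmax⟩ := hc.exists_isMaxOn hne
    (Metric.continuous_infDist_pt (attractor α)).continuousOn
  have step : ∀ (f : Plane → Plane) (k : ℝ), 0 ≤ k → k < 1 → MapsTo f (attractor α) (attractor α) →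
      (∀ a b, dist (f a) (f b) ≤ k * dist a b) → x ∈ f '' L →
      Metric.infDist x (attractor α) = 0 := by
    rintro f k hk0 hk1 hf hlip ⟨y, hy, rfl⟩
    obtain ⟨z, hz, hyz⟩ := hKc.exists_infDist_eq_dist hKne y
    have h1 : Metric.infDist (f y) (attractor α) ≤ k * Metric.infDist y (attractor α) :=
      (Metric.infDist_le_dist_of_mem (hf hz)).trans (by rw [hyz]; exact hlip y z)
    have h2 : Metric.infDist y (attractor α) ≤ Metric.infDist (f y) (attractor α) := hmax hy
    have h3 := Metric.infDist_nonneg (x := f y) (s := attractor α)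
    nlinarith [mul_le_mul_of_nonneg_left h2 hk0]
  have hzero : Metric.infDist x (attractor α) = 0 := by
    rw [hL] at hx
    rcases hx with hx | hx
    · obtain ⟨i, hi⟩ := mem_iUnion.1 hx
      exact step _ (ratio α) (by unfold ratio; linarith) (by unfold ratio; linarith) (hKs i)
        (fun a b => (dist_simil hα₁.le i a b).le) hi
    · obtain ⟨j, hj⟩ := mem_iUnion.1 hx
      exact step _ α hα₀.le hα₁ (hKf j) (dist_flat_le hα₀.le j) hj
  intro y hy
  refine (hKc.isClosed.mem_iff_infDist_zero hKne).2 (le_antisymm ?_ Metric.infDist_nonneg)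
  exact (hmax hy).trans hzero.le

end Hanoi

end

/-!
The energy is a sum over the joining segments alone. For `α < 1` these omit a Cantor set on every
side, and a continuous function that varies only there, like the Cantor function, would have energy
zero without being constant. The point is that such functions do not belong to the domain of any
resistance form with the scaling relation.

*Corner estimate* (`sq_sub_vertex_le`). The increment of `u` along a side is the sum of its
increments over `2 ^ n` cells of level `n` and over the joining segments between them. If some
nonnegative functional `A`, which passes to the cells along a side with total factor at most `r`,
bounds the squared increments between corners, then by the Cauchy–Schwarz inequality the cells
contribute at most `√((2 r) ^ n * A u)`, which tends to zero because `2 r = 1 - α < 1`. So the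
squared increment is at most the energy of the joining segments. For `H1 α` the functional is the
Dirichlet integral over the side (`isRegularClass_H1`); for the domain of any resistance form `E`
with the scaling relation it is a multiple of `E u u`, because resistances are finite
(`isRegularClass_of_scaling`).

*Consequences for such a regular class.* Since the energy of `u` on a cell is at most `r` times
that of `u`, the oscillation of `u` is at most a multiple of the square root of its energy
(`IsRegularClass.osc_le`). Replacing `u` by the value at a corner on each cell of level `n`, and
correcting it by affine functions on the joining segments of lower level, gives elements of
`cellConst α n` that converge to `u` in energy (`IsRegularClass.exists_cellConst_lt`).

*Existence.* `H1 α` is complete: a Cauchy sequence converges uniformly after normalization, and the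
limit is `H¹` on the joining segments by Fatou's lemma. For functions in `cellConst α n` the
energy on a side is bounded by the total energy (`dirichlet_onSide_le`), so approximation by these
functions shows that the limit is `H¹` on the sides as well. Points are separated by functions in
`cellConst α n`, which are built by gluing (`exists_glue`).

*Uniqueness.* Let `(E, D)` be a resistance form of continuous functions with the scaling relation.
By induction on `n`, `cellConst α n ⊆ D`, and `E` is the energy there
(`cellConst_subset_of_scaling`); iterating the scaling relation also gives `energy ≤ E` on `D`. A
sequence in `⋃ n, cellConst α n` that is Cauchy in energy is therefore Cauchy for `E`, and the
oscillation estimate identifies its limit in `D` up to a constant (`mem_of_tendsto_energy`). Hence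
the domain of every such form is the closure of `⋃ n, cellConst α n`, and `E` agrees with the
energy on it.
-/

namespace Hanoi

/-! ### One-dimensional Sobolev functions -/

/-- `g ∈ L²(0, ℓ)` and `f` is a primitive of `g` on `[0, ℓ]`: the representation of a continuous
element `f` of `H¹(0, ℓ)` with weak derivative `g`. -/
def HasSobolevDeriv (ℓ : ℝ) (f g : ℝ → ℝ) : Prop :=
  MemLp g 2 (volume.restrict (Ioo 0 ℓ)) ∧ ∀ x ∈ Icc 0 ℓ, f x = f 0 + ∫ t in 0..x, g t

theorem intervalIntegrable_of_memLp {ℓ : ℝ} {g : ℝ → ℝ}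
    (hg : MemLp g 2 (volume.restrict (Ioo 0 ℓ))) {x y : ℝ} (hx : x ∈ Icc 0 ℓ) (hy : y ∈ Icc 0 ℓ) :
    IntervalIntegrable g volume x y := by
  have h1 : IntegrableOn g (Ioo 0 ℓ) := hg.integrable (by norm_num)
  have h2 : IntegrableOn g (Ioc 0 ℓ) := by rwa [integrableOn_Ioc_iff_integrableOn_Ioo]
  rw [intervalIntegrable_iff]
  exact h2.mono_set fun t ht => ⟨lt_of_le_of_lt (le_min hx.1 hy.1) ht.1,
    ht.2.trans (max_le hx.2 hy.2)⟩

theorem setIntegral_Ioo_eq {ℓ : ℝ} (hℓ : 0 ≤ ℓ) (g : ℝ → ℝ) :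
    ∫ t in Ioo 0 ℓ, g t = ∫ t in 0..ℓ, g t := by
  rw [intervalIntegral.integral_of_le hℓ, integral_Ioc_eq_integral_Ioo]

theorem HasSobolevDeriv.congr {ℓ : ℝ} {f g f' : ℝ → ℝ} (h : HasSobolevDeriv ℓ f g)
    (hf : EqOn f f' (Icc 0 ℓ)) : HasSobolevDeriv ℓ f' g := by
  refine ⟨h.1, fun x hx => ?_⟩
  rw [← hf hx, ← hf ⟨le_rfl, hx.1.trans hx.2⟩]
  exact h.2 x hx

theorem HasSobolevDeriv.add {ℓ : ℝ} {f g f' g' : ℝ → ℝ} (h : HasSobolevDeriv ℓ f g)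
    (h' : HasSobolevDeriv ℓ f' g') : HasSobolevDeriv ℓ (f + f') (g + g') := by
  refine ⟨h.1.add h'.1, fun x hx => ?_⟩
  have h0 : (0 : ℝ) ∈ Icc 0 ℓ := ⟨le_rfl, hx.1.trans hx.2⟩
  simp only [Pi.add_apply]
  rw [intervalIntegral.integral_add (intervalIntegrable_of_memLp h.1 h0 hx)
    (intervalIntegrable_of_memLp h'.1 h0 hx), h.2 x hx, h'.2 x hx]
  ring

theorem HasSobolevDeriv.const_smul {ℓ : ℝ} {f g : ℝ → ℝ} (h : HasSobolevDeriv ℓ f g) (c : ℝ) :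
    HasSobolevDeriv ℓ (c • f) (c • g) := by
  refine ⟨h.1.const_smul c, fun x hx => ?_⟩
  simp only [Pi.smul_apply, smul_eq_mul, intervalIntegral.integral_const_mul]
  rw [h.2 x hx]
  ring

theorem HasSobolevDeriv.sub {ℓ : ℝ} {f g f' g' : ℝ → ℝ} (h : HasSobolevDeriv ℓ f g)
    (h' : HasSobolevDeriv ℓ f' g') : HasSobolevDeriv ℓ (f - f') (g - g') := by
  have := h.add (h'.const_smul (-1))
  simpa [sub_eq_add_neg] using this

theorem hasSobolevDeriv_affine (ℓ a b : ℝ) :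
    HasSobolevDeriv ℓ (fun t => a + b * t) (fun _ => b) := by
  refine ⟨memLp_const b, fun x _ => ?_⟩
  simp
  ring

theorem hasSobolevDeriv_const (ℓ a : ℝ) : HasSobolevDeriv ℓ (fun _ => a) (fun _ => 0) := by
  simpa using hasSobolevDeriv_affine ℓ a 0

theorem HasSobolevDeriv.sub_eq {ℓ : ℝ} {f g : ℝ → ℝ} (h : HasSobolevDeriv ℓ f g) {x y : ℝ}
    (hx : x ∈ Icc 0 ℓ) (hy : y ∈ Icc 0 ℓ) : f y - f x = ∫ t in x..y, g t := by
  have h0 : (0 : ℝ) ∈ Icc 0 ℓ := ⟨le_rfl, hx.1.trans hx.2⟩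
  rw [h.2 x hx, h.2 y hy, ← intervalIntegral.integral_add_adjacent_intervals
    (intervalIntegrable_of_memLp h.1 h0 hx) (intervalIntegrable_of_memLp h.1 hx hy)]
  ring

/-- Absolute continuity passes to functions with smaller increments. -/
theorem absolutelyContinuousOnInterval_of_dist_le {f f' : ℝ → ℝ} {a b : ℝ}
    (hf : AbsolutelyContinuousOnInterval f a b)
    (h : ∀ x ∈ uIcc a b, ∀ y ∈ uIcc a b, dist (f' x) (f' y) ≤ dist (f x) (f y)) :
    AbsolutelyContinuousOnInterval f' a b := by
  rw [absolutelyContinuousOnInterval_iff] at hf ⊢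
  intro ε hε
  obtain ⟨δ, hδ, H⟩ := hf ε hε
  refine ⟨δ, hδ, fun E hE hlt => lt_of_le_of_lt (Finset.sum_le_sum fun i hi => ?_) (H E hE hlt)⟩
  exact h _ (hE.1 i hi).1 _ (hE.1 i hi).2

theorem HasSobolevDeriv.absolutelyContinuous {ℓ : ℝ} (hℓ : 0 ≤ ℓ) {f g : ℝ → ℝ}
    (h : HasSobolevDeriv ℓ f g) : AbsolutelyContinuousOnInterval f 0 ℓ := by
  have h0 : (0 : ℝ) ∈ Icc 0 ℓ := ⟨le_rfl, hℓ⟩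
  have hi := intervalIntegrable_of_memLp h.1 h0 ⟨hℓ, le_rfl⟩
  have := hi.absolutelyContinuousOnInterval_intervalIntegral (c := 0) (by simp)
  refine absolutelyContinuousOnInterval_of_dist_le this fun x hx y hy => ?_
  rw [uIcc_of_le hℓ] at hx hy
  rw [h.2 x hx, h.2 y hy, dist_add_left]

theorem HasSobolevDeriv.continuousOn {ℓ : ℝ} {f g : ℝ → ℝ}
    (h : HasSobolevDeriv ℓ f g) : ContinuousOn f (Icc 0 ℓ) := by
  rcases lt_or_ge ℓ 0 with hℓ | hℓ
  · simp [Icc_eq_empty_of_lt hℓ]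
  · simpa [uIcc_of_le hℓ] using (h.absolutelyContinuous hℓ).continuousOn

/-- An absolutely continuous function has the derivative `g` almost everywhere when it is a
primitive of `g`. -/
theorem HasSobolevDeriv.ae_hasDerivAt {ℓ : ℝ} (hℓ : 0 ≤ ℓ) {f g : ℝ → ℝ}
    (h : HasSobolevDeriv ℓ f g) :
    ∀ᵐ x ∂volume.restrict (Ioo 0 ℓ), HasDerivAt f (g x) x := by
  have h0 : (0 : ℝ) ∈ Icc 0 ℓ := ⟨le_rfl, hℓ⟩
  have hi := intervalIntegrable_of_memLp h.1 h0 ⟨hℓ, le_rfl⟩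
  rw [ae_restrict_iff' measurableSet_Ioo]
  filter_upwards [hi.ae_hasDerivAt_integral] with x hx hxI
  have hx' := (hx (by rw [uIcc_of_le hℓ]; exact Ioo_subset_Icc_self hxI) 0 (by simp)).const_add (f 0)
  refine hx'.congr_of_eventuallyEq ?_
  filter_upwards [Icc_mem_nhds hxI.1 hxI.2] with y hy
  exact h.2 y hy

/-- A function whose increments are dominated by those of a Sobolev function is itself a Sobolev
function, with a smaller derivative. Truncations and Lipschitz functions are treated this way. -/
theorem HasSobolevDeriv.of_dist_le {ℓ : ℝ} (hℓ : 0 ≤ ℓ) {f g f' : ℝ → ℝ}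
    (h : HasSobolevDeriv ℓ f g)
    (hd : ∀ x ∈ Icc 0 ℓ, ∀ y ∈ Icc 0 ℓ, |f' y - f' x| ≤ |f y - f x|) :
    HasSobolevDeriv ℓ f' (deriv f') ∧
      ∀ᵐ x ∂volume.restrict (Ioo 0 ℓ), |deriv f' x| ≤ |g x| := by
  have hac : AbsolutelyContinuousOnInterval f' 0 ℓ := by
    refine absolutelyContinuousOnInterval_of_dist_le (h.absolutelyContinuous hℓ) ?_
    intro x hx y hy
    rw [uIcc_of_le hℓ] at hx hy
    exact hd y hy x hx
  have hae : ∀ᵐ x ∂volume.restrict (Ioo 0 ℓ), |deriv f' x| ≤ |g x| := by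
    filter_upwards [h.ae_hasDerivAt hℓ, ae_restrict_mem measurableSet_Ioo] with x hx hxI
    by_cases hdiff : DifferentiableAt ℝ f' x
    · refine le_of_tendsto_of_tendsto (hasDerivAt_iff_tendsto_slope.1 hdiff.hasDerivAt).abs
        (hasDerivAt_iff_tendsto_slope.1 hx).abs ?_
      filter_upwards [nhdsWithin_le_nhds (Icc_mem_nhds hxI.1 hxI.2)] with y hy
      rw [slope_def_field, slope_def_field, abs_div, abs_div]
      exact div_le_div_of_nonneg_right (hd x (Ioo_subset_Icc_self hxI) y hy) (abs_nonneg _)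
    · simp [deriv_zero_of_not_differentiableAt hdiff]
  refine ⟨⟨h.1.mono (stronglyMeasurable_deriv f').aestronglyMeasurable ?_, fun x hx => ?_⟩, hae⟩
  · simpa using hae
  · have : AbsolutelyContinuousOnInterval f' 0 x :=
      hac.mono (by rw [uIcc_of_le hℓ, uIcc_of_le hx.1]; exact Icc_subset_Icc_right hx.2)
    rw [this.integral_deriv_eq_sub]
    ring

theorem HasSobolevDeriv.isWeakDeriv {ℓ : ℝ} (hℓ : 0 ≤ ℓ) {f g : ℝ → ℝ}
    (h : HasSobolevDeriv ℓ f g) : IsWeakDeriv ℓ f g := by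
  refine ⟨h.1, fun φ hφ _ hs => ?_⟩
  have hac : AbsolutelyContinuousOnInterval φ 0 ℓ :=
    ContDiffOn.absolutelyContinuousOnInterval (hφ.of_le (by norm_num)).contDiffOn
  have h0 : φ 0 = 0 := image_eq_zero_of_notMem_tsupport fun h => by simpa using hs h
  have h1 : φ ℓ = 0 := image_eq_zero_of_notMem_tsupport fun h => by simpa using hs h
  have key := (h.absolutelyContinuous hℓ).integral_mul_deriv_eq_deriv_mul hac
  rw [h0, h1, ← setIntegral_Ioo_eq hℓ, ← setIntegral_Ioo_eq hℓ] at key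
  rw [key, mul_zero, mul_zero, sub_zero, zero_sub]
  congr 1
  refine integral_congr_ae ?_
  filter_upwards [h.ae_hasDerivAt hℓ] with x hx
  rw [hx.deriv]

theorem HasSobolevDeriv.memH1 {ℓ : ℝ} (hℓ : 0 ≤ ℓ) {f g : ℝ → ℝ}
    (h : HasSobolevDeriv ℓ f g) : MemH1 ℓ f := by
  refine ⟨?_, g, h.isWeakDeriv hℓ⟩
  obtain ⟨C, hC⟩ := isCompact_Icc.exists_bound_of_continuousOn h.continuousOn
  refine MemLp.of_bound (h.continuousOn.mono Ioo_subset_Icc_self |>.aestronglyMeasurable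
    measurableSet_Ioo) C ?_
  filter_upwards [ae_restrict_mem measurableSet_Ioo] with x hx
  exact hC x (Ioo_subset_Icc_self hx)

theorem ae_eq_zero_of_integral_mul_test {ℓ : ℝ} {g : ℝ → ℝ} (hg : IntegrableOn g (Ioo 0 ℓ))
    (h : ∀ φ : ℝ → ℝ, ContDiff ℝ ∞ φ → HasCompactSupport φ → tsupport φ ⊆ Ioo 0 ℓ →
      ∫ t in Ioo 0 ℓ, g t * φ t = 0) : ∀ᵐ x ∂volume.restrict (Ioo 0 ℓ), g x = 0 := by
  rw [ae_restrict_iff' measurableSet_Ioo]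
  refine isOpen_Ioo.ae_eq_zero_of_integral_contDiff_smul_eq_zero hg.locallyIntegrableOn ?_
  intro φ h1 h2 h3
  rw [← h φ h1 h2 h3, ← integral_indicator measurableSet_Ioo]
  refine integral_congr_ae (Eventually.of_forall fun x => ?_)
  by_cases hx : x ∈ Ioo 0 ℓ
  · simp [hx, mul_comm]
  · simp [hx, image_eq_zero_of_notMem_tsupport fun h => hx (h3 h)]

theorem integrableOn_mul_test {ℓ : ℝ} {g φ : ℝ → ℝ} (hg : IntegrableOn g (Ioo 0 ℓ))
    (hφ : Continuous φ) (hc : HasCompactSupport φ) :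
    IntegrableOn (fun t => g t * φ t) (Ioo 0 ℓ) := by
  obtain ⟨C, hC⟩ := hφ.bounded_above_of_compact_support hc
  exact hg.mul_bdd hφ.aestronglyMeasurable (Eventually.of_forall hC)

theorem IsWeakDeriv.ae_eq {ℓ : ℝ} {f g g' : ℝ → ℝ} (h : IsWeakDeriv ℓ f g)
    (h' : IsWeakDeriv ℓ f g') : g =ᵐ[volume.restrict (Ioo 0 ℓ)] g' := by
  have hi : IntegrableOn g (Ioo 0 ℓ) := h.1.integrable (by norm_num)
  have hi' : IntegrableOn g' (Ioo 0 ℓ) := h'.1.integrable (by norm_num)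
  have := ae_eq_zero_of_integral_mul_test (g := g - g') (hi.sub hi') fun φ h1 h2 h3 => by
    have e1 := h.2 φ h1 h2 h3
    have e2 := h'.2 φ h1 h2 h3
    simp only [Pi.sub_apply, sub_mul]
    rw [integral_sub (integrableOn_mul_test hi h1.continuous h2)
      (integrableOn_mul_test hi' h1.continuous h2)]
    linarith
  filter_upwards [this] with x hx
  simpa [sub_eq_zero] using hx

/-- The lemma of du Bois-Reymond for continuous functions: if the weak derivative of `h` vanishes,
then `h` is constant. -/
theorem eq_const_of_integral_mul_deriv_eq_zero {ℓ : ℝ} (hℓ : 0 < ℓ) {h : ℝ → ℝ}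
    (hc : ContinuousOn h (Icc 0 ℓ))
    (H : ∀ φ : ℝ → ℝ, ContDiff ℝ ∞ φ → HasCompactSupport φ → tsupport φ ⊆ Ioo 0 ℓ →
      ∫ t in Ioo 0 ℓ, h t * deriv φ t = 0) :
    ∃ c, ∀ x ∈ Icc 0 ℓ, h x = c := by
  have hi : IntegrableOn h (Ioo 0 ℓ) := (hc.integrableOn_Icc).mono_set Ioo_subset_Icc_self
  let b : ContDiffBump (ℓ / 2 : ℝ) := ⟨ℓ / 8, ℓ / 4, by linarith, by linarith⟩
  let ψ : ℝ → ℝ := b.normed volume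
  have hψ1 : ContDiff ℝ ∞ ψ := b.contDiff_normed
  have hψ2 : HasCompactSupport ψ := b.hasCompactSupport_normed
  have hψ3 : tsupport ψ ⊆ Ioo 0 ℓ := by
    have e : tsupport ψ = Metric.closedBall (ℓ / 2) (ℓ / 4) := b.tsupport_normed_eq
    rw [e, Real.closedBall_eq_Icc]
    exact Icc_subset_Ioo (by linarith) (by linarith)
  have integral_eq : ∀ φ : ℝ → ℝ, tsupport φ ⊆ Ioo 0 ℓ → ∫ t in Ioo 0 ℓ, φ t = ∫ t, φ t := by
    intro φ hφ
    exact setIntegral_eq_integral_of_forall_compl_eq_zero fun x hx =>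
      image_eq_zero_of_notMem_tsupport fun h => hx (hφ h)
  have hψ4 : ∫ t in Ioo 0 ℓ, ψ t = 1 := by
    rw [integral_eq ψ hψ3]
    exact b.integral_normed
  -- a test function of mean zero is the derivative of a test function
  have prim : ∀ φ : ℝ → ℝ, ContDiff ℝ ∞ φ → HasCompactSupport φ → tsupport φ ⊆ Ioo 0 ℓ →
      ∫ t in Ioo 0 ℓ, φ t = 0 → ∫ t in Ioo 0 ℓ, h t * φ t = 0 := by
    intro φ h1 h2 h3 h4
    rcases (tsupport φ).eq_empty_or_nonempty with he | hne
    · rw [tsupport_eq_empty_iff] at he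
      simp [he]
    obtain ⟨p, hp⟩ := h2.exists_isLeast hne
    obtain ⟨q, hq⟩ := h2.exists_isGreatest hne
    have hder : ∀ x, HasDerivAt (fun x => ∫ t in 0..x, φ t) (φ x) x := fun x =>
      intervalIntegral.integral_hasDerivAt_right (h1.continuous.intervalIntegrable _ _)
        (h1.continuous.stronglyMeasurableAtFilter _ _) h1.continuous.continuousAt
    have hderiv : deriv (fun x => ∫ t in 0..x, φ t) = φ := funext fun x => (hder x).deriv
    have hsupp : tsupport (fun x => ∫ t in 0..x, φ t) ⊆ Icc p q := by
      refine closure_minimal (fun x hx => ?_) isClosed_Icc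
      by_contra hx'
      refine hx ?_
      rcases lt_or_ge x p with hxp | hxp
      · refine (intervalIntegral.integral_congr fun t ht => ?_).trans
          (intervalIntegral.integral_zero (a := 0) (b := x))
        refine image_eq_zero_of_notMem_tsupport fun ht' => ?_
        have h5 := hp.2 ht'
        have h6 := (h3 hp.1).1
        rcases le_max_iff.1 ht.2 with h7 | h7 <;> linarith
      · have hxq : q < x := by
          by_contra h5
          exact hx' ⟨hxp, not_lt.1 h5⟩
        have h7 : 0 ≤ x := by linarith [(h3 hq.1).1]
        rw [integral_eq φ h3] at h4
        change ∫ t in 0..x, φ t = 0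
        rw [intervalIntegral.integral_of_le h7]
        refine Eq.trans ?_ h4
        refine setIntegral_eq_integral_of_forall_compl_eq_zero fun t ht =>
          image_eq_zero_of_notMem_tsupport fun ht' => ht ?_
        exact ⟨(h3 ht').1, (hq.2 ht').trans hxq.le⟩
    have hθ : ContDiff ℝ ∞ (fun x => ∫ t in 0..x, φ t) := by
      rw [contDiff_infty_iff_deriv, hderiv]
      exact ⟨fun x => (hder x).differentiableAt, h1⟩
    have := H _ hθ (isCompact_Icc.of_isClosed_subset (isClosed_tsupport _) hsupp)
      (hsupp.trans (Icc_subset_Ioo (h3 hp.1).1 (h3 hq.1).2))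
    rwa [hderiv] at this
  have hae := ae_eq_zero_of_integral_mul_test
    (g := fun t => h t - ∫ s in Ioo 0 ℓ, h s * ψ s)
    (hi.sub (integrable_const _)) fun φ h1 h2 h3 => by
      have h5 := prim (fun t => φ t - (∫ s in Ioo 0 ℓ, φ s) * ψ t)
        (h1.sub (contDiff_const.mul hψ1)) (h2.sub (hψ2.mul_left))
        ((tsupport_sub _ _).trans (union_subset h3
          ((tsupport_mul_subset_right).trans hψ3))) ?_
      · have e1 : ∀ t, h t * (φ t - (∫ s in Ioo 0 ℓ, φ s) * ψ t) =
            h t * φ t - (∫ s in Ioo 0 ℓ, φ s) * (h t * ψ t) := fun t => by ring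
        simp only [e1] at h5
        rw [integral_sub (integrableOn_mul_test hi h1.continuous h2)
          ((integrableOn_mul_test hi hψ1.continuous hψ2).const_mul _),
          integral_const_mul] at h5
        simp only [sub_mul]
        rw [integral_sub (integrableOn_mul_test hi h1.continuous h2)
          ((h1.continuous.integrable_of_hasCompactSupport h2).integrableOn.const_mul _),
          integral_const_mul]
        linarith
      · rw [integral_sub (h1.continuous.integrable_of_hasCompactSupport h2).integrableOn
          ((hψ1.continuous.integrable_of_hasCompactSupport hψ2).integrableOn.const_mul _),
          integral_const_mul, hψ4]
        ring
  refine ⟨∫ s in Ioo 0 ℓ, h s * ψ s, ?_⟩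
  have h5 : EqOn h (fun _ => ∫ s in Ioo 0 ℓ, h s * ψ s) (Ioo 0 ℓ) := by
    refine Measure.eqOn_open_of_ae_eq (μ := volume) ?_ isOpen_Ioo
      (hc.mono Ioo_subset_Icc_self) continuousOn_const
    filter_upwards [hae] with x hx
    linarith
  have h6 := h5.of_subset_closure hc continuousOn_const Ioo_subset_Icc_self
    (by rw [closure_Ioo hℓ.ne])
  exact h6

theorem hasSobolevDeriv_zero_length (f : ℝ → ℝ) : HasSobolevDeriv 0 f 0 := by
  refine ⟨MemLp.zero, fun x hx => ?_⟩
  have : x = 0 := le_antisymm hx.2 hx.1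
  simp [this]

theorem memH1_zero_length (f : ℝ → ℝ) : MemH1 0 f :=
  (hasSobolevDeriv_zero_length f).memH1 le_rfl

/-- A continuous element of `H¹(0, ℓ)` is a primitive of its weak derivative. -/
theorem MemH1.exists_hasSobolevDeriv {ℓ : ℝ} (hℓ : 0 ≤ ℓ) {f : ℝ → ℝ} (h : MemH1 ℓ f)
    (hc : ContinuousOn f (Icc 0 ℓ)) : ∃ g, HasSobolevDeriv ℓ f g := by
  rcases hℓ.eq_or_lt with rfl | hpos
  · exact ⟨0, hasSobolevDeriv_zero_length f⟩
  obtain ⟨-, g, hg⟩ := h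
  have hF : HasSobolevDeriv ℓ (fun x => ∫ t in 0..x, g t) g :=
    ⟨hg.1, fun x _ => by simp⟩
  have hFi : IntegrableOn (fun x => ∫ t in 0..x, g t) (Ioo 0 ℓ) :=
    hF.continuousOn.integrableOn_Icc.mono_set Ioo_subset_Icc_self
  have hfi : IntegrableOn f (Ioo 0 ℓ) := hc.integrableOn_Icc.mono_set Ioo_subset_Icc_self
  obtain ⟨c, hcst⟩ := eq_const_of_integral_mul_deriv_eq_zero hpos
    (h := fun x => f x - ∫ t in 0..x, g t) (hc.sub hF.continuousOn) fun φ h1 h2 h3 => by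
      have e1 := hg.2 φ h1 h2 h3
      have e2 := (hF.isWeakDeriv hℓ).2 φ h1 h2 h3
      have hd : Continuous (deriv φ) := h1.continuous_deriv (by norm_num)
      simp only [sub_mul]
      rw [integral_sub (integrableOn_mul_test hfi hd h2.deriv)
        (integrableOn_mul_test hFi hd h2.deriv), e1, e2, sub_self]
  refine ⟨g, hg.1, fun x hx => ?_⟩
  have e0 := hcst 0 ⟨le_rfl, hℓ⟩
  have e1 := hcst x hx
  simp only [intervalIntegral.integral_same, sub_zero] at e0
  linarith

theorem HasSobolevDeriv.weakDeriv_ae_eq {ℓ : ℝ} (hℓ : 0 ≤ ℓ) {f g : ℝ → ℝ}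
    (h : HasSobolevDeriv ℓ f g) : weakDeriv ℓ f =ᵐ[volume.restrict (Ioo 0 ℓ)] g := by
  have hex : ∃ g, IsWeakDeriv ℓ f g := ⟨g, h.isWeakDeriv hℓ⟩
  rw [weakDeriv, dif_pos hex]
  exact hex.choose_spec.ae_eq (h.isWeakDeriv hℓ)

theorem dirichlet_eq {ℓ : ℝ} (hℓ : 0 ≤ ℓ) {f g f' g' : ℝ → ℝ} (h : HasSobolevDeriv ℓ f g)
    (h' : HasSobolevDeriv ℓ f' g') : dirichlet ℓ f f' = ∫ t in Ioo 0 ℓ, g t * g' t := by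
  refine integral_congr_ae ?_
  filter_upwards [h.weakDeriv_ae_eq hℓ, h'.weakDeriv_ae_eq hℓ] with t h1 h2
  rw [h1, h2]

theorem dirichlet_comm (ℓ : ℝ) (f f' : ℝ → ℝ) : dirichlet ℓ f f' = dirichlet ℓ f' f := by
  simp only [dirichlet, mul_comm]

theorem dirichlet_self_nonneg (ℓ : ℝ) (f : ℝ → ℝ) : 0 ≤ dirichlet ℓ f f :=
  integral_nonneg fun _ => mul_self_nonneg _

theorem dirichlet_zero_length (f f' : ℝ → ℝ) : dirichlet 0 f f' = 0 := by
  simp [dirichlet]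

/-- `f` is a continuous element of `H¹(0, ℓ)`. -/
def Sobolev (ℓ : ℝ) (f : ℝ → ℝ) : Prop := ∃ g, HasSobolevDeriv ℓ f g

theorem Sobolev.add {ℓ : ℝ} {f f' : ℝ → ℝ} (h : Sobolev ℓ f) (h' : Sobolev ℓ f') :
    Sobolev ℓ (f + f') :=
  ⟨_, h.choose_spec.add h'.choose_spec⟩

theorem Sobolev.sub {ℓ : ℝ} {f f' : ℝ → ℝ} (h : Sobolev ℓ f) (h' : Sobolev ℓ f') :
    Sobolev ℓ (f - f') :=
  ⟨_, h.choose_spec.sub h'.choose_spec⟩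

theorem Sobolev.const_smul {ℓ : ℝ} {f : ℝ → ℝ} (h : Sobolev ℓ f) (c : ℝ) :
    Sobolev ℓ (c • f) :=
  ⟨_, h.choose_spec.const_smul c⟩

theorem Sobolev.congr {ℓ : ℝ} {f f' : ℝ → ℝ} (h : Sobolev ℓ f) (he : EqOn f f' (Icc 0 ℓ)) :
    Sobolev ℓ f' :=
  ⟨_, h.choose_spec.congr he⟩

theorem Sobolev.continuousOn {ℓ : ℝ} {f : ℝ → ℝ} (h : Sobolev ℓ f) : ContinuousOn f (Icc 0 ℓ) :=
  h.choose_spec.continuousOn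

theorem memH1_iff_sobolev {ℓ : ℝ} (hℓ : 0 ≤ ℓ) {f : ℝ → ℝ} (hc : ContinuousOn f (Icc 0 ℓ)) :
    MemH1 ℓ f ↔ Sobolev ℓ f :=
  ⟨fun h => h.exists_hasSobolevDeriv hℓ hc, fun ⟨_, h⟩ => h.memH1 hℓ⟩

theorem dirichlet_congr {ℓ : ℝ} (hℓ : 0 ≤ ℓ) {f₁ f₂ f₁' f₂' : ℝ → ℝ} (h : Sobolev ℓ f₁)
    (h' : Sobolev ℓ f₁') (he : EqOn f₁ f₂ (Icc 0 ℓ)) (he' : EqOn f₁' f₂' (Icc 0 ℓ)) :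
    dirichlet ℓ f₁ f₁' = dirichlet ℓ f₂ f₂' := by
  obtain ⟨g, h⟩ := h
  obtain ⟨g', h'⟩ := h'
  rw [dirichlet_eq hℓ h h', dirichlet_eq hℓ (h.congr he) (h'.congr he')]

theorem dirichlet_add_left {ℓ : ℝ} (hℓ : 0 ≤ ℓ) {f₁ f₂ f : ℝ → ℝ} (h₁ : Sobolev ℓ f₁)
    (h₂ : Sobolev ℓ f₂) (h : Sobolev ℓ f) :
    dirichlet ℓ (f₁ + f₂) f = dirichlet ℓ f₁ f + dirichlet ℓ f₂ f := by
  obtain ⟨g₁, h₁⟩ := h₁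
  obtain ⟨g₂, h₂⟩ := h₂
  obtain ⟨g, h⟩ := h
  rw [dirichlet_eq hℓ (h₁.add h₂) h, dirichlet_eq hℓ h₁ h, dirichlet_eq hℓ h₂ h]
  simp only [Pi.add_apply, add_mul]
  exact integral_add (h₁.1.integrable_mul h.1) (h₂.1.integrable_mul h.1)

theorem dirichlet_smul_left {ℓ : ℝ} (hℓ : 0 ≤ ℓ) {f₁ f : ℝ → ℝ} (c : ℝ) (h₁ : Sobolev ℓ f₁)
    (h : Sobolev ℓ f) : dirichlet ℓ (c • f₁) f = c * dirichlet ℓ f₁ f := by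
  obtain ⟨g₁, h₁⟩ := h₁
  obtain ⟨g, h⟩ := h
  rw [dirichlet_eq hℓ (h₁.const_smul c) h, dirichlet_eq hℓ h₁ h, ← integral_const_mul]
  simp only [Pi.smul_apply, smul_eq_mul, mul_assoc]

/-- The polarization identity for the Dirichlet integral. -/
theorem dirichlet_add_self {ℓ : ℝ} (hℓ : 0 ≤ ℓ) {f f' : ℝ → ℝ} (h : Sobolev ℓ f)
    (h' : Sobolev ℓ f') : dirichlet ℓ (f + f') (f + f') =
      dirichlet ℓ f f + 2 * dirichlet ℓ f f' + dirichlet ℓ f' f' := by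
  rw [dirichlet_add_left hℓ h h' (h.add h'), dirichlet_comm ℓ f, dirichlet_comm ℓ f',
    dirichlet_add_left hℓ h h' h, dirichlet_add_left hℓ h h' h', dirichlet_comm ℓ f' f]
  ring

theorem two_mul_abs_dirichlet_le {ℓ : ℝ} (hℓ : 0 ≤ ℓ) {f f' : ℝ → ℝ} (h : Sobolev ℓ f)
    (h' : Sobolev ℓ f') : 2 * |dirichlet ℓ f f'| ≤ dirichlet ℓ f f + dirichlet ℓ f' f' := by
  have h1 := dirichlet_add_self hℓ h h'
  have h2 := dirichlet_add_self hℓ h (h'.const_smul (-1))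
  have h3 := dirichlet_self_nonneg ℓ (f + f')
  have h4 := dirichlet_self_nonneg ℓ (f + (-1 : ℝ) • f')
  rw [dirichlet_comm ℓ f ((-1 : ℝ) • f'), dirichlet_smul_left hℓ _ h' h,
    dirichlet_smul_left hℓ _ h' (h'.const_smul _), dirichlet_comm ℓ f' ((-1 : ℝ) • f'),
    dirichlet_smul_left hℓ _ h' h', dirichlet_comm ℓ f' f] at h2
  have h5 : |dirichlet ℓ f f'| ≤ (dirichlet ℓ f f + dirichlet ℓ f' f') / 2 :=
    abs_le.2 ⟨by linarith, by linarith⟩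
  linarith

theorem sq_intervalIntegral_le {ℓ : ℝ} {g : ℝ → ℝ}
    (hg : MemLp g 2 (volume.restrict (Ioo 0 ℓ))) {x y : ℝ} (hx : x ∈ Icc 0 ℓ) (hy : y ∈ Icc 0 ℓ) :
    (∫ t in x..y, g t) ^ 2 ≤ ℓ * ∫ t in Ioo 0 ℓ, g t * g t := by
  wlog hxy : x ≤ y generalizing x y
  · rw [intervalIntegral.integral_symm, neg_sq]
    exact this hy hx (le_of_not_ge hxy)
  have hsub : Ioc x y ≤ᵐ[volume] Ioo 0 ℓ := by
    refine (LE.le.eventuallyLE (Ioc_subset_Ioc hx.1 hy.2)).trans ?_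
    exact Ioo_ae_eq_Ioc.symm.le
  have hi2 : IntegrableOn (fun t => g t * g t) (Ioo 0 ℓ) := hg.integrable_mul hg
  have hi : IntegrableOn g (Ioo 0 ℓ) := hg.integrable (by norm_num)
  have hmono : ∫ t in Ioc x y, g t * g t ≤ ∫ t in Ioo 0 ℓ, g t * g t :=
    setIntegral_mono_set hi2 (Eventually.of_forall fun t => mul_self_nonneg _) hsub
  have hi2' : IntegrableOn (fun t => g t * g t) (Ioc x y) := hi2.mono_set_ae hsub
  have hi' : IntegrableOn g (Ioc x y) := hi.mono_set_ae hsub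
  have hvar : ∀ c : ℝ, 0 ≤ (∫ t in Ioc x y, g t * g t) - 2 * c * (∫ t in Ioc x y, g t) +
      c ^ 2 * (y - x) := by
    intro c
    have h1 : 0 ≤ ∫ t in Ioc x y, (g t - c) ^ 2 := integral_nonneg fun _ => sq_nonneg _
    have h2 : ∫ t in Ioc x y, (g t - c) ^ 2 = ∫ t in Ioc x y,
        (g t * g t - 2 * c * g t + c ^ 2) := by congr 1; ext t; ring
    have h3 : ∫ t in Ioc x y, (g t * g t - 2 * c * g t + c ^ 2) =
        (∫ t in Ioc x y, g t * g t) - 2 * c * (∫ t in Ioc x y, g t) + c ^ 2 * (y - x) := by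
      rw [integral_add (f := fun t => g t * g t - 2 * c * g t) (hi2'.sub (hi'.const_mul _))
        (integrable_const _), integral_sub hi2' (hi'.const_mul _), integral_const_mul]
      simp [hxy, mul_comm]
    linarith
  rw [intervalIntegral.integral_of_le hxy]
  set A := ∫ t in Ioc x y, g t * g t
  set B := ∫ t in Ioc x y, g t
  have hA : 0 ≤ A := integral_nonneg fun _ => mul_self_nonneg _
  have hyx : y - x ≤ ℓ := by linarith [hx.1, hy.2]
  have hℓ : 0 ≤ ℓ := hx.1.trans hx.2
  rcases hxy.eq_or_lt with rfl | hlt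
  · have : B = 0 := by simp [B]
    rw [this]
    nlinarith
  · have hpos : 0 < y - x := sub_pos.2 hlt
    have := hvar (B / (y - x))
    have e : A - 2 * (B / (y - x)) * B + (B / (y - x)) ^ 2 * (y - x) = A - B ^ 2 / (y - x) := by
      field_simp; ring
    rw [e, sub_nonneg, div_le_iff₀ hpos] at this
    nlinarith

theorem Sobolev.sq_sub_le {ℓ : ℝ} {f : ℝ → ℝ} (h : Sobolev ℓ f) {x y : ℝ}
    (hx : x ∈ Icc 0 ℓ) (hy : y ∈ Icc 0 ℓ) : (f y - f x) ^ 2 ≤ ℓ * dirichlet ℓ f f := by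
  obtain ⟨g, h⟩ := h
  rw [dirichlet_eq (hx.1.trans hx.2) h h, h.sub_eq hx hy]
  exact sq_intervalIntegral_le h.1 hx hy

theorem sobolev_affine (ℓ a b : ℝ) : Sobolev ℓ (fun t => a + b * t) :=
  ⟨_, hasSobolevDeriv_affine ℓ a b⟩

theorem dirichlet_affine {ℓ : ℝ} (hℓ : 0 ≤ ℓ) (a b : ℝ) :
    dirichlet ℓ (fun t => a + b * t) (fun t => a + b * t) = ℓ * b ^ 2 := by
  rw [dirichlet_eq hℓ (hasSobolevDeriv_affine ℓ a b) (hasSobolevDeriv_affine ℓ a b)]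
  simp [hℓ, sq]

/-- Functions with increments dominated by those of a Sobolev function. -/
theorem Sobolev.of_dist_le {ℓ : ℝ} (hℓ : 0 ≤ ℓ) {f f' : ℝ → ℝ} (h : Sobolev ℓ f)
    (hd : ∀ x ∈ Icc 0 ℓ, ∀ y ∈ Icc 0 ℓ, |f' y - f' x| ≤ |f y - f x|) :
    Sobolev ℓ f' ∧ dirichlet ℓ f' f' ≤ dirichlet ℓ f f := by
  obtain ⟨g, h⟩ := h
  obtain ⟨h1, h2⟩ := h.of_dist_le hℓ hd
  refine ⟨⟨_, h1⟩, ?_⟩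
  rw [dirichlet_eq hℓ h1 h1, dirichlet_eq hℓ h h]
  refine integral_mono_ae (h1.1.integrable_mul h1.1) (h.1.integrable_mul h.1) ?_
  filter_upwards [h2] with x hx
  exact mul_self_le_mul_self_iff (abs_nonneg _) (abs_nonneg _) |>.1 hx |> fun h => by
    simpa using h

theorem map_mul_left_restrict_Ioo {c : ℝ} (hc : 0 < c) (ℓ : ℝ) :
    (volume.restrict (Ioo 0 ℓ)).map (fun t => c * t) =
      ENNReal.ofReal c⁻¹ • volume.restrict (Ioo 0 (c * ℓ)) := by
  have hm : MeasurableEmbedding (fun t : ℝ => c * t) :=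
    (Homeomorph.mulLeft₀ c hc.ne').measurableEmbedding
  have hpre : (fun t : ℝ => c * t) ⁻¹' Ioo 0 (c * ℓ) = Ioo 0 ℓ := by
    ext t
    rw [mem_preimage, mem_Ioo, mem_Ioo, mul_pos_iff_of_pos_left hc, mul_lt_mul_iff_right₀ hc]
  rw [← hpre, ← hm.restrict_map, Real.map_volume_mul_left hc.ne', Measure.restrict_smul,
    abs_of_pos (inv_pos.2 hc)]

theorem HasSobolevDeriv.comp_mul {c ℓ : ℝ} (hc : 0 < c) {f g : ℝ → ℝ}
    (h : HasSobolevDeriv (c * ℓ) f g) :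
    HasSobolevDeriv ℓ (fun t => f (c * t)) (fun t => c * g (c * t)) := by
  refine ⟨?_, fun x hx => ?_⟩
  · refine MemLp.const_mul ?_ c
    have hm := h.1.smul_measure (c := ENNReal.ofReal c⁻¹) ENNReal.ofReal_ne_top
    rw [← map_mul_left_restrict_Ioo hc] at hm
    exact (memLp_map_measure_iff hm.1 (by fun_prop)).1 hm
  · beta_reduce
    rw [h.2 (c * x) ⟨mul_nonneg hc.le hx.1, mul_le_mul_of_nonneg_left hx.2 hc.le⟩,
      intervalIntegral.integral_const_mul, mul_zero, ← smul_eq_mul c (∫ _ in _.._, _),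
      intervalIntegral.smul_integral_comp_mul_left, mul_zero]

theorem Sobolev.comp_mul {c ℓ : ℝ} (hc : 0 < c) {f : ℝ → ℝ} (h : Sobolev (c * ℓ) f) :
    Sobolev ℓ (fun t => f (c * t)) :=
  ⟨_, h.choose_spec.comp_mul hc⟩

theorem sobolev_comp_mul_iff {c ℓ : ℝ} (hc : 0 < c) {f : ℝ → ℝ} :
    Sobolev ℓ (fun t => f (c * t)) ↔ Sobolev (c * ℓ) f := by
  refine ⟨fun h => ?_, fun h => h.comp_mul hc⟩
  have : Sobolev (c⁻¹ * (c * ℓ)) (fun t => f (c * t)) := by rwa [inv_mul_cancel_left₀ hc.ne']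
  have h2 := this.comp_mul (inv_pos.2 hc)
  simpa [mul_inv_cancel_left₀ hc.ne'] using h2

/-- The Dirichlet integral scales with the inverse of the length. -/
theorem dirichlet_comp_mul {c ℓ : ℝ} (hc : 0 < c) (hℓ : 0 ≤ ℓ) {f f' : ℝ → ℝ}
    (h : Sobolev (c * ℓ) f) (h' : Sobolev (c * ℓ) f') :
    dirichlet ℓ (fun t => f (c * t)) (fun t => f' (c * t)) = c * dirichlet (c * ℓ) f f' := by
  obtain ⟨g, h⟩ := h
  obtain ⟨g', h'⟩ := h'
  rw [dirichlet_eq hℓ (h.comp_mul hc) (h'.comp_mul hc), dirichlet_eq (mul_nonneg hc.le hℓ) h h',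
    setIntegral_Ioo_eq hℓ, setIntegral_Ioo_eq (mul_nonneg hc.le hℓ)]
  have := intervalIntegral.smul_integral_comp_mul_left (fun t => g t * g' t) c (a := 0) (b := ℓ)
  rw [mul_zero] at this
  rw [← this, smul_eq_mul, ← intervalIntegral.integral_const_mul,
    ← intervalIntegral.integral_const_mul]
  congr 1
  ext t
  ring

theorem HasSobolevDeriv.left {a b : ℝ} (hb : 0 ≤ b) {f g : ℝ → ℝ}
    (h : HasSobolevDeriv (a + b) f g) : HasSobolevDeriv a f g :=
  ⟨h.1.mono_measure (Measure.restrict_mono (Ioo_subset_Ioo_right (by linarith)) le_rfl),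
    fun x hx => h.2 x ⟨hx.1, by linarith [hx.2]⟩⟩

theorem map_add_left_restrict_Ioo (a b : ℝ) :
    (volume.restrict (Ioo 0 b)).map (fun t => a + t) = volume.restrict (Ioo a (a + b)) := by
  have hm : MeasurableEmbedding (fun t : ℝ => a + t) :=
    (Homeomorph.addLeft a).measurableEmbedding
  have hpre : (fun t : ℝ => a + t) ⁻¹' Ioo a (a + b) = Ioo 0 b := by
    ext t
    simp
  rw [← hpre, ← hm.restrict_map, map_add_left_eq_self]

theorem HasSobolevDeriv.right {a b : ℝ} (ha : 0 ≤ a) {f g : ℝ → ℝ}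
    (h : HasSobolevDeriv (a + b) f g) :
    HasSobolevDeriv b (fun t => f (a + t)) (fun t => g (a + t)) := by
  refine ⟨?_, fun x hx => ?_⟩
  · have hm : MemLp g 2 (volume.restrict (Ioo a (a + b))) :=
      h.1.mono_measure (Measure.restrict_mono (Ioo_subset_Ioo_left ha) le_rfl)
    rw [← map_add_left_restrict_Ioo] at hm
    exact (memLp_map_measure_iff hm.1 (by fun_prop)).1 hm
  · have e := h.sub_eq (x := a + 0) (y := a + x) ⟨by simpa, by linarith [hx.1, hx.2]⟩
      ⟨by linarith [hx.1], by linarith [hx.2]⟩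
    rw [intervalIntegral.integral_comp_add_left (fun t => g t)]
    linarith

/-- Continuous Sobolev functions on adjacent intervals with a common value can be concatenated. -/
theorem HasSobolevDeriv.concat {a b : ℝ} (ha : 0 ≤ a) {f g₁ g₂ : ℝ → ℝ}
    (h₁ : HasSobolevDeriv a f g₁) (h₂ : HasSobolevDeriv b (fun t => f (a + t)) g₂) :
    HasSobolevDeriv (a + b) f ((Iio a).piecewise g₁ fun t => g₂ (t - a)) := by
  classical
  have hm : MemLp (fun t => g₂ (t - a)) 2 (volume.restrict (Ioo a (a + b))) := by
    rw [← map_add_left_restrict_Ioo]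
    refine (memLp_map_measure_iff ?_ (by fun_prop)).2 ?_
    · rw [map_add_left_restrict_Ioo]
      have hg := h₂.1.1
      have e : volume.restrict (Ioo 0 b) =
          (volume.restrict (Ioo a (a + b))).map (fun t => t - a) := by
        rw [← map_add_left_restrict_Ioo, Measure.map_map (by fun_prop) (by fun_prop)]
        simp [Function.comp_def]
      rw [e] at hg
      exact hg.comp_measurable (by fun_prop)
    · simpa [Function.comp_def] using h₂.1
  have hmem : MemLp ((Iio a).piecewise g₁ fun t => g₂ (t - a)) 2
      (volume.restrict (Ioo 0 (a + b))) := by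
    refine MemLp.piecewise measurableSet_Iio ?_ ?_
    · rw [Measure.restrict_restrict measurableSet_Iio]
      exact h₁.1.mono_measure (Measure.restrict_mono
        (show Iio a ∩ Ioo 0 (a + b) ⊆ Ioo 0 a from fun t ht => ⟨ht.2.1, ht.1⟩) le_rfl)
    · rw [Measure.restrict_restrict measurableSet_Iio.compl]
      refine hm.mono_measure ?_
      rw [restrict_Ioo_eq_restrict_Ico]
      exact Measure.restrict_mono (show (Iio a)ᶜ ∩ Ioo 0 (a + b) ⊆ Ico a (a + b) from
        fun t ht => ⟨not_lt.1 ht.1, ht.2.2⟩) le_rfl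
  have hleft : ∀ x ∈ Icc 0 a, ∫ t in 0..x, (Iio a).piecewise g₁ (fun t => g₂ (t - a)) t =
      ∫ t in 0..x, g₁ t := by
    intro x hx
    refine intervalIntegral.integral_congr_ae ?_
    filter_upwards [Measure.ae_ne volume a] with t ht htx
    rw [uIoc_of_le hx.1] at htx
    exact piecewise_eq_of_mem _ _ _ (lt_of_le_of_ne (htx.2.trans hx.2) ht)
  refine ⟨hmem, fun x hx => ?_⟩
  rcases le_total x a with hxa | hxa
  · rw [hleft x ⟨hx.1, hxa⟩]
    exact h₁.2 x ⟨hx.1, hxa⟩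
  · have h0 : (0 : ℝ) ∈ Icc 0 (a + b) := ⟨le_rfl, hx.1.trans hx.2⟩
    have haI : a ∈ Icc 0 (a + b) := ⟨ha, hxa.trans hx.2⟩
    rw [← intervalIntegral.integral_add_adjacent_intervals
      (intervalIntegrable_of_memLp hmem h0 haI) (intervalIntegrable_of_memLp hmem haI hx),
      hleft a ⟨ha, le_rfl⟩, ← add_assoc, ← h₁.2 a ⟨ha, le_rfl⟩]
    have e1 : ∫ t in a..x, (Iio a).piecewise g₁ (fun t => g₂ (t - a)) t =
        ∫ t in a..x, g₂ (t - a) := by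
      refine intervalIntegral.integral_congr fun t ht => ?_
      rw [uIcc_of_le hxa] at ht
      exact piecewise_eq_of_notMem _ _ _ (by simpa using ht.1)
    have e2 := h₂.2 (x - a) ⟨by linarith, by linarith [hx.2]⟩
    rw [e1, intervalIntegral.integral_comp_sub_right (fun t => g₂ t), sub_self]
    simpa using e2

theorem sobolev_add_iff {a b : ℝ} (ha : 0 ≤ a) (hb : 0 ≤ b) {f : ℝ → ℝ} :
    Sobolev (a + b) f ↔ Sobolev a f ∧ Sobolev b (fun t => f (a + t)) :=
  ⟨fun ⟨_, h⟩ => ⟨⟨_, h.left hb⟩, ⟨_, h.right ha⟩⟩, fun ⟨⟨_, h₁⟩, ⟨_, h₂⟩⟩ => ⟨_, h₁.concat ha h₂⟩⟩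

/-- The Dirichlet integral is additive over adjacent intervals. -/
theorem dirichlet_add_length {a b : ℝ} (ha : 0 ≤ a) (hb : 0 ≤ b) {f : ℝ → ℝ}
    (h : Sobolev (a + b) f) : dirichlet (a + b) f f =
      dirichlet a f f + dirichlet b (fun t => f (a + t)) (fun t => f (a + t)) := by
  obtain ⟨g, h⟩ := h
  have hi : IntegrableOn (fun t => g t * g t) (Ioo 0 (a + b)) := h.1.integrable_mul h.1
  rw [← integrableOn_Ioc_iff_integrableOn_Ioo] at hi
  rw [dirichlet_eq (add_nonneg ha hb) h h, dirichlet_eq ha (h.left hb) (h.left hb),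
    dirichlet_eq hb (h.right ha) (h.right ha), setIntegral_Ioo_eq (add_nonneg ha hb),
    setIntegral_Ioo_eq ha, setIntegral_Ioo_eq hb,
    intervalIntegral.integral_comp_add_left (fun t => g t * g t), add_zero,
    intervalIntegral.integral_add_adjacent_intervals]
  · rw [intervalIntegrable_iff, uIoc_of_le ha]
    exact hi.mono_set (Ioc_subset_Ioc_right (by linarith))
  · rw [intervalIntegrable_iff, uIoc_of_le (by linarith)]
    exact hi.mono_set (Ioc_subset_Ioc_left ha)

/-- Completeness of the Dirichlet norm, in the form of a closedness property: a pointwise limit of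
a sequence of Sobolev functions that is Cauchy for the Dirichlet norm is a limit for this norm. -/
theorem Sobolev.of_tendsto {ℓ : ℝ} (hℓ : 0 ≤ ℓ) {s : ℕ → ℝ → ℝ} {f : ℝ → ℝ}
    (hs : ∀ n, Sobolev ℓ (s n))
    (hC : ∀ ε > 0, ∃ N, ∀ m ≥ N, ∀ n ≥ N, dirichlet ℓ (s m - s n) (s m - s n) < ε)
    (hf : ∀ x ∈ Icc 0 ℓ, Tendsto (fun n => s n x) atTop (𝓝 (f x))) :
    Sobolev ℓ f ∧ Tendsto (fun n => dirichlet ℓ (s n - f) (s n - f)) atTop (𝓝 0) := by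
  choose g hg using hs
  let G : ℕ → Lp ℝ 2 (volume.restrict (Ioo 0 ℓ)) := fun n => (hg n).1.toLp
  have norm_eq : ∀ {h : ℝ → ℝ} (hh : MemLp h 2 (volume.restrict (Ioo 0 ℓ))),
      ‖hh.toLp‖ ^ 2 = ∫ t in Ioo 0 ℓ, h t * h t := by
    intro h hh
    rw [← real_inner_self_eq_norm_sq, L2.inner_def]
    refine integral_congr_ae ?_
    filter_upwards [hh.coeFn_toLp] with t ht
    rw [ht]
    simp [sq]
  have hcau : CauchySeq G := by
    rw [Metric.cauchySeq_iff]
    intro ε hε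
    obtain ⟨N, hN⟩ := hC (ε ^ 2) (by positivity)
    refine ⟨N, fun m hm n hn => ?_⟩
    have := hN m hm n hn
    rw [dirichlet_eq hℓ ((hg m).sub (hg n)) ((hg m).sub (hg n)),
      ← norm_eq ((hg m).1.sub (hg n).1), MemLp.toLp_sub (hg m).1 (hg n).1, ← dist_eq_norm] at this
    exact lt_of_pow_lt_pow_left₀ 2 hε.le this
  obtain ⟨L, hL⟩ := cauchySeq_tendsto_of_complete hcau
  have hLm : MemLp L 2 (volume.restrict (Ioo 0 ℓ)) := Lp.memLp L
  have hint : Tendsto (fun n => ∫ t in Ioo 0 ℓ, (g n - L) t * (g n - L) t) atTop (𝓝 0) := by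
    have h1 : ∀ n, ∫ t in Ioo 0 ℓ, (g n - L) t * (g n - L) t = ‖G n - L‖ ^ 2 := by
      intro n
      rw [← norm_eq ((hg n).1.sub hLm), MemLp.toLp_sub (hg n).1 hLm, Lp.toLp_coeFn]
    simp only [h1]
    have h2 := (tendsto_iff_norm_sub_tendsto_zero.1 hL).pow 2
    simpa using h2
  have hfL : HasSobolevDeriv ℓ f L := by
    refine ⟨hLm, fun x hx => ?_⟩
    have h0 : (0 : ℝ) ∈ Icc 0 ℓ := ⟨le_rfl, hx.1.trans hx.2⟩
    have hlim : Tendsto (fun n => ∫ t in 0..x, g n t) atTop (𝓝 (∫ t in 0..x, L t)) := by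
      rw [tendsto_iff_norm_sub_tendsto_zero]
      have hsq : Tendsto (fun n => √(ℓ * ∫ t in Ioo 0 ℓ, (g n - L) t * (g n - L) t)) atTop
          (𝓝 0) := by
        have := (hint.const_mul ℓ).sqrt
        simpa using this
      refine squeeze_zero (fun _ => norm_nonneg _) (fun n => ?_) hsq
      refine Real.le_sqrt_of_sq_le ?_
      rw [Real.norm_eq_abs, sq_abs, ← intervalIntegral.integral_sub
        (intervalIntegrable_of_memLp (hg n).1 h0 hx) (intervalIntegrable_of_memLp hLm h0 hx)]
      exact sq_intervalIntegral_le ((hg n).1.sub hLm) h0 hx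
    have h1 := (hf x hx).sub (hf 0 h0)
    have h2 : ∀ n, s n x - s n 0 = ∫ t in 0..x, g n t := fun n => by
      rw [(hg n).2 x hx]
      ring
    simp only [h2] at h1
    linarith [tendsto_nhds_unique h1 hlim]
  refine ⟨⟨L, hfL⟩, ?_⟩
  simp only [fun n => dirichlet_eq hℓ ((hg n).sub hfL) ((hg n).sub hfL)]
  exact hint

/-! ### Barycentric coordinates and the first-level decomposition of the attractor -/

/-- The barycentric coordinates of the plane with respect to the three corners. -/
noncomputable def bary (i : Fin 3) (x : Plane) : ℝ :=
  ![1 - x 0 - x 1 / √3, 2 * (x 1 / √3), x 0 - x 1 / √3] i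

theorem continuous_bary (i : Fin 3) : Continuous (bary i) := by
  have h0 : Continuous fun x : Plane => x 0 := by fun_prop
  have h1 : Continuous fun x : Plane => x 1 / √3 := by fun_prop
  fin_cases i
  · exact (continuous_const.sub h0).sub h1
  · exact continuous_const.mul h1
  · exact h0.sub h1

theorem bary_sum (j : Fin 3) (x : Plane) : bary j x + bary (j + 1) x + bary (j + 2) x = 1 := by
  fin_cases j <;> simp [bary] <;> ring

theorem bary_ext {x y : Plane} (h : ∀ i, bary i x = bary i y) : x = y := by
  have h3 : √3 ≠ 0 := by positivity
  have h1 := h 1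
  have h2 := h 2
  simp only [bary, Matrix.cons_val_one, Matrix.cons_val_zero, Matrix.cons_val] at h1 h2
  have e1 : x 1 / √3 = y 1 / √3 := by linarith
  have e0 : x 0 = y 0 := by linarith
  have e2 : x 1 = y 1 := by field_simp at e1; exact e1
  ext i
  fin_cases i
  · exact e0
  · exact e2

theorem bary_corner (i k : Fin 3) : bary i (corner k) = if i = k then 1 else 0 := by
  have h3 : √3 ≠ 0 := by positivity
  fin_cases i <;> fin_cases k <;> simp [bary, corner] <;> field_simp <;> norm_num

theorem bary_simil (α : ℝ) (i k : Fin 3) (x : Plane) :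
    bary k (simil α i x) = ratio α * bary k x + (1 - ratio α) * bary k (corner i) := by
  fin_cases k <;> simp [bary, simil] <;> ring

theorem bary_add_smul_sideDir (j : Fin 3) (x : Plane) (t : ℝ) :
    bary j (x + t • sideDir j) = bary j x ∧ bary (j + 1) (x + t • sideDir j) = bary (j + 1) x - t ∧
      bary (j + 2) (x + t • sideDir j) = bary (j + 2) x + t := by
  have h3 : √3 ≠ 0 := by positivity
  fin_cases j <;> refine ⟨?_, ?_, ?_⟩ <;> simp [bary, sideDir, corner] <;> field_simp <;> ring

theorem bary_flat (α : ℝ) (j : Fin 3) (x : Plane) :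
    bary j (flat α j x) = 0 ∧
      bary (j + 1) (flat α j x) = ratio α + α * (bary (j + 1) x + bary j x / 2) := by
  have h3 : √3 * √3 = 3 := Real.mul_self_sqrt (by norm_num)
  have h3' : √3 ≠ 0 := by positivity
  have hz : ∃ z, x 1 = √3 * z := ⟨x 1 / √3, by field_simp⟩
  obtain ⟨z, hz⟩ := hz
  fin_cases j <;> refine ⟨?_, ?_⟩ <;>
    simp [bary, flat, flatMatrix, sideMid, corner, ratio, Matrix.toLpLin_apply, Matrix.vecHead,
      Matrix.vecTail, hz] <;>
    field_simp <;> ring_nf <;> (try simp only [Real.sq_sqrt (show (0:ℝ) ≤ 3 by norm_num)]) <;>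
    ring_nf

/-- The parameters `0 < α ≤ 1` of the Hanoi attractors. -/
class Admissible (α : ℝ) : Prop where
  pos : 0 < α
  le_one : α ≤ 1

section

variable {α : ℝ}

theorem ratio_pos (h : α < 1) : 0 < ratio α := by
  unfold ratio
  linarith

theorem two_ratio_add : 2 * ratio α + α = 1 := by
  unfold ratio
  ring

theorem exists_cases (j k : Fin 3) : k = j ∨ k = j + 1 ∨ k = j + 2 := by
  revert j k
  decide

theorem joinLength_nil : joinLength α [] = α := by
  simp [joinLength]

theorem joinLength_cons (i : Fin 3) (w : List (Fin 3)) :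
    joinLength α (i :: w) = ratio α * joinLength α w := by
  simp only [joinLength, List.length_cons, pow_succ]
  ring

theorem bary_joinCurve (j : Fin 3) (t : ℝ) : bary j (joinCurve α [] j t) = 0 ∧
    bary (j + 1) (joinCurve α [] j t) = 1 - ratio α - t ∧
    bary (j + 2) (joinCurve α [] j t) = ratio α + t := by
  obtain ⟨h1, h2, h3⟩ := bary_add_smul_sideDir j (simil α (j + 1) (corner (j + 2))) t
  have hne : ∀ j : Fin 3, j ≠ j + 2 ∧ j ≠ j + 1 ∧ j + 1 ≠ j + 2 := by decide
  simp only [joinCurve, wordMap, id_eq]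
  rw [h1, h2, h3]
  simp only [bary_simil, bary_corner, if_neg (hne j).1, if_neg (hne j).2.1, if_neg (hne j).2.2,
    if_neg (hne j).2.2.symm, if_true]
  refine ⟨by ring, by ring, by ring⟩

theorem continuous_cellMap (i : Fin 3) : Continuous (cellMap α i) :=
  ((continuous_simil α i).comp continuous_subtype_val).subtype_mk _

theorem along_eq (u : attractor α → ℝ) {γ : ℝ → Plane} {t : ℝ} (h : γ t ∈ attractor α) :
    along u γ t = u ⟨γ t, h⟩ :=
  dif_pos h

theorem sideCurve_nil (j : Fin 3) (t : ℝ) : sideCurve α [] j t = sidePoint j t := rfl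

theorem continuousOn_along {u : attractor α → ℝ} (hu : Continuous u) {γ : ℝ → Plane} {s : Set ℝ}
    (hγ : Continuous γ) (hs : ∀ t ∈ s, γ t ∈ attractor α) : ContinuousOn (along u γ) s := by
  rw [continuousOn_iff_continuous_domRestrict]
  have : s.domRestrict (along u γ) = fun t : s => u ⟨γ t, hs t t.2⟩ := by
    ext t
    simp [domRestrict, along, hs t t.2]
  rw [this]
  exact hu.comp ((hγ.comp continuous_subtype_val).subtype_mk _)

theorem along_comp_cellMap (u : attractor α → ℝ) {γ γ' : ℝ → Plane} {i : Fin 3} {t t' : ℝ}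
    (h : γ t ∈ attractor α) (he : γ' t' = simil α i (γ t)) :
    along (u ∘ cellMap α i) γ t = along u γ' t' := by
  rw [along_eq _ h, along_eq u (γ := γ') (t := t') (he ▸ simil_mem i h)]
  simp only [Function.comp, cellMap, he]

/-- The middle part of a side of the triangle is a joining segment. -/
theorem onSide_middle (u : attractor α → ℝ) (j : Fin 3) (t : ℝ) :
    onJoin u [] j t = onSide u [] j (ratio α + t) := by
  have : joinCurve α [] j t = sideCurve α [] j (ratio α + t) := by
    simp only [joinCurve, sideCurve, wordMap, id_eq, simil, sideDir]
    module
  simp only [onJoin, onSide, along]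
  congr!

theorem simil_injective (h1 : α < 1) (i : Fin 3) : Function.Injective (simil α i) := by
  intro x y hxy
  simp only [simil, add_left_inj] at hxy
  simpa using smul_right_injective Plane (ratio_pos h1).ne' hxy

variable [hα : Admissible α]

theorem ratio_nonneg : 0 ≤ ratio α := by
  have := hα.le_one
  unfold ratio
  linarith

theorem ratio_lt_half : ratio α < 1 / 2 := by
  have := hα.pos
  unfold ratio
  linarith

theorem bary_nonneg {x : Plane} (hx : x ∈ attractor α) (i : Fin 3) : 0 ≤ bary i x := by
  have hX := attractor_isForwardInvariant hα.pos hα.le_one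
  have hr0 : 0 ≤ ratio α := ratio_nonneg
  have hr1 : ratio α < 1 / 2 := ratio_lt_half
  have hcor : ∀ i k, 0 ≤ bary i (corner k) := fun i k => by
    rw [bary_corner]
    split_ifs <;> norm_num
  have hcl : IsClosed {x : Plane | ∀ i, 0 ≤ bary i x} := by
    simp only [ofPred_forall]
    exact isClosed_iInter fun i => isClosed_le continuous_const (continuous_bary i)
  have hT : IsForwardInvariant α (attractor α ∩ {x | ∀ i, 0 ≤ bary i x}) := by
    refine ⟨hX.1.inter_right hcl, ⟨corner 0, ?_, fun i => hcor i 0⟩, ?_, ?_⟩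
    · exact fun C hC => corner_mem_of_invariant hα.pos hα.le_one hC 0
    · rintro i x ⟨hx, hb⟩
      refine ⟨hX.2.2.1 i hx, fun k => ?_⟩
      rw [bary_simil]
      exact add_nonneg (mul_nonneg hr0 (hb k)) (mul_nonneg (by linarith) (hcor k i))
    · rintro j x ⟨hx, hb⟩
      refine ⟨hX.2.2.2 j hx, fun k => ?_⟩
      obtain ⟨h1, h2⟩ := bary_flat α j x
      have h3 := bary_sum j (flat α j x)
      have h4 := bary_sum j x
      have h5 : 0 ≤ α * (bary (j + 1) x + bary j x / 2) :=
        mul_nonneg hα.pos.le (by linarith [hb j, hb (j + 1)])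
      have h6 : α * (bary (j + 1) x + bary j x / 2) ≤ α * 1 :=
        mul_le_mul_of_nonneg_left (by linarith [hb j, hb (j + 1), hb (j + 2)]) hα.pos.le
      have h7 := two_ratio_add (α := α)
      have hk : ∀ j k : Fin 3, k = j ∨ k = j + 1 ∨ k = j + 2 := by decide
      rcases hk j k with rfl | rfl | rfl <;> linarith
  exact (hx _ hT).2 i

theorem eq_corner_of_bary_eq_one {x : Plane} (hx : x ∈ attractor α) {i : Fin 3}
    (h : bary i x = 1) : x = corner i := by
  have h1 := bary_sum i x
  have h2 := bary_nonneg hx (i + 1)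
  have h3 := bary_nonneg hx (i + 2)
  refine bary_ext fun k => ?_
  have hne : ∀ i : Fin 3, i + 1 ≠ i ∧ i + 2 ≠ i := by decide
  rcases exists_cases i k with rfl | rfl | rfl
  · simp [bary_corner, h]
  · rw [bary_corner, if_neg (hne i).1]
    linarith
  · rw [bary_corner, if_neg (hne i).2]
    linarith

instance : CompactSpace (attractor α) :=
  isCompact_iff_compactSpace.1 (attractor_spec hα.pos hα.le_one).1

variable (α) in
/-- The corners as points of the attractor. -/
noncomputable def vertex (i : Fin 3) : attractor α :=
  ⟨corner i, fun _ hC => corner_mem_of_invariant hα.pos hα.le_one hC i⟩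

theorem joinLength_nonneg (w : List (Fin 3)) : 0 ≤ joinLength α w :=
  mul_nonneg hα.pos.le (pow_nonneg ratio_nonneg _)

theorem joinCurve_mem_nil {j : Fin 3} {t : ℝ} (ht : t ∈ Icc 0 α) :
    joinCurve α [] j t ∈ attractor α :=
  joinCurve_mem hα.pos hα.le_one [] j (by rwa [joinLength_nil])

/-- The first-level decomposition of the attractor into three cells and three segments. -/
theorem exists_cell_or_join (x : attractor α) :
    (∃ i y, x = cellMap α i y) ∨ ∃ j, ∃ t ∈ Icc 0 α, (x : Plane) = joinCurve α [] j t := by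
  obtain ⟨-, -, hX⟩ := attractor_spec hα.pos hα.le_one
  have hx := hX.subset x.2
  rcases hx with hx | hx
  · obtain ⟨i, y, hy, hxy⟩ := mem_iUnion.1 hx
    exact Or.inl ⟨i, ⟨y, hy⟩, Subtype.ext hxy.symm⟩
  · obtain ⟨j, y, hy, hxy⟩ := mem_iUnion.1 hx
    right
    have h7 := two_ratio_add (α := α)
    refine ⟨j, α * (1 - (bary (j + 1) y + bary j y / 2)), ⟨?_, ?_⟩, ?_⟩
    · refine mul_nonneg hα.pos.le ?_
      linarith [bary_nonneg hy j, bary_nonneg hy (j + 2), bary_sum j y]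
    · refine mul_le_of_le_one_right hα.pos.le ?_
      linarith [bary_nonneg hy j, bary_nonneg hy (j + 1)]
    · rw [← hxy]
      obtain ⟨h1, h2⟩ := bary_flat α j y
      obtain ⟨h3, h4, h5⟩ := bary_joinCurve (α := α) j
        (α * (1 - (bary (j + 1) y + bary j y / 2)))
      have h6 := bary_sum j (flat α j y)
      refine bary_ext fun k => ?_
      rcases exists_cases j k with rfl | rfl | rfl <;> linarith

/-! ### Functions along the segments -/

theorem continuousOn_onSide {u : attractor α → ℝ} (hu : Continuous u) (w : List (Fin 3))
    (j : Fin 3) : ContinuousOn (onSide u w j) (Icc 0 (ratio α ^ w.length)) :=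
  continuousOn_along hu (by unfold sideCurve; fun_prop)
    fun _ ht => sideCurve_mem hα.pos hα.le_one w j ht

theorem continuousOn_onJoin {u : attractor α → ℝ} (hu : Continuous u) (w : List (Fin 3))
    (j : Fin 3) : ContinuousOn (onJoin u w j) (Icc 0 (joinLength α w)) :=
  continuousOn_along hu (by unfold joinCurve; fun_prop)
    fun _ ht => joinCurve_mem hα.pos hα.le_one w j ht

theorem onJoin_comp_cellMap (u : attractor α → ℝ) (i : Fin 3) (w : List (Fin 3)) (j : Fin 3) :
    EqOn (onJoin (u ∘ cellMap α i) w j) (fun t => onJoin u (i :: w) j (ratio α * t))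
      (Icc 0 (joinLength α w)) := fun t ht =>
  along_comp_cellMap u (joinCurve_mem hα.pos hα.le_one w j ht) (by
    simp only [joinCurve, wordMap, Function.comp, simil]
    module)

theorem onSide_comp_cellMap (u : attractor α → ℝ) (i : Fin 3) (w : List (Fin 3)) (j : Fin 3) :
    EqOn (onSide (u ∘ cellMap α i) w j) (fun t => onSide u (i :: w) j (ratio α * t))
      (Icc 0 (ratio α ^ w.length)) := fun t ht =>
  along_comp_cellMap u (sideCurve_mem hα.pos hα.le_one w j ht) (by
    simp only [sideCurve, wordMap, Function.comp, simil]
    module)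

theorem sideCurve_nil_mem (j : Fin 3) {t : ℝ} (ht : t ∈ Icc (0 : ℝ) 1) :
    sideCurve α [] j t ∈ attractor α :=
  sideCurve_mem hα.pos hα.le_one [] j (by simpa using ht)

/-- The first part of a side of the triangle is a side of a cell. -/
theorem onSide_left (u : attractor α → ℝ) (j : Fin 3) :
    EqOn (onSide (u ∘ cellMap α (j + 1)) [] j) (fun t => onSide u [] j (ratio α * t))
      (Icc 0 1) := fun t ht =>
  along_comp_cellMap u (sideCurve_nil_mem j ht) (by
    rw [sideCurve_nil, sideCurve_nil, simil_sidePoint_left])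

/-- The last part of a side of the triangle is a side of a cell. -/
theorem onSide_right (u : attractor α → ℝ) (j : Fin 3) :
    EqOn (onSide (u ∘ cellMap α (j + 2)) [] j)
      (fun t => onSide u [] j (ratio α + (α + ratio α * t))) (Icc 0 1) := fun t ht =>
  along_comp_cellMap u (sideCurve_nil_mem j ht) (by
    rw [sideCurve_nil, sideCurve_nil, simil_sidePoint_right]
    congr 1
    linarith [two_ratio_add (α := α)])

theorem onSide_zero (u : attractor α → ℝ) (j : Fin 3) :
    onSide u [] j 0 = u (vertex α (j + 1)) := by
  rw [onSide, along_eq _ (sideCurve_nil_mem j ⟨le_rfl, zero_le_one⟩)]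
  congr 1
  ext1
  simp [sideCurve, wordMap, vertex]

theorem onSide_one (u : attractor α → ℝ) (j : Fin 3) :
    onSide u [] j 1 = u (vertex α (j + 2)) := by
  rw [onSide, along_eq _ (sideCurve_nil_mem j ⟨zero_le_one, le_rfl⟩)]
  congr 1
  ext1
  simp [sideCurve, wordMap, vertex, sideDir]

theorem onJoin_zero (u : attractor α → ℝ) (j : Fin 3) :
    onJoin u [] j 0 = u (cellMap α (j + 1) (vertex α (j + 2))) := by
  have h := onSide_left u j (x := 1) ⟨zero_le_one, le_rfl⟩
  rw [onSide_one] at h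
  rw [onSide_middle, add_zero]
  simpa using h.symm

theorem onJoin_end (u : attractor α → ℝ) (j : Fin 3) :
    onJoin u [] j α = u (cellMap α (j + 2) (vertex α (j + 1))) := by
  have h := onSide_right u j (x := 0) ⟨le_rfl, zero_le_one⟩
  rw [onSide_zero] at h
  rw [onSide_middle]
  simpa using h.symm

theorem cellMap_vertex (i : Fin 3) : cellMap α i (vertex α i) = vertex α i := by
  ext1
  simp [cellMap, vertex, simil]

/-! ### Gluing -/

theorem bary_simil_self_ge {i : Fin 3} {x : Plane} (hx : x ∈ attractor α) :
    1 - ratio α ≤ bary i (simil α i x) := by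
  rw [bary_simil, bary_corner, if_pos rfl]
  linarith [mul_nonneg (ratio_nonneg (α := α)) (bary_nonneg hx i)]

/-- Continuous functions on the three cells and on the three segments between them that agree at
the six common points define a continuous function on the attractor. -/
theorem exists_glue (h1 : α < 1) {v : Fin 3 → attractor α → ℝ} (hv : ∀ i, Continuous (v i))
    {g : Fin 3 → ℝ → ℝ} (hg : ∀ j, ContinuousOn (g j) (Icc 0 α))
    (h_zero : ∀ j, g j 0 = v (j + 1) (vertex α (j + 2)))
    (h_end : ∀ j, g j α = v (j + 2) (vertex α (j + 1))) :
    ∃ u : attractor α → ℝ, Continuous u ∧ (∀ i, u ∘ cellMap α i = v i) ∧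
      ∀ j, EqOn (onJoin u [] j) (g j) (Icc 0 α) := by
  have hr0 : 0 < ratio α := ratio_pos h1
  have hr1 : ratio α < 1 / 2 := ratio_lt_half
  have hra := two_ratio_add (α := α)
  -- the attractor is a quotient of the disjoint union of the pieces
  let π : (Fin 3 × attractor α) ⊕ (Fin 3 × Icc 0 α) → attractor α :=
    Sum.elim (fun p => cellMap α p.1 p.2) fun p => ⟨joinCurve α [] p.1 p.2, joinCurve_mem_nil p.2.2⟩
  let φ : (Fin 3 × attractor α) ⊕ (Fin 3 × Icc 0 α) → ℝ :=
    Sum.elim (fun p => v p.1 p.2) fun p => g p.1 p.2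
  have hπc : Continuous π := by
    refine continuous_sum_dom.2 ⟨?_, ?_⟩
    · exact continuous_prod_of_discrete_left.2 fun i => continuous_cellMap i
    · refine continuous_prod_of_discrete_left.2 fun j => ?_
      refine Continuous.subtype_mk ?_ _
      simp only [joinCurve]
      fun_prop
  have hφc : Continuous φ := by
    refine continuous_sum_dom.2 ⟨?_, ?_⟩
    · exact continuous_prod_of_discrete_left.2 fun i => hv i
    · exact continuous_prod_of_discrete_left.2 fun j =>
        continuousOn_iff_continuous_domRestrict.1 (hg j)
  have hπs : Function.Surjective π := by
    intro x
    rcases exists_cell_or_join x with ⟨i, y, h⟩ | ⟨j, t, ht, h⟩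
    · exact ⟨Sum.inl (i, y), h.symm⟩
    · exact ⟨Sum.inr (j, ⟨t, ht⟩), Subtype.ext h.symm⟩
  have cell_join : ∀ (i : Fin 3) (x : attractor α) (j : Fin 3) (t : ℝ), t ∈ Icc 0 α →
      simil α i x = joinCurve α [] j t → v i x = g j t := by
    intro i x j t ht hxt
    obtain ⟨b0, b1, b2⟩ := bary_joinCurve (α := α) j t
    have hge := bary_simil_self_ge (α := α) (i := i) x.2
    have hne : ∀ j : Fin 3, j + 1 ≠ j + 2 := by decide
    rcases exists_cases j i with rfl | rfl | rfl
    · rw [hxt, b0] at hge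
      linarith
    · have ht0 : t = 0 := by
        rw [hxt, b1] at hge
        linarith [ht.1]
      rw [← hxt, bary_simil, bary_corner, if_neg (hne j).symm, ht0] at b2
      have hb : bary (j + 2) (x : Plane) = 1 := by
        have : ratio α * (bary (j + 2) (x : Plane) - 1) = 0 := by linarith
        rcases mul_eq_zero.1 this with h | h <;> linarith
      have hx : x = vertex α (j + 2) := Subtype.ext (eq_corner_of_bary_eq_one x.2 hb)
      rw [hx, ht0, h_zero]
    · have ht0 : t = α := by
        rw [hxt, b2] at hge
        linarith [ht.2]
      rw [← hxt, bary_simil, bary_corner, if_neg (hne j), ht0] at b1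
      have hb : bary (j + 1) (x : Plane) = 1 := by
        have : ratio α * (bary (j + 1) (x : Plane) - 1) = 0 := by linarith
        rcases mul_eq_zero.1 this with h | h <;> linarith
      have hx : x = vertex α (j + 1) := Subtype.ext (eq_corner_of_bary_eq_one x.2 hb)
      rw [hx, ht0, h_end]
  have hfac : Function.FactorsThrough φ π := by
    rintro (⟨i, x⟩ | ⟨j, t⟩) (⟨k, y⟩ | ⟨l, s⟩) h <;> replace h := congrArg Subtype.val h
    · change simil α i x = simil α k y at h
      have hik : i = k := by
        by_contra hne
        have h2 := bary_simil_self_ge (α := α) (i := i) x.2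
        have h3 := bary_simil_self_ge (α := α) (i := k) y.2
        rw [← h] at h3
        have h4 : ∀ m, 0 ≤ bary m (simil α i x) := fun m => bary_nonneg (simil_mem i x.2) m
        have h5 := bary_sum i (simil α i x)
        rcases exists_cases i k with rfl | rfl | rfl
        · exact hne rfl
        · linarith [h4 (i + 2)]
        · linarith [h4 (i + 1)]
      subst hik
      rw [Subtype.ext (simil_injective h1 i h)]
    · exact cell_join i x l s s.2 h
    · exact (cell_join k y j t t.2 h.symm).symm
    · change joinCurve α [] j t = joinCurve α [] l s at h
      obtain ⟨b0, b1, b2⟩ := bary_joinCurve (α := α) j t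
      obtain ⟨c0, c1, c2⟩ := bary_joinCurve (α := α) l s
      rw [← h] at c0 c1 c2
      rcases exists_cases j l with rfl | rfl | rfl
      · rw [Subtype.ext (show (t : ℝ) = s by linarith)]
      · linarith [t.2.2]
      · linarith [t.2.1]
  have hq : IsQuotientMap π := hπc.isClosedMap.isQuotientMap hπc hπs
  let u := hq.lift (f := ⟨π, hπc⟩) ⟨φ, hφc⟩ hfac
  have hu : ∀ p, u (π p) = φ p := fun p =>
    DFunLike.congr_fun (hq.lift_comp (f := ⟨π, hπc⟩) ⟨φ, hφc⟩ hfac) p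
  refine ⟨u, u.continuous, fun i => funext fun x => hu (Sum.inl (i, x)), fun j t ht => ?_⟩
  rw [onJoin, along_eq _ (joinCurve_mem_nil ht)]
  exact hu (Sum.inr (j, ⟨t, ht⟩))

end

/-! ### The energy of the joining segments -/

/-- A sum over the joining segments, split according to the first letter of the cell. -/
theorem hasSum_words {f : List (Fin 3) × Fin 3 → ℝ} {a : Fin 3 → ℝ}
    (h : ∀ i, HasSum (fun e : List (Fin 3) × Fin 3 => f (i :: e.1, e.2)) (a i)) :
    HasSum f (∑ i, a i + ∑ j, f ([], j)) := by
  have hinj : ∀ i : Fin 3, Function.Injective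
      (fun e : List (Fin 3) × Fin 3 => ((i :: e.1, e.2) : List (Fin 3) × Fin 3)) := by
    rintro i ⟨w, j⟩ ⟨w', j'⟩ h
    simpa using h
  have hinj0 : Function.Injective (fun j : Fin 3 => (([], j) : List (Fin 3) × Fin 3)) := by
    intro j j' h
    simpa using h
  have h1 := hasSum_sum fun i (_ : i ∈ Finset.univ) => (hasSum_extend_zero (hinj i)).2 (h i)
  have h2 := (hasSum_extend_zero hinj0).2 (hasSum_fintype fun j => f ([], j))
  refine (h1.add h2).congr_fun ?_
  rintro ⟨w, j⟩
  have hnil : ∀ i j, ¬ ∃ e : List (Fin 3) × Fin 3, ((i :: e.1, e.2) : List (Fin 3) × Fin 3) =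
      ([], j) := by simp
  cases w with
  | nil =>
    rw [hinj0.extend_apply, Finset.sum_eq_zero fun i _ => ?_, zero_add]
    exact Function.extend_apply' _ _ _ (hnil i j)
  | cons k w =>
    rw [Function.extend_apply' (f := fun j : Fin 3 => (([], j) : List (Fin 3) × Fin 3)) _ _ _
      (by simp), Finset.sum_eq_single k, Pi.zero_apply, add_zero]
    · exact ((hinj k).extend_apply (fun e => f (k :: e.1, e.2)) 0 (w, j)).symm
    · intro i _ hik
      exact Function.extend_apply' _ _ _ (by simp [hik])
    · simp

theorem summable_words {f : List (Fin 3) × Fin 3 → ℝ} :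
    Summable f ↔ ∀ i, Summable (fun e : List (Fin 3) × Fin 3 => f (i :: e.1, e.2)) := by
  refine ⟨fun h i => ?_, fun h =>
    (hasSum_words (f := f) fun i => (h i).hasSum).summable⟩
  have hinj : Function.Injective
      (fun e : List (Fin 3) × Fin 3 => ((i :: e.1, e.2) : List (Fin 3) × Fin 3)) := by
    rintro ⟨w, j⟩ ⟨w', j'⟩ h
    simpa using h
  exact h.comp_injective hinj

theorem tsum_words {f : List (Fin 3) × Fin 3 → ℝ} (h : Summable f) :
    ∑' e, f e = ∑ i, ∑' e : List (Fin 3) × Fin 3, f (i :: e.1, e.2) + ∑ j, f ([], j) :=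
  (hasSum_words (f := f) fun i => (summable_words.1 h i).hasSum).tsum_eq

/-- Rescaling of a segment by a factor `r ≥ 0`; for `r = 0` the rescaled function is constant. -/
theorem sobolev_scale_iff {r ℓ : ℝ} (hr : 0 ≤ r) {f f' : ℝ → ℝ}
    (h : EqOn f' (fun t => f (r * t)) (Icc 0 ℓ)) : Sobolev ℓ f' ↔ Sobolev (r * ℓ) f := by
  rcases hr.eq_or_lt with rfl | hr
  · rw [zero_mul]
    refine iff_of_true ?_ ⟨_, hasSobolevDeriv_zero_length f⟩
    exact Sobolev.congr ⟨_, hasSobolevDeriv_const ℓ (f 0)⟩ fun t ht => by simp [h ht]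
  · rw [← sobolev_comp_mul_iff hr]
    exact ⟨fun h' => h'.congr h, fun h' => h'.congr h.symm⟩

theorem dirichlet_scale {r ℓ : ℝ} (hr : 0 ≤ r) (hℓ : 0 ≤ ℓ) {f f' : ℝ → ℝ}
    (h : EqOn f' (fun t => f (r * t)) (Icc 0 ℓ)) (hf : Sobolev (r * ℓ) f) :
    dirichlet ℓ f' f' = r * dirichlet (r * ℓ) f f := by
  have hf' := (sobolev_scale_iff hr h).2 hf
  rw [dirichlet_congr hℓ hf' hf' h h]
  rcases hr.eq_or_lt with rfl | hr
  · have := dirichlet_eq hℓ (hasSobolevDeriv_const ℓ (f 0)) (hasSobolevDeriv_const ℓ (f 0))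
    simpa using this
  · exact dirichlet_comp_mul hr hℓ hf hf

section

variable {α : ℝ}

theorem along_add (u v : attractor α → ℝ) (γ : ℝ → Plane) :
    along (u + v) γ = along u γ + along v γ := by
  ext t
  simp only [along, Pi.add_apply]
  split_ifs <;> simp

theorem along_smul (c : ℝ) (u : attractor α → ℝ) (γ : ℝ → Plane) :
    along (c • u) γ = c • along u γ := by
  ext t
  simp only [along, Pi.smul_apply]
  split_ifs <;> simp

theorem onJoin_add (u v : attractor α → ℝ) (w : List (Fin 3)) (j : Fin 3) :
    onJoin (u + v) w j = onJoin u w j + onJoin v w j :=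
  along_add u v _

theorem onJoin_smul (c : ℝ) (u : attractor α → ℝ) (w : List (Fin 3)) (j : Fin 3) :
    onJoin (c • u) w j = c • onJoin u w j :=
  along_smul c u _

theorem onJoin_sub (u v : attractor α → ℝ) (w : List (Fin 3)) (j : Fin 3) :
    onJoin (u - v) w j = onJoin u w j - onJoin v w j := by
  have := onJoin_add u ((-1 : ℝ) • v) w j
  rw [onJoin_smul] at this
  simpa [sub_eq_add_neg] using this

/-- Continuous functions that are `H¹` on the joining segments, with finite energy. In contrast to
`H1 α`, nothing is required on the sides, so that a function may for instance vary like
the Cantor function on the part of a side that is not covered by joining segments. -/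
def JoinH1 (α : ℝ) : Set (attractor α → ℝ) :=
  {u | Continuous u ∧ (∀ w j, MemH1 (joinLength α w) (onJoin u w j)) ∧
    Summable fun e : List (Fin 3) × Fin 3 => joinEnergy u u e.1 e.2}

theorem mem_H1_iff {u : attractor α → ℝ} :
    u ∈ H1 α ↔ u ∈ JoinH1 α ∧ ∀ w j, MemH1 (ratio α ^ w.length) (onSide u w j) :=
  ⟨fun h => ⟨⟨h.1, h.2.2.1, h.2.2.2⟩, h.2.1⟩, fun h => ⟨h.1.1, h.2, h.1.2.1, h.1.2.2⟩⟩

theorem joinEnergy_comm (u v : attractor α → ℝ) (w : List (Fin 3)) (j : Fin 3) :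
    joinEnergy u v w j = joinEnergy v u w j :=
  dirichlet_comm _ _ _

theorem joinEnergy_self_nonneg (u : attractor α → ℝ) (w : List (Fin 3)) (j : Fin 3) :
    0 ≤ joinEnergy u u w j :=
  dirichlet_self_nonneg _ _

theorem energy_comm (u v : attractor α → ℝ) : energy α u v = energy α v u := by
  simp only [energy, joinEnergy_comm u v]

theorem energy_self_nonneg (u : attractor α → ℝ) : 0 ≤ energy α u u :=
  tsum_nonneg fun _ => joinEnergy_self_nonneg _ _ _

theorem dirichlet_onJoin_nil_le {u : attractor α → ℝ} (hu : u ∈ JoinH1 α) (j : Fin 3) :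
    dirichlet α (onJoin u [] j) (onJoin u [] j) ≤ energy α u u := by
  have := hu.2.2.le_tsum ([], j) fun e _ => joinEnergy_self_nonneg u e.1 e.2
  simpa only [energy, joinEnergy, joinLength_nil] using this

variable [hα : Admissible α]

theorem memH1_onJoin_iff {u : attractor α → ℝ} (hu : Continuous u) (w : List (Fin 3)) (j : Fin 3) :
    MemH1 (joinLength α w) (onJoin u w j) ↔ Sobolev (joinLength α w) (onJoin u w j) :=
  memH1_iff_sobolev (joinLength_nonneg w) (continuousOn_onJoin hu w j)

theorem memH1_onJoin_nil_iff {u : attractor α → ℝ} (hu : Continuous u) (j : Fin 3) :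
    MemH1 α (onJoin u [] j) ↔ Sobolev α (onJoin u [] j) := by
  simpa only [joinLength_nil] using memH1_onJoin_iff hu [] j

theorem JoinH1.sobolev {u : attractor α → ℝ} (hu : u ∈ JoinH1 α) (w : List (Fin 3)) (j : Fin 3) :
    Sobolev (joinLength α w) (onJoin u w j) :=
  (memH1_onJoin_iff hu.1 w j).1 (hu.2.1 w j)

theorem JoinH1.sobolev_nil {u : attractor α → ℝ} (hu : u ∈ JoinH1 α) (j : Fin 3) :
    Sobolev α (onJoin u [] j) := by
  simpa only [joinLength_nil] using JoinH1.sobolev hu [] j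

theorem onJoin_const (c : ℝ) (w : List (Fin 3)) (j : Fin 3) :
    EqOn (fun _ => c) (onJoin (fun _ : attractor α => c) w j) (Icc 0 (joinLength α w)) :=
  fun t ht => by rw [onJoin, along_eq _ (joinCurve_mem hα.pos hα.le_one w j ht)]

theorem joinEnergy_const_left (c : ℝ) {v : attractor α → ℝ} (hv : v ∈ JoinH1 α)
    (w : List (Fin 3)) (j : Fin 3) : joinEnergy (fun _ : attractor α => c) v w j = 0 := by
  obtain ⟨g, hg⟩ := JoinH1.sobolev hv w j
  rw [joinEnergy, dirichlet_eq (joinLength_nonneg w)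
    ((hasSobolevDeriv_const _ c).congr (onJoin_const c w j)) hg]
  simp

theorem const_mem_joinH1 (c : ℝ) : (fun _ : attractor α => c) ∈ JoinH1 α := by
  have h : ∀ w j, HasSobolevDeriv (joinLength α w) (onJoin (fun _ : attractor α => c) w j)
      (fun _ => 0) := fun w j => (hasSobolevDeriv_const _ c).congr (onJoin_const c w j)
  refine ⟨continuous_const, fun w j => (h w j).memH1 (joinLength_nonneg w), ?_⟩
  have e : ∀ w j, joinEnergy (fun _ : attractor α => c) (fun _ : attractor α => c) w j = 0 :=
    fun w j => by
      rw [joinEnergy, dirichlet_eq (joinLength_nonneg w) (h w j) (h w j)]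
      simp
  simp only [e]
  exact summable_zero

theorem energy_const_left (c : ℝ) {v : attractor α → ℝ} (hv : v ∈ JoinH1 α) :
    energy α (fun _ : attractor α => c) v = 0 := by
  simp [energy, joinEnergy_const_left c hv]

theorem joinEnergy_add_left {u v z : attractor α → ℝ} (hu : u ∈ JoinH1 α) (hv : v ∈ JoinH1 α)
    (hz : z ∈ JoinH1 α) (w : List (Fin 3)) (j : Fin 3) :
    joinEnergy (u + v) z w j = joinEnergy u z w j + joinEnergy v z w j := by
  rw [joinEnergy, onJoin_add]
  exact dirichlet_add_left (joinLength_nonneg w) (JoinH1.sobolev hu w j) (JoinH1.sobolev hv w j)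
    (JoinH1.sobolev hz w j)

theorem joinEnergy_smul_left (c : ℝ) {u v : attractor α → ℝ} (hu : u ∈ JoinH1 α)
    (hv : v ∈ JoinH1 α) (w : List (Fin 3)) (j : Fin 3) :
    joinEnergy (c • u) v w j = c * joinEnergy u v w j := by
  rw [joinEnergy, onJoin_smul]
  exact dirichlet_smul_left (joinLength_nonneg w) c (JoinH1.sobolev hu w j) (JoinH1.sobolev hv w j)

theorem summable_joinEnergy {u v : attractor α → ℝ} (hu : u ∈ JoinH1 α) (hv : v ∈ JoinH1 α) :
    Summable fun e : List (Fin 3) × Fin 3 => joinEnergy u v e.1 e.2 := by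
  refine Summable.of_norm_bounded (hu.2.2.add hv.2.2) fun e => ?_
  have := two_mul_abs_dirichlet_le (joinLength_nonneg e.1) (JoinH1.sobolev hu e.1 e.2)
    (JoinH1.sobolev hv e.1 e.2)
  rw [Real.norm_eq_abs, joinEnergy, joinEnergy, joinEnergy]
  linarith [abs_nonneg (dirichlet (joinLength α e.1) (onJoin u e.1 e.2) (onJoin v e.1 e.2))]

theorem joinEnergy_add_self {u v : attractor α → ℝ} (hu : u ∈ JoinH1 α) (hv : v ∈ JoinH1 α)
    (w : List (Fin 3)) (j : Fin 3) : joinEnergy (u + v) (u + v) w j =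
      joinEnergy u u w j + 2 * joinEnergy u v w j + joinEnergy v v w j := by
  rw [joinEnergy, onJoin_add]
  exact dirichlet_add_self (joinLength_nonneg w) (JoinH1.sobolev hu w j) (JoinH1.sobolev hv w j)

theorem add_mem_joinH1 {u v : attractor α → ℝ} (hu : u ∈ JoinH1 α) (hv : v ∈ JoinH1 α) :
    u + v ∈ JoinH1 α := by
  refine ⟨hu.1.add hv.1, fun w j => ?_, ?_⟩
  · rw [onJoin_add]
    exact ((JoinH1.sobolev hu w j).add (JoinH1.sobolev hv w j)).choose_spec.memH1
      (joinLength_nonneg w)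
  · simp only [joinEnergy_add_self hu hv]
    exact (hu.2.2.add ((summable_joinEnergy hu hv).mul_left 2)).add hv.2.2

theorem smul_mem_joinH1 (c : ℝ) {u : attractor α → ℝ} (hu : u ∈ JoinH1 α) :
    c • u ∈ JoinH1 α := by
  have hS : ∀ w j, Sobolev (joinLength α w) (onJoin (c • u) w j) := fun w j => by
    rw [onJoin_smul]
    exact (JoinH1.sobolev hu w j).const_smul c
  refine ⟨hu.1.const_smul c, fun w j => (hS w j).choose_spec.memH1 (joinLength_nonneg w), ?_⟩
  have e : ∀ w j, joinEnergy (c • u) (c • u) w j = c * (c * joinEnergy u u w j) := fun w j => by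
    have h1 := dirichlet_smul_left (joinLength_nonneg w) c (JoinH1.sobolev hu w j) (hS w j)
    have h2 := dirichlet_smul_left (joinLength_nonneg w) c (JoinH1.sobolev hu w j)
      (JoinH1.sobolev hu w j)
    rw [dirichlet_comm _ (onJoin u w j) (onJoin (c • u) w j), onJoin_smul, h2] at h1
    rw [joinEnergy, onJoin_smul]
    exact h1
  simp only [e]
  exact (hu.2.2.mul_left c).mul_left c

theorem sub_mem_joinH1 {u v : attractor α → ℝ} (hu : u ∈ JoinH1 α) (hv : v ∈ JoinH1 α) :
    u - v ∈ JoinH1 α := by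
  simpa [sub_eq_add_neg] using add_mem_joinH1 hu (smul_mem_joinH1 (-1) hv)

theorem energy_add_left {u v z : attractor α → ℝ} (hu : u ∈ JoinH1 α) (hv : v ∈ JoinH1 α)
    (hz : z ∈ JoinH1 α) : energy α (u + v) z = energy α u z + energy α v z := by
  simp only [energy, joinEnergy_add_left hu hv hz]
  exact (summable_joinEnergy hu hz).tsum_add (summable_joinEnergy hv hz)

theorem energy_smul_left (c : ℝ) {u v : attractor α → ℝ} (hu : u ∈ JoinH1 α)
    (hv : v ∈ JoinH1 α) : energy α (c • u) v = c * energy α u v := by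
  simp only [energy, joinEnergy_smul_left c hu hv]
  exact tsum_mul_left

theorem joinEnergy_add_le {u v : attractor α → ℝ} (hu : u ∈ JoinH1 α) (hv : v ∈ JoinH1 α)
    (w : List (Fin 3)) (j : Fin 3) : joinEnergy (u + v) (u + v) w j ≤
      2 * joinEnergy u u w j + 2 * joinEnergy v v w j := by
  have h1 := two_mul_abs_dirichlet_le (joinLength_nonneg w) (JoinH1.sobolev hu w j)
    (JoinH1.sobolev hv w j)
  have h2 := le_abs_self (joinEnergy u v w j)
  rw [joinEnergy_add_self hu hv]
  simp only [joinEnergy] at h2 ⊢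
  linarith

theorem energy_add_le {u v : attractor α → ℝ} (hu : u ∈ JoinH1 α) (hv : v ∈ JoinH1 α) :
    energy α (u + v) (u + v) ≤ 2 * energy α u u + 2 * energy α v v := by
  rw [energy, energy, energy, ← tsum_mul_left, ← tsum_mul_left,
    ← (hu.2.2.mul_left 2).tsum_add (hv.2.2.mul_left 2)]
  exact (add_mem_joinH1 hu hv).2.2.tsum_le_tsum (fun e => joinEnergy_add_le hu hv e.1 e.2)
    ((hu.2.2.mul_left 2).add (hv.2.2.mul_left 2))

theorem energy_add_const {u : attractor α → ℝ} (hu : u ∈ JoinH1 α) (c : ℝ) :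
    energy α (u + fun _ => c) (u + fun _ => c) = energy α u u := by
  have hc := const_mem_joinH1 (α := α) c
  rw [energy_add_left hu hc (add_mem_joinH1 hu hc), energy_const_left _ (add_mem_joinH1 hu hc),
    add_zero, energy_comm, energy_add_left hu hc hu, energy_const_left _ hu, add_zero]

theorem energy_sub_comm {u v : attractor α → ℝ} (hu : u ∈ JoinH1 α) (hv : v ∈ JoinH1 α) :
    energy α (u - v) (u - v) = energy α (v - u) (v - u) := by
  have h := sub_mem_joinH1 hu hv
  have e : v - u = (-1 : ℝ) • (u - v) := by simp
  rw [e, energy_smul_left _ h (smul_mem_joinH1 _ h), energy_comm (u - v) ((-1 : ℝ) • (u - v)),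
    energy_smul_left _ h h]
  ring

theorem memH1_onJoin_comp_iff {u : attractor α → ℝ} (hu : Continuous u) (i : Fin 3)
    (w : List (Fin 3)) (j : Fin 3) :
    MemH1 (joinLength α w) (onJoin (u ∘ cellMap α i) w j) ↔
      MemH1 (joinLength α (i :: w)) (onJoin u (i :: w) j) := by
  rw [memH1_onJoin_iff (hu.comp (continuous_cellMap i)), memH1_onJoin_iff hu,
    sobolev_scale_iff ratio_nonneg (onJoin_comp_cellMap u i w j), joinLength_cons]

theorem joinEnergy_comp {u : attractor α → ℝ} (i : Fin 3) (w : List (Fin 3)) (j : Fin 3)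
    (hu : Sobolev (joinLength α (i :: w)) (onJoin u (i :: w) j)) :
    joinEnergy (u ∘ cellMap α i) (u ∘ cellMap α i) w j = ratio α * joinEnergy u u (i :: w) j := by
  rw [joinLength_cons] at hu
  rw [joinEnergy, dirichlet_scale ratio_nonneg (joinLength_nonneg w) (onJoin_comp_cellMap u i w j)
    hu, joinEnergy, joinLength_cons]

/-- For `α = 1` the convention `0⁻¹ = 0` is harmless, since the segment has length zero. -/
theorem joinEnergy_cons {u : attractor α → ℝ} (i : Fin 3) (w : List (Fin 3)) (j : Fin 3)
    (hu : Sobolev (joinLength α (i :: w)) (onJoin u (i :: w) j)) :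
    joinEnergy u u (i :: w) j =
      (ratio α)⁻¹ * joinEnergy (u ∘ cellMap α i) (u ∘ cellMap α i) w j := by
  rw [joinEnergy_comp i w j hu]
  rcases (ratio_nonneg (α := α)).eq_or_lt with h0 | h0
  · rw [joinEnergy, joinLength_cons, ← h0]
    simp [dirichlet_zero_length]
  · rw [inv_mul_cancel_left₀ h0.ne']

/-- The class `JoinH1 α` satisfies the scaling relation. -/
theorem mem_joinH1_iff {u : attractor α → ℝ} (hu : Continuous u) :
    u ∈ JoinH1 α ↔ (∀ i, u ∘ cellMap α i ∈ JoinH1 α) ∧ ∀ j, MemH1 α (onJoin u [] j) := by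
  constructor
  · intro h
    refine ⟨fun i => ⟨hu.comp (continuous_cellMap i), fun w j =>
      (memH1_onJoin_comp_iff hu i w j).2 (h.2.1 _ _), ?_⟩, fun j => ?_⟩
    · simp only [joinEnergy_comp i _ _ (JoinH1.sobolev h _ _)]
      exact (summable_words.1 h.2.2 i).mul_left _
    · simpa only [joinLength_nil] using h.2.1 [] j
  · rintro ⟨h1, h2⟩
    have hm : ∀ w j, MemH1 (joinLength α w) (onJoin u w j) := by
      intro w j
      cases w with
      | nil => simpa only [joinLength_nil] using h2 j
      | cons i w => exact (memH1_onJoin_comp_iff hu i w j).1 ((h1 i).2.1 w j)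
    refine ⟨hu, hm, summable_words.2 fun i => ?_⟩
    simp only [joinEnergy_cons i _ _ ((memH1_onJoin_iff hu _ _).1 (hm _ _))]
    exact (h1 i).2.2.mul_left _

theorem energy_eq_sum {u : attractor α → ℝ} (hu : u ∈ JoinH1 α) :
    energy α u u = ∑ i, (ratio α)⁻¹ * energy α (u ∘ cellMap α i) (u ∘ cellMap α i) +
      ∑ j, dirichlet α (onJoin u [] j) (onJoin u [] j) := by
  rw [energy, tsum_words hu.2.2]
  congr 1
  · refine Finset.sum_congr rfl fun i _ => ?_
    simp only [joinEnergy_cons i _ _ (JoinH1.sobolev hu _ _)]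
    exact tsum_mul_left
  · simp only [joinEnergy, joinLength_nil]

theorem sum_energy_comp {u : attractor α → ℝ} (hu : u ∈ JoinH1 α) :
    ∑ i, energy α (u ∘ cellMap α i) (u ∘ cellMap α i) =
      ratio α * (energy α u u - ∑ j, dirichlet α (onJoin u [] j) (onJoin u [] j)) := by
  have h1 := tsum_words hu.2.2
  have h2 : ∀ i, energy α (u ∘ cellMap α i) (u ∘ cellMap α i) =
      ratio α * ∑' e : List (Fin 3) × Fin 3, joinEnergy u u (i :: e.1) e.2 := fun i => by
    simp only [energy, joinEnergy_comp i _ _ (JoinH1.sobolev hu _ _)]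
    exact tsum_mul_left
  simp only [h2, ← Finset.mul_sum]
  congr 1
  rw [energy, h1]
  simp [joinEnergy, joinLength_nil]

theorem energy_comp_le {u : attractor α → ℝ} (hu : u ∈ JoinH1 α) (i : Fin 3) :
    energy α (u ∘ cellMap α i) (u ∘ cellMap α i) ≤ ratio α * energy α u u := by
  have h1 := sum_energy_comp hu
  have h2 : energy α (u ∘ cellMap α i) (u ∘ cellMap α i) ≤
      ∑ i, energy α (u ∘ cellMap α i) (u ∘ cellMap α i) :=
    Finset.single_le_sum (f := fun i => energy α (u ∘ cellMap α i) (u ∘ cellMap α i))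
      (fun i _ => energy_self_nonneg _) (Finset.mem_univ i)
  have h3 : 0 ≤ ∑ j, dirichlet α (onJoin u [] j) (onJoin u [] j) :=
    Finset.sum_nonneg fun j _ => dirichlet_self_nonneg _ _
  nlinarith [ratio_nonneg (α := α)]

end

section

variable {α : ℝ}

/-! ### The energy inside the cells of level `n` -/

/-- The energy of `u` on the joining segments of level at least `n`. -/
noncomputable def tailEnergy (n : ℕ) (u : attractor α → ℝ) : ℝ :=
  ∑' e : List (Fin 3) × Fin 3, if n ≤ e.1.length then joinEnergy u u e.1 e.2 else 0

theorem tailEnergy_zero (u : attractor α → ℝ) : tailEnergy 0 u = energy α u u := by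
  simp [tailEnergy, energy]

theorem tailEnergy_nonneg (n : ℕ) (u : attractor α → ℝ) : 0 ≤ tailEnergy n u := by
  refine tsum_nonneg fun e => ?_
  split_ifs
  · exact joinEnergy_self_nonneg _ _ _
  · exact le_rfl

theorem summable_tailEnergy (n : ℕ) {u : attractor α → ℝ} (hu : u ∈ JoinH1 α) :
    Summable fun e : List (Fin 3) × Fin 3 =>
      if n ≤ e.1.length then joinEnergy u u e.1 e.2 else 0 := by
  refine Summable.of_nonneg_of_le (fun e => ?_) (fun e => ?_) hu.2.2
  · split_ifs
    · exact joinEnergy_self_nonneg _ _ _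
    · exact le_rfl
  · split_ifs
    · exact le_rfl
    · exact joinEnergy_self_nonneg _ _ _

theorem tendsto_tailEnergy {u : attractor α → ℝ} (hu : u ∈ JoinH1 α) :
    Tendsto (fun n => tailEnergy n u) atTop (𝓝 0) := by
  have := tendsto_tsum_of_dominated_convergence (𝓕 := atTop)
    (f := fun (n : ℕ) (e : List (Fin 3) × Fin 3) =>
      if n ≤ e.1.length then joinEnergy u u e.1 e.2 else 0) (g := fun _ => 0) hu.2.2
    (fun e => tendsto_const_nhds.congr' ?_) (Eventually.of_forall fun n e => ?_)
  · simpa [tailEnergy] using this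
  · filter_upwards [eventually_gt_atTop e.1.length] with n hn
    rw [if_neg (not_le.2 hn)]
  · rw [Real.norm_eq_abs]
    split_ifs
    · exact (abs_of_nonneg (joinEnergy_self_nonneg _ _ _)).le
    · simpa using joinEnergy_self_nonneg _ _ _

variable [hα : Admissible α]

/-! ### Corner and oscillation estimates -/

/-- The increment of `u` along a side is the sum of the increments over the two cells and the
joining segment of which the side consists. -/
theorem sub_vertex_eq (u : attractor α → ℝ) (j : Fin 3) :
    u (vertex α (j + 2)) - u (vertex α (j + 1)) =
      ((u ∘ cellMap α (j + 1)) (vertex α (j + 2)) - (u ∘ cellMap α (j + 1)) (vertex α (j + 1))) +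
      (onJoin u [] j α - onJoin u [] j 0) +
      ((u ∘ cellMap α (j + 2)) (vertex α (j + 2)) -
        (u ∘ cellMap α (j + 2)) (vertex α (j + 1))) := by
  rw [onJoin_zero, onJoin_end]
  simp only [Function.comp, cellMap_vertex]
  ring

theorem sq_onJoin_sub_le {u : attractor α → ℝ} (hu : u ∈ JoinH1 α) (j : Fin 3) {s t : ℝ}
    (hs : s ∈ Icc 0 α) (ht : t ∈ Icc 0 α) :
    (onJoin u [] j t - onJoin u [] j s) ^ 2 ≤
      α * dirichlet α (onJoin u [] j) (onJoin u [] j) :=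
  (JoinH1.sobolev_nil hu j).sq_sub_le hs ht

theorem add_energy_comp_le {u : attractor α → ℝ} (hu : u ∈ JoinH1 α) (j : Fin 3) :
    energy α (u ∘ cellMap α (j + 1)) (u ∘ cellMap α (j + 1)) +
      energy α (u ∘ cellMap α (j + 2)) (u ∘ cellMap α (j + 2)) ≤
      ratio α * (energy α u u - dirichlet α (onJoin u [] j) (onJoin u [] j)) := by
  have h1 := sum_energy_comp hu
  have h2 : ∀ f : Fin 3 → ℝ, ∑ i, f i = f j + f (j + 1) + f (j + 2) := by
    intro f
    rw [Fin.sum_univ_three]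
    fin_cases j <;> simp <;> ring
  rw [h2, h2] at h1
  have h3 := energy_self_nonneg (u ∘ cellMap α j)
  have h4 := mul_nonneg (ratio_nonneg (α := α)) (dirichlet_self_nonneg α (onJoin u [] (j + 1)))
  have h5 := mul_nonneg (ratio_nonneg (α := α)) (dirichlet_self_nonneg α (onJoin u [] (j + 2)))
  linarith

/-- The increment of `u` along a side is controlled by the energy of the joining segments alone,
as soon as it is controlled by *some* functional `A` that scales like an energy: the contribution
of the `2 ^ n` cells of level `n` along the side is of the order `√((2 r) ^ n)`, and `2 r < 1`. -/
theorem sq_sub_vertex_le {𝒞 : Set (attractor α → ℝ)} (h𝒞 : 𝒞 ⊆ JoinH1 α)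
    (hF : ∀ u ∈ 𝒞, ∀ i, u ∘ cellMap α i ∈ 𝒞) (j : Fin 3) (A : (attractor α → ℝ) → ℝ)
    (hA : ∀ u ∈ 𝒞, 0 ≤ A u)
    (hAr : ∀ u ∈ 𝒞, A (u ∘ cellMap α (j + 1)) + A (u ∘ cellMap α (j + 2)) ≤ ratio α * A u)
    (hAd : ∀ u ∈ 𝒞, (u (vertex α (j + 2)) - u (vertex α (j + 1))) ^ 2 ≤ A u)
    {u : attractor α → ℝ} (hu : u ∈ 𝒞) :
    (u (vertex α (j + 2)) - u (vertex α (j + 1))) ^ 2 ≤ energy α u u := by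
  have hr0 : 0 ≤ ratio α := ratio_nonneg
  have hr1 : ratio α < 1 / 2 := ratio_lt_half
  have hra := two_ratio_add (α := α)
  have key : ∀ n : ℕ, ∀ u ∈ 𝒞, |u (vertex α (j + 2)) - u (vertex α (j + 1))| ≤
      √(energy α u u) + √((2 * ratio α) ^ n * A u) := by
    intro n
    induction n with
    | zero =>
      intro u hu
      rw [pow_zero, one_mul]
      exact (Real.abs_le_sqrt (hAd u hu)).trans (le_add_of_nonneg_left (Real.sqrt_nonneg _))
    | succ n ih =>
      intro u hu
      have i1 := ih _ (hF u hu (j + 1))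
      have i2 := ih _ (hF u hu (j + 2))
      have i3 := Real.abs_le_sqrt (sq_onJoin_sub_le (h𝒞 hu) j (s := 0) (t := α)
        ⟨le_rfl, hα.pos.le⟩ ⟨hα.pos.le, le_rfl⟩)
      have hE := add_energy_comp_le (h𝒞 hu) j
      have hAu := hAr u hu
      have hA1 := hA _ (hF u hu (j + 1))
      have hA2 := hA _ (hF u hu (j + 2))
      have e1 := energy_self_nonneg (u ∘ cellMap α (j + 1))
      have e2 := energy_self_nonneg (u ∘ cellMap α (j + 2))
      have q0 := dirichlet_self_nonneg α (onJoin u [] j)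
      have qle := dirichlet_onJoin_nil_le (h𝒞 hu) j
      set J := energy α u u
      set J1 := energy α (u ∘ cellMap α (j + 1)) (u ∘ cellMap α (j + 1))
      set J2 := energy α (u ∘ cellMap α (j + 2)) (u ∘ cellMap α (j + 2))
      set q := dirichlet α (onJoin u [] j) (onJoin u [] j)
      set A1 := A (u ∘ cellMap α (j + 1))
      set A2 := A (u ∘ cellMap α (j + 2))
      have add_sqrt : ∀ {x y z : ℝ}, 0 ≤ x → 0 ≤ y → 2 * (x + y) ≤ z → √x + √y ≤ √z := by
        intro x y z hx hy hz
        refine Real.le_sqrt_of_sq_le (le_trans ?_ hz)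
        nlinarith [Real.sq_sqrt hx, Real.sq_sqrt hy, sq_nonneg (√x - √y)]
      have hAs : √((2 * ratio α) ^ n * A1) + √((2 * ratio α) ^ n * A2) ≤
          √((2 * ratio α) ^ (n + 1) * A u) := by
        have hp : 0 ≤ (2 * ratio α) ^ n := by positivity
        refine add_sqrt (mul_nonneg hp hA1) (mul_nonneg hp hA2) ?_
        rw [pow_succ]
        nlinarith [mul_le_mul_of_nonneg_left hAu hp]
      have hJ12 : √J1 + √J2 ≤ √(2 * ratio α * (J - q)) := add_sqrt e1 e2 (by linarith)
      -- the Cauchy–Schwarz inequality with the weights `2 r + α = 1`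
      have hJs : √(2 * ratio α * (J - q)) + √(α * q) ≤ √J := by
        refine Real.le_sqrt_of_sq_le ?_
        have hP : 0 ≤ J - q := sub_nonneg.2 qle
        have hx : 0 ≤ 2 * ratio α * (J - q) := by positivity
        have hy : 0 ≤ α * q := mul_nonneg hα.pos.le q0
        have hxs := Real.sq_sqrt hx
        have hys := Real.sq_sqrt hy
        have hcross : 2 * √(2 * ratio α * (J - q)) * √(α * q) ≤
            α * (J - q) + 2 * ratio α * q := by
          refine le_of_sq_le_sq ?_ (add_nonneg (mul_nonneg hα.pos.le hP) (by positivity))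
          rw [mul_pow, mul_pow, hxs, hys]
          nlinarith [sq_nonneg (α * (J - q) - 2 * ratio α * q)]
        have hαe : α = 1 - 2 * ratio α := by linarith
        calc _ = 2 * ratio α * (J - q) + α * q + 2 * √(2 * ratio α * (J - q)) * √(α * q) := by
              rw [add_sq, hxs, hys]; ring
          _ ≤ 2 * ratio α * (J - q) + α * q + (α * (J - q) + 2 * ratio α * q) := by
              linarith
          _ = (2 * ratio α + α) * J := by ring
          _ = J := by rw [hra, one_mul]
      rw [sub_vertex_eq u j]
      refine (abs_add_three _ _ _).trans ?_
      linarith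
  have hlim : Tendsto (fun n : ℕ => √(energy α u u) + √((2 * ratio α) ^ n * A u)) atTop
      (𝓝 (√(energy α u u))) := by
    have h1 : Tendsto (fun n : ℕ => (2 * ratio α) ^ n * A u) atTop (𝓝 0) := by
      simpa using (tendsto_pow_atTop_nhds_zero_of_lt_one (by positivity) (by linarith)).mul_const
        (A u)
    have h2 := h1.sqrt
    rw [Real.sqrt_zero] at h2
    simpa using h2.const_add (√(energy α u u))
  have hle := ge_of_tendsto' hlim fun n => key n u hu
  rw [← sq_abs, ← Real.sq_sqrt (energy_self_nonneg u)]
  exact pow_le_pow_left₀ (abs_nonneg _) hle 2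

/-- A class of functions, stable under restriction to cells, for which the energy of the joining
segments controls the increments between corners. It contains no functions of Cantor type. -/
structure IsRegularClass (𝒞 : Set (attractor α → ℝ)) : Prop where
  subset : 𝒞 ⊆ JoinH1 α
  comp : ∀ u ∈ 𝒞, ∀ i, u ∘ cellMap α i ∈ 𝒞
  corner : ∀ u ∈ 𝒞, ∀ j, (u (vertex α (j + 2)) - u (vertex α (j + 1))) ^ 2 ≤ energy α u u

theorem IsRegularClass.abs_sub_vertex_le {𝒞 : Set (attractor α → ℝ)} (h : IsRegularClass 𝒞)
    {u : attractor α → ℝ} (hu : u ∈ 𝒞) (a b : Fin 3) :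
    |u (vertex α a) - u (vertex α b)| ≤ √(energy α u u) := by
  have key : ∀ j : Fin 3, |u (vertex α (j + 2)) - u (vertex α (j + 1))| ≤ √(energy α u u) :=
    fun j => Real.abs_le_sqrt (h.corner u hu j)
  have hab : ∀ a b : Fin 3, a = b ∨ (∃ j : Fin 3, a = j + 2 ∧ b = j + 1) ∨
      ∃ j : Fin 3, a = j + 1 ∧ b = j + 2 := by decide
  rcases hab a b with rfl | ⟨j, rfl, rfl⟩ | ⟨j, rfl, rfl⟩
  · simp
  · exact key j
  · rw [abs_sub_comm]
    exact key j

theorem dist_cellMap (i : Fin 3) (x y : attractor α) :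
    dist (cellMap α i x) (cellMap α i y) = ratio α * dist x y :=
  dist_simil hα.le_one i x y

/-- The oscillation of `u` is controlled by its energy. The constant `8` works since
`8 * √r + 1 ≤ 8`: on a cell the energy of `u` is multiplied by at most `r`. -/
theorem IsRegularClass.osc_vertex_le {𝒞 : Set (attractor α → ℝ)} (h : IsRegularClass 𝒞)
    {u : attractor α → ℝ} (hu : u ∈ 𝒞) (x : attractor α) (j : Fin 3) :
    |u x - u (vertex α j)| ≤ 8 * √(energy α u u) := by
  have hr0 : 0 ≤ ratio α := ratio_nonneg
  have hr1 : ratio α < 1 / 2 := ratio_lt_half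
  have hsr : √(ratio α) ≤ 3 / 4 := Real.sqrt_le_iff.2 ⟨by norm_num, by linarith⟩
  obtain ⟨B, hB⟩ := Metric.isBounded_iff.1
    (Metric.isBounded_of_compactSpace (s := (univ : Set (attractor α))))
  have key : ∀ ε : ℝ, 0 ≤ ε → ∀ n : ℕ, ∀ u ∈ 𝒞,
      (∀ x y : attractor α, dist x y ≤ ratio α ^ n * B → |u x - u y| ≤ ε) →
      ∀ x j, |u x - u (vertex α j)| ≤ 8 * √(energy α u u) + ε := by
    intro ε hε n
    induction n with
    | zero =>
      intro u hu H x j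
      refine (H x _ ?_).trans (le_add_of_nonneg_left (by positivity))
      rw [pow_zero, one_mul]
      exact hB (mem_univ _) (mem_univ _)
    | succ n ih =>
      intro u hu H x j
      have hcell : ∀ i, √(energy α (u ∘ cellMap α i) (u ∘ cellMap α i)) ≤
          3 / 4 * √(energy α u u) := fun i => by
        refine (Real.sqrt_le_sqrt (energy_comp_le (h.subset hu) i)).trans ?_
        rw [Real.sqrt_mul hr0]
        exact mul_le_mul_of_nonneg_right hsr (Real.sqrt_nonneg _)
      have hs0 := Real.sqrt_nonneg (energy α u u)
      rcases exists_cell_or_join x with ⟨i, y, rfl⟩ | ⟨k, t, ht, hx⟩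
      · have i1 := ih _ (h.comp u hu i) (fun x y hxy => H _ _ (by
          rw [dist_cellMap, pow_succ', mul_assoc]
          exact mul_le_mul_of_nonneg_left hxy hr0)) y i
        have i2 := h.abs_sub_vertex_le hu i j
        have i3 := abs_sub_le (u (cellMap α i y)) (u (vertex α i)) (u (vertex α j))
        simp only [Function.comp, cellMap_vertex] at i1
        have := hcell i
        linarith
      · have hux : u x = onJoin u [] k t := by
          rw [onJoin, along_eq _ (joinCurve_mem_nil ht)]
          congr 1
          exact Subtype.ext hx
        have i1 : |onJoin u [] k t - onJoin u [] k 0| ≤ √(energy α u u) := by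
          refine Real.abs_le_sqrt ((sq_onJoin_sub_le (h.subset hu) k ⟨le_rfl, hα.pos.le⟩ ht).trans ?_)
          have q0 := dirichlet_self_nonneg α (onJoin u [] k)
          have qle := dirichlet_onJoin_nil_le (h.subset hu) k
          nlinarith [hα.le_one]
        have i2 := h.abs_sub_vertex_le (h.comp u hu (k + 1)) (k + 2) (k + 1)
        have i3 := h.abs_sub_vertex_le hu (k + 1) j
        have i4 := hcell (k + 1)
        rw [onJoin_zero, ← hux] at i1
        simp only [Function.comp, cellMap_vertex] at i2
        have i5 := abs_sub_le (u x) (u (cellMap α (k + 1) (vertex α (k + 2)))) (u (vertex α j))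
        have i6 := abs_sub_le (u (cellMap α (k + 1) (vertex α (k + 2)))) (u (vertex α (k + 1)))
          (u (vertex α j))
        linarith
  refine le_of_forall_pos_le_add fun ε hε => ?_
  have huc := CompactSpace.uniformContinuous_of_continuous (h.subset hu).1
  obtain ⟨δ, hδ, hd⟩ := Metric.uniformContinuous_iff.1 huc ε hε
  have hlim : Tendsto (fun n : ℕ => ratio α ^ n * B) atTop (𝓝 0) := by
    simpa using (tendsto_pow_atTop_nhds_zero_of_lt_one hr0 (by linarith)).mul_const B
  obtain ⟨n, hn⟩ := (hlim.eventually (gt_mem_nhds hδ)).exists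
  exact key ε hε.le n u hu (fun x y hxy => (hd (hxy.trans_lt hn)).le) x j

theorem IsRegularClass.osc_le {𝒞 : Set (attractor α → ℝ)} (h : IsRegularClass 𝒞)
    {u : attractor α → ℝ} (hu : u ∈ 𝒞) (x y : attractor α) :
    |u x - u y| ≤ 16 * √(energy α u u) := by
  have h1 := h.osc_vertex_le hu x 0
  have h2 := h.osc_vertex_le hu y 0
  rw [abs_sub_comm] at h2
  linarith [abs_sub_le (u x) (u (vertex α 0)) (u y)]

theorem IsRegularClass.eq_const {𝒞 : Set (attractor α → ℝ)} (h : IsRegularClass 𝒞)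
    {u : attractor α → ℝ} (hu : u ∈ 𝒞) (h0 : energy α u u = 0) :
    ∃ c : ℝ, ∀ x, u x = c := by
  refine ⟨u (vertex α 0), fun x => ?_⟩
  have := h.osc_vertex_le hu x 0
  rw [h0, Real.sqrt_zero, mul_zero] at this
  exact sub_eq_zero.1 (abs_nonpos_iff.1 this)

/-! ### Functions that are constant on the cells of some level -/

theorem sum_tailEnergy_comp (n : ℕ) {u : attractor α → ℝ} (hu : u ∈ JoinH1 α) :
    ∑ i, tailEnergy n (u ∘ cellMap α i) = ratio α * tailEnergy (n + 1) u := by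
  have h1 := tsum_words (summable_tailEnergy (n + 1) hu)
  rw [tailEnergy, h1, Finset.sum_eq_zero fun j _ => if_neg (by simp), add_zero, Finset.mul_sum]
  refine Finset.sum_congr rfl fun i _ => ?_
  rw [tailEnergy, ← tsum_mul_left]
  congr 1
  ext e
  simp only [List.length_cons, Nat.add_le_add_iff_right, mul_ite, mul_zero,
    joinEnergy_comp i _ _ (JoinH1.sobolev hu _ _)]

variable (α) in
/-- Continuous functions that are constant on the cells of level `n` and `H¹` on the joining
segments of lower level. -/
def cellConst : ℕ → Set (attractor α → ℝ)
  | 0 => {u | ∃ c : ℝ, u = fun _ => c}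
  | n + 1 => {u | Continuous u ∧ (∀ i, u ∘ cellMap α i ∈ cellConst n) ∧
      ∀ j, MemH1 α (onJoin u [] j)}

theorem cellConst_subset_joinH1 (n : ℕ) : cellConst α n ⊆ JoinH1 α := by
  induction n with
  | zero =>
    rintro _ ⟨c, rfl⟩
    exact const_mem_joinH1 c
  | succ n ih => exact fun u hu => (mem_joinH1_iff hu.1).2 ⟨fun i => ih (hu.2.1 i), hu.2.2⟩

theorem const_mem_cellConst (n : ℕ) (c : ℝ) : (fun _ : attractor α => c) ∈ cellConst α n := by
  induction n with
  | zero => exact ⟨c, rfl⟩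
  | succ n ih =>
    exact ⟨continuous_const, fun i => ih, ((mem_joinH1_iff continuous_const).1
      (const_mem_joinH1 c)).2⟩

theorem cellConst_subset_succ (n : ℕ) : cellConst α n ⊆ cellConst α (n + 1) := by
  induction n with
  | zero =>
    rintro _ ⟨c, rfl⟩
    exact const_mem_cellConst 1 c
  | succ n ih => exact fun u hu => ⟨hu.1, fun i => ih (hu.2.1 i), hu.2.2⟩

theorem cellConst_mono : Monotone (cellConst α) :=
  monotone_nat_of_le_succ cellConst_subset_succ

theorem sub_mem_cellConst (n : ℕ) : ∀ u ∈ cellConst α n, ∀ v ∈ cellConst α n,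
    u - v ∈ cellConst α n := by
  induction n with
  | zero =>
    rintro _ ⟨c, rfl⟩ _ ⟨d, rfl⟩
    exact ⟨c - d, rfl⟩
  | succ n ih =>
    intro u hu v hv
    refine ⟨hu.1.sub hv.1, fun i => ih _ (hu.2.1 i) _ (hv.2.1 i), ?_⟩
    exact ((mem_joinH1_iff (hu.1.sub hv.1)).1 (sub_mem_joinH1 (cellConst_subset_joinH1 _ hu)
      (cellConst_subset_joinH1 _ hv))).2

/-- A function in a regular class is approximated by functions that are constant on the cells of
level `n`. On a cell of level `n` the approximant is the value of `u` at a corner of that cell; on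
the joining segments of lower level `u` is corrected by an affine function, and the energy of
the corrections is controlled by the energy of `u` inside the cells of level `n`. -/
theorem IsRegularClass.exists_cellConst {𝒞 : Set (attractor α → ℝ)} (h : IsRegularClass 𝒞)
    (h1 : α < 1) (n : ℕ) : ∀ u ∈ 𝒞, ∃ v ∈ cellConst α n,
      energy α (u - v) (u - v) ≤ (1 + 12 / α * (1 - ratio α ^ n)) * tailEnergy n u ∧
      ∀ i, (u (vertex α i) - v (vertex α i)) ^ 2 ≤ ratio α ^ n * tailEnergy n u := by
  have hr0 : 0 < ratio α := ratio_pos h1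
  have hr1 : ratio α < 1 / 2 := ratio_lt_half
  have hα0 := hα.pos
  induction n with
  | zero =>
    intro u hu
    refine ⟨fun _ => u (vertex α 0), ⟨_, rfl⟩, ?_, fun i => ?_⟩
    · have e : u - (fun _ => u (vertex α 0)) = u + fun _ => -u (vertex α 0) := by
        ext x
        simp [sub_eq_add_neg]
      rw [e, energy_add_const (h.subset hu), tailEnergy_zero]
      simp
    · rw [tailEnergy_zero, pow_zero, one_mul, ← sq_abs, ← Real.sq_sqrt (energy_self_nonneg u)]
      exact pow_le_pow_left₀ (abs_nonneg _) (h.abs_sub_vertex_le hu i 0) 2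
  | succ n ih =>
    intro u hu
    have hU := h.subset hu
    choose v hv hvE hvc using fun i => ih (u ∘ cellMap α i) (h.comp u hu i)
    -- the error at the two end points of a joining segment
    let a : Fin 3 → ℝ := fun j => v (j + 1) (vertex α (j + 2)) - onJoin u [] j 0
    let b : Fin 3 → ℝ := fun j => v (j + 2) (vertex α (j + 1)) - onJoin u [] j α
    let L : Fin 3 → ℝ → ℝ := fun j t => a j + ((b j - a j) / α) * t
    have hLS : ∀ j, Sobolev α (L j) := fun j => sobolev_affine _ _ _
    obtain ⟨z, hzc, hzv, hzj⟩ := exists_glue h1 (v := v) (g := fun j => onJoin u [] j + L j)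
      (fun i => (cellConst_subset_joinH1 n (hv i)).1)
      (fun j => ((JoinH1.sobolev_nil hU j).add (hLS j)).continuousOn)
      (fun j => by simp [L, a]) (fun j => by
        simp only [Pi.add_apply, L, a, b]
        field_simp
        ring)
    have hzS : ∀ j, Sobolev α (onJoin z [] j) := fun j =>
      ((JoinH1.sobolev_nil hU j).add (hLS j)).congr (hzj j).symm
    have hz : z ∈ cellConst α (n + 1) := ⟨hzc, fun i => by rw [hzv]; exact hv i,
      fun j => (memH1_onJoin_nil_iff hzc j).2 (hzS j)⟩
    have hZ := cellConst_subset_joinH1 _ hz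
    have htail := sum_tailEnergy_comp n hU
    have hT : ∀ i, 0 ≤ tailEnergy n (u ∘ cellMap α i) := fun i => tailEnergy_nonneg _ _
    have hTi : ∀ i, tailEnergy n (u ∘ cellMap α i) ≤ ratio α * tailEnergy (n + 1) u := fun i => by
      rw [← htail]
      exact Finset.single_le_sum (f := fun i => tailEnergy n (u ∘ cellMap α i))
        (fun i _ => hT i) (Finset.mem_univ i)
    have hp : 0 < ratio α ^ n := pow_pos hr0 n
    have hT1 := tailEnergy_nonneg (n + 1) u
    refine ⟨z, hz, ?_, fun i => ?_⟩
    · rw [energy_eq_sum (sub_mem_joinH1 hU hZ)]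
      have hcell : ∑ i, (ratio α)⁻¹ * energy α ((u - z) ∘ cellMap α i) ((u - z) ∘ cellMap α i) ≤
          (1 + 12 / α * (1 - ratio α ^ n)) * tailEnergy (n + 1) u := by
        rw [← Finset.mul_sum, inv_mul_le_iff₀ hr0]
        calc ∑ i, energy α ((u - z) ∘ cellMap α i) ((u - z) ∘ cellMap α i)
            ≤ ∑ i, (1 + 12 / α * (1 - ratio α ^ n)) * tailEnergy n (u ∘ cellMap α i) := by
              refine Finset.sum_le_sum fun i _ => ?_
              have : (u - z) ∘ cellMap α i = u ∘ cellMap α i - v i := by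
                rw [← hzv i]; rfl
              rw [this]
              exact hvE i
          _ = _ := by rw [← Finset.mul_sum, htail]; ring
      have hjoin : ∀ j, dirichlet α (onJoin (u - z) [] j) (onJoin (u - z) [] j) ≤
          4 / α * ratio α ^ n * (ratio α * tailEnergy (n + 1) u) := by
        intro j
        have hE : EqOn (onJoin (u - z) [] j)
            (fun t => -a j + (-((b j - a j) / α)) * t) (Icc 0 α) := by
          intro t ht
          rw [onJoin_sub, Pi.sub_apply, hzj j ht]
          simp only [Pi.add_apply, L]
          ring
        have hS := (JoinH1.sobolev_nil (sub_mem_joinH1 hU hZ) j)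
        rw [dirichlet_congr hα0.le hS hS hE hE, dirichlet_affine hα0.le]
        have ha : a j ^ 2 ≤ ratio α ^ n * (ratio α * tailEnergy (n + 1) u) := by
          have := hvc (j + 1) (j + 2)
          have e : a j ^ 2 = ((u ∘ cellMap α (j + 1)) (vertex α (j + 2)) -
              v (j + 1) (vertex α (j + 2))) ^ 2 := by
            simp only [a, onJoin_zero, Function.comp]
            ring
          rw [e]
          exact this.trans (mul_le_mul_of_nonneg_left (hTi _) hp.le)
        have hb : b j ^ 2 ≤ ratio α ^ n * (ratio α * tailEnergy (n + 1) u) := by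
          have := hvc (j + 2) (j + 1)
          have e : b j ^ 2 = ((u ∘ cellMap α (j + 2)) (vertex α (j + 1)) -
              v (j + 2) (vertex α (j + 1))) ^ 2 := by
            simp only [b, onJoin_end, Function.comp]
            ring
          rw [e]
          exact this.trans (mul_le_mul_of_nonneg_left (hTi _) hp.le)
        have e : α * (-((b j - a j) / α)) ^ 2 = (b j - a j) ^ 2 / α := by
          field_simp
        rw [e, div_le_iff₀ hα0]
        have e2 : 4 / α * ratio α ^ n * (ratio α * tailEnergy (n + 1) u) * α =
            4 * (ratio α ^ n * (ratio α * tailEnergy (n + 1) u)) := by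
          field_simp
        rw [e2]
        nlinarith [sq_nonneg (a j + b j)]
      have hsum : ∑ j, dirichlet α (onJoin (u - z) [] j) (onJoin (u - z) [] j) ≤
          3 * (4 / α * ratio α ^ n * (ratio α * tailEnergy (n + 1) u)) := by
        refine (Finset.sum_le_sum fun j _ => hjoin j).trans ?_
        simp
      have hfin : 3 * (4 / α * ratio α ^ n * (ratio α * tailEnergy (n + 1) u)) ≤
          12 / α * (ratio α ^ n - ratio α ^ (n + 1)) * tailEnergy (n + 1) u := by
        have e : 3 * (4 / α * ratio α ^ n * (ratio α * tailEnergy (n + 1) u)) =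
            12 / α * ratio α ^ n * tailEnergy (n + 1) u * ratio α := by ring
        have e' : 12 / α * (ratio α ^ n - ratio α ^ (n + 1)) * tailEnergy (n + 1) u =
            12 / α * ratio α ^ n * tailEnergy (n + 1) u * (1 - ratio α) := by
          rw [pow_succ]; ring
        rw [e, e']
        exact mul_le_mul_of_nonneg_left (by linarith) (by positivity)
      calc _ ≤ (1 + 12 / α * (1 - ratio α ^ n)) * tailEnergy (n + 1) u +
            12 / α * (ratio α ^ n - ratio α ^ (n + 1)) * tailEnergy (n + 1) u := by linarith
        _ = _ := by ring
    · have := hvc i i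
      have e : v i (vertex α i) = z (vertex α i) := by
        rw [← hzv i, Function.comp, cellMap_vertex]
      rw [e, Function.comp, cellMap_vertex] at this
      refine this.trans ?_
      rw [pow_succ, mul_assoc]
      exact mul_le_mul_of_nonneg_left (hTi i) hp.le

theorem IsRegularClass.exists_cellConst_lt {𝒞 : Set (attractor α → ℝ)} (h : IsRegularClass 𝒞)
    (h1 : α < 1) {u : attractor α → ℝ} (hu : u ∈ 𝒞) {ε : ℝ} (hε : 0 < ε) :
    ∃ n, ∃ v ∈ cellConst α n, energy α (u - v) (u - v) < ε := by
  have hα0 := hα.pos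
  have hlim := (tendsto_tailEnergy (h.subset hu)).const_mul (1 + 12 / α)
  rw [mul_zero] at hlim
  obtain ⟨n, hn⟩ := (hlim.eventually (gt_mem_nhds hε)).exists
  obtain ⟨v, hv, hE, -⟩ := h.exists_cellConst h1 n u hu
  refine ⟨n, v, hv, (hE.trans ?_).trans_lt hn⟩
  refine mul_le_mul_of_nonneg_right ?_ (tailEnergy_nonneg n u)
  have h2 : 0 ≤ ratio α ^ n := pow_nonneg ratio_nonneg n
  have h3 : 12 / α * (1 - ratio α ^ n) ≤ 12 / α * 1 :=
    mul_le_mul_of_nonneg_left (by linarith) (by positivity)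
  linarith

end

section

variable {α : ℝ}

/-! ### Sides and the scaling relation for `H¹(X)` -/

theorem onSide_add (u v : attractor α → ℝ) (w : List (Fin 3)) (j : Fin 3) :
    onSide (u + v) w j = onSide u w j + onSide v w j :=
  along_add u v _

theorem onSide_smul (c : ℝ) (u : attractor α → ℝ) (w : List (Fin 3)) (j : Fin 3) :
    onSide (c • u) w j = c • onSide u w j :=
  along_smul c u _

theorem onSide_sub (u v : attractor α → ℝ) (w : List (Fin 3)) (j : Fin 3) :
    onSide (u - v) w j = onSide u w j - onSide v w j := by
  have := onSide_add u ((-1 : ℝ) • v) w j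
  rw [onSide_smul] at this
  simpa [sub_eq_add_neg] using this

variable [hα : Admissible α]

theorem memH1_onSide_iff {u : attractor α → ℝ} (hu : Continuous u) (w : List (Fin 3)) (j : Fin 3) :
    MemH1 (ratio α ^ w.length) (onSide u w j) ↔ Sobolev (ratio α ^ w.length) (onSide u w j) :=
  memH1_iff_sobolev (pow_nonneg ratio_nonneg _) (continuousOn_onSide hu w j)

theorem memH1_onSide_comp_iff {u : attractor α → ℝ} (hu : Continuous u) (i : Fin 3)
    (w : List (Fin 3)) (j : Fin 3) :
    MemH1 (ratio α ^ w.length) (onSide (u ∘ cellMap α i) w j) ↔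
      MemH1 (ratio α ^ (i :: w).length) (onSide u (i :: w) j) := by
  rw [memH1_onSide_iff (hu.comp (continuous_cellMap i)), memH1_onSide_iff hu,
    sobolev_scale_iff ratio_nonneg (onSide_comp_cellMap u i w j), List.length_cons, pow_succ']

theorem sobolev_onSide_nil_iff {u : attractor α → ℝ} (j : Fin 3) :
    Sobolev 1 (onSide u [] j) ↔ Sobolev 1 (onSide (u ∘ cellMap α (j + 1)) [] j) ∧
      Sobolev α (onJoin u [] j) ∧ Sobolev 1 (onSide (u ∘ cellMap α (j + 2)) [] j) := by
  have hr0 : 0 ≤ ratio α := ratio_nonneg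
  have e : (1 : ℝ) = ratio α * 1 + (α + ratio α * 1) := by linarith [two_ratio_add (α := α)]
  have em : onJoin u [] j = fun t => onSide u [] j (ratio α * 1 + t) := by
    ext t
    rw [onSide_middle, mul_one]
  have er : EqOn (onSide (u ∘ cellMap α (j + 2)) [] j)
      (fun t => (fun s => onSide u [] j (ratio α * 1 + (α + s))) (ratio α * t)) (Icc 0 1) := by
    simpa only [mul_one] using onSide_right u j
  rw [sobolev_scale_iff (f := onSide u [] j) hr0 (onSide_left u j),
    sobolev_scale_iff (f := fun s => onSide u [] j (ratio α * 1 + (α + s))) hr0 er, em]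
  nth_rw 1 [e]
  rw [sobolev_add_iff (by positivity) (by linarith [hα.pos]),
    sobolev_add_iff hα.pos.le (by positivity)]

/-- The energy on a side of the triangle is the sum of its three parts. -/
theorem dirichlet_onSide_comp {u : attractor α → ℝ} (j : Fin 3)
    (h : Sobolev 1 (onSide u [] j)) :
    dirichlet 1 (onSide (u ∘ cellMap α (j + 1)) [] j) (onSide (u ∘ cellMap α (j + 1)) [] j) +
      dirichlet 1 (onSide (u ∘ cellMap α (j + 2)) [] j) (onSide (u ∘ cellMap α (j + 2)) [] j) =
      ratio α * (dirichlet 1 (onSide u [] j) (onSide u [] j) -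
        dirichlet α (onJoin u [] j) (onJoin u [] j)) := by
  have hr0 : 0 ≤ ratio α := ratio_nonneg
  have e : (1 : ℝ) = ratio α * 1 + (α + ratio α * 1) := by linarith [two_ratio_add (α := α)]
  have em : onJoin u [] j = fun t => onSide u [] j (ratio α * 1 + t) := by
    ext t
    rw [onSide_middle, mul_one]
  have er : EqOn (onSide (u ∘ cellMap α (j + 2)) [] j)
      (fun t => (fun s => onSide u [] j (ratio α * 1 + (α + s))) (ratio α * t)) (Icc 0 1) := by
    simpa only [mul_one] using onSide_right u j
  have ha : 0 ≤ ratio α * 1 := by positivity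
  have hb : 0 ≤ α + ratio α * 1 := by linarith [hα.pos]
  have h' : Sobolev (ratio α * 1 + (α + ratio α * 1)) (onSide u [] j) := by rwa [← e]
  have h1 := (sobolev_add_iff ha hb).1 h'
  have h2 := (sobolev_add_iff hα.pos.le ha).1 h1.2
  have d1 := dirichlet_add_length ha hb h'
  have d2 := dirichlet_add_length hα.pos.le ha h1.2
  rw [← e] at d1
  rw [dirichlet_scale hr0 zero_le_one (onSide_left u j) h1.1,
    dirichlet_scale (f := fun s => onSide u [] j (ratio α * 1 + (α + s))) hr0 zero_le_one er h2.2,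
    em, d1, d2]
  ring

/-- A side of the triangle consists of a joining segment and of sides of two cells, so that the
condition on sides passes between `u` and its restrictions to the cells. -/
theorem mem_H1_iff_scaling {u : attractor α → ℝ} (hu : Continuous u) :
    u ∈ H1 α ↔ (∀ i, u ∘ cellMap α i ∈ H1 α) ∧ ∀ j, MemH1 α (onJoin u [] j) := by
  simp only [mem_H1_iff]
  rw [mem_joinH1_iff hu]
  constructor
  · rintro ⟨⟨h1, h2⟩, h3⟩
    exact ⟨fun i => ⟨h1 i, fun w j => (memH1_onSide_comp_iff hu i w j).2 (h3 _ _)⟩, h2⟩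
  · rintro ⟨h1, h2⟩
    refine ⟨⟨fun i => (h1 i).1, h2⟩, fun w j => ?_⟩
    cases w with
    | nil =>
      have hs : ∀ i, Sobolev 1 (onSide (u ∘ cellMap α i) [] j) := fun i => by
        simpa using (memH1_onSide_iff (hu.comp (continuous_cellMap i)) [] j).1 ((h1 i).2 [] j)
      rw [memH1_onSide_iff hu]
      simpa using (sobolev_onSide_nil_iff j).2 ⟨hs _, (memH1_onJoin_nil_iff hu j).1 (h2 j), hs _⟩
    | cons i w => exact (memH1_onSide_comp_iff hu i w j).1 ((h1 i).2 w j)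

theorem satisfiesScaling_H1 : SatisfiesScaling α (energy α) (H1 α) :=
  fun _ hu => ⟨mem_H1_iff_scaling hu, fun h => energy_eq_sum (mem_H1_iff.1 h).1⟩

theorem H1.sobolev_onSide {u : attractor α → ℝ} (hu : u ∈ H1 α) (w : List (Fin 3)) (j : Fin 3) :
    Sobolev (ratio α ^ w.length) (onSide u w j) :=
  (memH1_onSide_iff hu.1 w j).1 (hu.2.1 w j)

theorem H1.sobolev_onSide_nil {u : attractor α → ℝ} (hu : u ∈ H1 α) (j : Fin 3) :
    Sobolev 1 (onSide u [] j) := by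
  simpa using H1.sobolev_onSide hu [] j

/-- On `H1 α` the Dirichlet integral over a side bounds the increment along the side, which is the
a priori bound that the corner estimate requires. -/
theorem isRegularClass_H1 : IsRegularClass (H1 α) where
  subset := fun u hu => (mem_H1_iff.1 hu).1
  comp := fun u hu => ((mem_H1_iff_scaling hu.1).1 hu).1
  corner := fun u hu j => by
    refine sq_sub_vertex_le (𝒞 := H1 α) (fun u hu => (mem_H1_iff.1 hu).1)
      (fun u hu => ((mem_H1_iff_scaling hu.1).1 hu).1) j
      (fun u => dirichlet 1 (onSide u [] j) (onSide u [] j)) (fun u _ => dirichlet_self_nonneg _ _)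
      (fun u hu => ?_) (fun u hu => ?_) hu
    · rw [dirichlet_onSide_comp j (H1.sobolev_onSide_nil hu j)]
      exact mul_le_mul_of_nonneg_left (sub_le_self _ (dirichlet_self_nonneg _ _)) ratio_nonneg
    · have := (H1.sobolev_onSide_nil hu j).sq_sub_le (x := 0) (y := 1) ⟨le_rfl, zero_le_one⟩
        ⟨zero_le_one, le_rfl⟩
      rwa [onSide_zero, onSide_one, one_mul] at this

/-! ### The space `H¹(X)` -/

theorem const_mem_H1 (c : ℝ) : (fun _ : attractor α => c) ∈ H1 α := by
  refine mem_H1_iff.2 ⟨const_mem_joinH1 c, fun w j => ?_⟩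
  refine ((hasSobolevDeriv_const _ c).congr fun t ht => ?_).memH1 (pow_nonneg ratio_nonneg _)
  rw [onSide, along_eq _ (sideCurve_mem hα.pos hα.le_one w j ht)]

theorem add_mem_H1 {u v : attractor α → ℝ} (hu : u ∈ H1 α) (hv : v ∈ H1 α) : u + v ∈ H1 α := by
  refine mem_H1_iff.2 ⟨add_mem_joinH1 (mem_H1_iff.1 hu).1 (mem_H1_iff.1 hv).1, fun w j => ?_⟩
  rw [onSide_add]
  exact ((H1.sobolev_onSide hu w j).add (H1.sobolev_onSide hv w j)).choose_spec.memH1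
    (pow_nonneg ratio_nonneg _)

theorem smul_mem_H1 (c : ℝ) {u : attractor α → ℝ} (hu : u ∈ H1 α) : c • u ∈ H1 α := by
  refine mem_H1_iff.2 ⟨smul_mem_joinH1 c (mem_H1_iff.1 hu).1, fun w j => ?_⟩
  rw [onSide_smul]
  exact ((H1.sobolev_onSide hu w j).const_smul c).choose_spec.memH1 (pow_nonneg ratio_nonneg _)

theorem sub_mem_H1 {u v : attractor α → ℝ} (hu : u ∈ H1 α) (hv : v ∈ H1 α) : u - v ∈ H1 α := by
  simpa [sub_eq_add_neg] using add_mem_H1 hu (smul_mem_H1 (-1) hv)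

/-- A normalized sequence that is Cauchy in energy converges uniformly. -/
theorem IsRegularClass.exists_tendsto {𝒞 : Set (attractor α → ℝ)} (h : IsRegularClass 𝒞)
    {s : ℕ → attractor α → ℝ} (hs : ∀ n, Continuous (s n)) (hd : ∀ m n, s m - s n ∈ 𝒞)
    (hC : ∀ ε > 0, ∃ N, ∀ m ≥ N, ∀ n ≥ N, energy α (s m - s n) (s m - s n) < ε) :
    ∃ u : attractor α → ℝ, Continuous u ∧
      ∀ x, Tendsto (fun n => s n x - s n (vertex α 0)) atTop (𝓝 (u x)) := by
  let f : ℕ → C(attractor α, ℝ) := fun n =>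
    ⟨fun x => s n x - s n (vertex α 0), (hs n).sub continuous_const⟩
  have hf : CauchySeq f := by
    rw [Metric.cauchySeq_iff]
    intro ε hε
    obtain ⟨N, hN⟩ := hC ((ε / 16) ^ 2) (by positivity)
    refine ⟨N, fun m hm n hn => lt_of_le_of_lt ((ContinuousMap.dist_le (C := ε / 2)
      (by positivity)).2 fun x => ?_) (half_lt_self hε)⟩
    have h1 := h.osc_vertex_le (hd m n) x 0
    have h2 := (Real.sqrt_lt_sqrt (energy_self_nonneg _) (hN m hm n hn)).le
    rw [Real.sqrt_sq (by positivity)] at h2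
    have e : dist (f m x) (f n x) = |(s m - s n) x - (s m - s n) (vertex α 0)| := by
      rw [Real.dist_eq]
      simp only [f, ContinuousMap.coe_mk, Pi.sub_apply]
      congr 1
      ring
    rw [e]
    linarith
  obtain ⟨u, hu⟩ := cauchySeq_tendsto_of_complete hf
  exact ⟨u, u.continuous, fun x => ((continuous_eval_const x).tendsto u).comp hu⟩

/-- Closedness of the energy on `JoinH1 α` with respect to pointwise convergence to a continuous
function. -/
theorem JoinH1.of_tendsto {s : ℕ → attractor α → ℝ} (hs : ∀ n, s n ∈ JoinH1 α)
    (hC : ∀ ε > 0, ∃ N, ∀ m ≥ N, ∀ n ≥ N, energy α (s m - s n) (s m - s n) < ε)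
    {u : attractor α → ℝ} (hu : Continuous u) (hlim : ∀ x, Tendsto (fun n => s n x) atTop (𝓝 (u x))) :
    u ∈ JoinH1 α ∧ Tendsto (fun n => energy α (s n - u) (s n - u)) atTop (𝓝 0) := by
  have hseg : ∀ w j, Sobolev (joinLength α w) (onJoin u w j) ∧
      Tendsto (fun n => joinEnergy (s n - u) (s n - u) w j) atTop (𝓝 0) := by
    intro w j
    have := Sobolev.of_tendsto (joinLength_nonneg w) (fun n => JoinH1.sobolev (hs n) w j)
      (fun ε hε => ?_) (f := onJoin u w j) (fun t ht => ?_)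
    · simpa only [joinEnergy, onJoin_sub] using this
    · obtain ⟨N, hN⟩ := hC ε hε
      refine ⟨N, fun m hm n hn => lt_of_le_of_lt ?_ (hN m hm n hn)⟩
      have := (sub_mem_joinH1 (hs m) (hs n)).2.2.le_tsum (w, j)
        fun e _ => joinEnergy_self_nonneg _ e.1 e.2
      simpa only [energy, joinEnergy, onJoin_sub] using this
    · have hmem := joinCurve_mem hα.pos hα.le_one w j ht
      simpa only [onJoin, along_eq _ hmem] using hlim ⟨_, hmem⟩
  have hsub : ∀ n w j, Sobolev (joinLength α w) (onJoin (s n - u) w j) := fun n w j => by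
    rw [onJoin_sub]
    exact (JoinH1.sobolev (hs n) w j).sub (hseg w j).1
  -- Fatou's lemma for the sum over the joining segments
  have hsum : ∀ ε > 0, ∃ N, ∀ n ≥ N, ∀ F : Finset (List (Fin 3) × Fin 3),
      ∑ e ∈ F, joinEnergy (s n - u) (s n - u) e.1 e.2 ≤ ε := by
    intro ε hε
    obtain ⟨N, hN⟩ := hC (ε / 2) (by positivity)
    refine ⟨N, fun n hn F => ?_⟩
    have hb : ∀ m ≥ N, ∑ e ∈ F, joinEnergy (s n - u) (s n - u) e.1 e.2 ≤
        ε + 2 * ∑ e ∈ F, joinEnergy (s m - u) (s m - u) e.1 e.2 := by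
      intro m hm
      have h1 : ∑ e ∈ F, joinEnergy (s n - s m) (s n - s m) e.1 e.2 ≤ ε / 2 :=
        ((sub_mem_joinH1 (hs n) (hs m)).2.2.sum_le_tsum F
          fun e _ => joinEnergy_self_nonneg _ _ _).trans (hN n hn m hm).le
      have h2 : ∀ e ∈ F, joinEnergy (s n - u) (s n - u) e.1 e.2 ≤
          2 * joinEnergy (s n - s m) (s n - s m) e.1 e.2 +
            2 * joinEnergy (s m - u) (s m - u) e.1 e.2 := fun e _ => by
        have h3 : onJoin (s n - u) e.1 e.2 =
            onJoin (s n - s m) e.1 e.2 + onJoin (s m - u) e.1 e.2 := by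
          rw [← onJoin_add, sub_add_sub_cancel]
        have h4 := JoinH1.sobolev (sub_mem_joinH1 (hs n) (hs m)) e.1 e.2
        have h5 := two_mul_abs_dirichlet_le (joinLength_nonneg e.1) h4 (hsub m e.1 e.2)
        have h6 := dirichlet_add_self (joinLength_nonneg e.1) h4 (hsub m e.1 e.2)
        have h7 := le_abs_self (dirichlet (joinLength α e.1) (onJoin (s n - s m) e.1 e.2)
          (onJoin (s m - u) e.1 e.2))
        simp only [joinEnergy]
        rw [h3, h6]
        linarith
      have := Finset.sum_le_sum h2
      rw [Finset.sum_add_distrib, ← Finset.mul_sum, ← Finset.mul_sum] at this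
      linarith
    have hlim0 : Tendsto (fun m => ε + 2 * ∑ e ∈ F, joinEnergy (s m - u) (s m - u) e.1 e.2) atTop
        (𝓝 ε) := by
      have := ((tendsto_finsetSum F fun e _ => (hseg e.1 e.2).2).const_mul 2).const_add ε
      simpa using this
    exact ge_of_tendsto hlim0 (eventually_atTop.2 ⟨N, hb⟩)
  have hmem : u ∈ JoinH1 α := by
    obtain ⟨N, hN⟩ := hsum 1 one_pos
    have h1 : s N - u ∈ JoinH1 α := ⟨(hs N).1.sub hu, fun w j =>
      (hsub N w j).choose_spec.memH1 (joinLength_nonneg w),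
      summable_of_sum_le (fun e => joinEnergy_self_nonneg _ _ _) (hN N le_rfl)⟩
    simpa using sub_mem_joinH1 (hs N) h1
  refine ⟨hmem, ?_⟩
  rw [Metric.tendsto_atTop]
  intro ε hε
  obtain ⟨N, hN⟩ := hsum (ε / 2) (by positivity)
  refine ⟨N, fun n hn => ?_⟩
  rw [Real.dist_eq, sub_zero, abs_of_nonneg (energy_self_nonneg _)]
  refine lt_of_le_of_lt ?_ (half_lt_self hε)
  exact Real.tsum_le_of_sum_le (fun e => joinEnergy_self_nonneg _ _ _) (hN n hn)

end

section

variable {α : ℝ}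

/-! ### Completeness -/

/-- For `α = 1` the sides of the triangle are the only segments of positive length. -/
theorem joinH1_subset_H1_of_eq_one (h1 : α = 1) : JoinH1 α ⊆ H1 α := by
  have hr : ratio α = 0 := by rw [ratio, h1]; norm_num
  refine fun u hu => mem_H1_iff.2 ⟨hu, fun w j => ?_⟩
  cases w with
  | nil =>
    have e : onSide u [] j = onJoin u [] j := by
      ext t
      rw [onSide_middle, hr, zero_add]
    have := hu.2.1 [] j
    rw [joinLength_nil, ← e] at this
    have e1 : ratio α ^ ([] : List (Fin 3)).length = α := by
      rw [List.length_nil, pow_zero, h1]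
    rw [e1]
    exact this
  | cons i w =>
    rw [List.length_cons, pow_succ, hr, mul_zero]
    exact memH1_zero_length _

variable [hα : Admissible α]

theorem cellConst_subset_H1 (n : ℕ) : cellConst α n ⊆ H1 α := by
  induction n with
  | zero =>
    rintro _ ⟨c, rfl⟩
    exact const_mem_H1 c
  | succ n ih => exact fun u hu => (mem_H1_iff_scaling hu.1).2 ⟨fun i => ih (hu.2.1 i), hu.2.2⟩

theorem comp_mem_cellConst {n : ℕ} {u : attractor α → ℝ} (hu : u ∈ cellConst α n) (i : Fin 3) :
    u ∘ cellMap α i ∈ cellConst α n := by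
  cases n with
  | zero =>
    obtain ⟨c, rfl⟩ := hu
    exact ⟨c, rfl⟩
  | succ n => exact cellConst_subset_succ n (hu.2.1 i)

/-- For functions that are constant on small cells, the energy on a side is at most the energy of
all joining segments. -/
theorem dirichlet_onSide_le (h1 : α < 1) (j : Fin 3) (n : ℕ) : ∀ u ∈ cellConst α n,
    dirichlet 1 (onSide u [] j) (onSide u [] j) ≤ energy α u u := by
  induction n with
  | zero =>
    rintro _ ⟨c, rfl⟩
    have h : HasSobolevDeriv 1 (onSide (fun _ : attractor α => c) [] j) fun _ => 0 :=
      (hasSobolevDeriv_const 1 c).congr fun t ht => by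
        rw [onSide, along_eq _ (sideCurve_nil_mem j ht)]
    rw [dirichlet_eq zero_le_one h h]
    simpa using energy_self_nonneg _
  | succ n ih =>
    intro u hu
    have h2 := dirichlet_onSide_comp j
      (H1.sobolev_onSide_nil (cellConst_subset_H1 _ hu) j)
    have h3 := add_energy_comp_le (cellConst_subset_joinH1 _ hu) j
    have h4 := ih _ (hu.2.1 (j + 1))
    have h5 := ih _ (hu.2.1 (j + 2))
    have h6 := le_of_mul_le_mul_left ((h2.symm.le.trans (add_le_add h4 h5)).trans h3)
      (ratio_pos h1)
    linarith

/-- On the sides of a smaller cell, the estimate `dirichlet_onSide_le` is applied to the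
restrictions to that cell. -/
theorem sobolev_onSide_of_tendsto (h1 : α < 1) (w : List (Fin 3)) (j : Fin 3) :
    ∀ (s : ℕ → attractor α → ℝ), (∀ n, ∃ k, s n ∈ cellConst α k) →
    (∀ ε > 0, ∃ N, ∀ m ≥ N, ∀ n ≥ N, energy α (s m - s n) (s m - s n) < ε) →
    ∀ u : attractor α → ℝ, Continuous u → (∀ x, Tendsto (fun n => s n x) atTop (𝓝 (u x))) →
    MemH1 (ratio α ^ w.length) (onSide u w j) := by
  have hsub : ∀ u v : attractor α → ℝ, (∃ k, u ∈ cellConst α k) → (∃ k, v ∈ cellConst α k) →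
      ∃ k, u - v ∈ cellConst α k := by
    rintro u v ⟨k, hk⟩ ⟨l, hl⟩
    exact ⟨max k l, sub_mem_cellConst _ _ (cellConst_mono (le_max_left k l) hk) _
      (cellConst_mono (le_max_right k l) hl)⟩
  induction w with
  | nil =>
    intro s hs hC u hu hlim
    rw [memH1_onSide_iff hu, List.length_nil, pow_zero]
    refine (Sobolev.of_tendsto zero_le_one (s := fun n => onSide (s n) [] j) (fun n => ?_)
      (fun ε hε => ?_) (fun t ht => ?_)).1
    · obtain ⟨k, hk⟩ := hs n
      exact H1.sobolev_onSide_nil (cellConst_subset_H1 k hk) j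
    · obtain ⟨N, hN⟩ := hC ε hε
      refine ⟨N, fun m hm n hn => lt_of_le_of_lt ?_ (hN m hm n hn)⟩
      obtain ⟨k, hk⟩ := hsub _ _ (hs m) (hs n)
      simpa only [onSide_sub] using dirichlet_onSide_le h1 j k _ hk
    · have hmem := sideCurve_nil_mem (α := α) j ht
      simpa only [onSide, along_eq _ hmem] using hlim ⟨_, hmem⟩
  | cons i w ih =>
    intro s hs hC u hu hlim
    refine (memH1_onSide_comp_iff hu i w j).1 (ih (fun n => s n ∘ cellMap α i) (fun n => ?_)
      (fun ε hε => ?_) _ (hu.comp (continuous_cellMap i)) fun x => hlim _)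
    · obtain ⟨k, hk⟩ := hs n
      exact ⟨k, comp_mem_cellConst hk i⟩
    · obtain ⟨N, hN⟩ := hC ε hε
      refine ⟨N, fun m hm n hn => lt_of_le_of_lt ?_ (hN m hm n hn)⟩
      obtain ⟨k, hk⟩ := hsub _ _ (hs m) (hs n)
      have h2 := energy_comp_le (cellConst_subset_joinH1 k hk) i
      have h3 := energy_self_nonneg (s m - s n)
      have h4 : ratio α < 1 / 2 := ratio_lt_half
      exact h2.trans (by nlinarith)

theorem sub_const_mem_cellConst {n : ℕ} {v : attractor α → ℝ} (hv : v ∈ cellConst α n) (c : ℝ) :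
    v - (fun _ => c) ∈ cellConst α n :=
  sub_mem_cellConst n _ hv _ (const_mem_cellConst n c)

/-- The limit of a normalized Cauchy sequence is `H¹` on the sides because it is also the limit of
functions that are constant on small cells. -/
theorem H1_complete {s : ℕ → attractor α → ℝ} (hs : ∀ n, s n ∈ H1 α)
    (hC : ∀ ε > 0, ∃ N, ∀ m ≥ N, ∀ n ≥ N, energy α (s m - s n) (s m - s n) < ε) :
    ∃ u ∈ H1 α, Tendsto (fun n => energy α (s n - u) (s n - u)) atTop (𝓝 0) := by
  have hJ : ∀ n, s n ∈ JoinH1 α := fun n => isRegularClass_H1.subset (hs n)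
  have hconst : ∀ (v : attractor α → ℝ) (c : ℝ), v - (fun _ => c) = v + fun _ => -c := by
    intro v c
    ext x
    simp [sub_eq_add_neg]
  obtain ⟨u, huc, hlim⟩ := isRegularClass_H1.exists_tendsto (fun n => (hJ n).1)
    (fun m n => sub_mem_H1 (hs m) (hs n)) hC
  let s' : ℕ → attractor α → ℝ := fun n => s n - fun _ => s n (vertex α 0)
  have hs' : ∀ n, s' n ∈ H1 α := fun n => sub_mem_H1 (hs n) (const_mem_H1 _)
  have hs's : ∀ m n, energy α (s' m - s' n) (s' m - s' n) =
      energy α (s m - s n) (s m - s n) := fun m n => by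
    have e : s' m - s' n = (s m - s n) + fun _ => s n (vertex α 0) - s m (vertex α 0) := by
      ext x
      simp only [s', Pi.sub_apply, Pi.add_apply]
      ring
    rw [e, energy_add_const (sub_mem_joinH1 (hJ m) (hJ n))]
  obtain ⟨huJ, hE⟩ := JoinH1.of_tendsto (s := s') (fun n => isRegularClass_H1.subset (hs' n))
    (by simpa only [hs's] using hC) huc hlim
  have hE' : Tendsto (fun n => energy α (s n - u) (s n - u)) atTop (𝓝 0) := by
    refine hE.congr fun n => ?_
    have e : s' n - u = (s n - u) + fun _ => -s n (vertex α 0) := by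
      ext x
      simp only [s', Pi.sub_apply, Pi.add_apply]
      ring
    rw [e, energy_add_const (sub_mem_joinH1 (hJ n) huJ)]
  refine ⟨u, ?_, hE'⟩
  rcases hα.le_one.eq_or_lt with h1 | h1
  · exact joinH1_subset_H1_of_eq_one h1 huJ
  -- replace the sequence by one for which the energy on the sides is controlled
  choose k t ht htE using fun n : ℕ => isRegularClass_H1.exists_cellConst_lt h1 (hs' n)
    (ε := 1 / ((n : ℝ) + 1)) (by positivity)
  have htJ : ∀ n, t n ∈ JoinH1 α := fun n => cellConst_subset_joinH1 _ (ht n)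
  have hs'J : ∀ n, s' n ∈ JoinH1 α := fun n => isRegularClass_H1.subset (hs' n)
  have hone : Tendsto (fun n : ℕ => 1 / ((n : ℝ) + 1)) atTop (𝓝 0) :=
    tendsto_one_div_add_atTop_nhds_zero_nat
  have hst : Tendsto (fun n => energy α (s' n - t n) (s' n - t n)) atTop (𝓝 0) :=
    squeeze_zero (fun n => energy_self_nonneg _) (fun n => (htE n).le) hone
  have htu : Tendsto (fun n => energy α (t n - u) (t n - u)) atTop (𝓝 0) := by
    have h2 := (hst.const_mul 2).add (hE.const_mul 2)
    rw [mul_zero, add_zero] at h2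
    refine squeeze_zero (fun n => energy_self_nonneg _) (fun n => ?_) h2
    have e : t n - u = (t n - s' n) + (s' n - u) := by abel
    rw [e, energy_sub_comm (hs'J n) (htJ n)]
    exact energy_add_le (sub_mem_joinH1 (htJ n) (hs'J n)) (sub_mem_joinH1 (hs'J n) huJ)
  let t' : ℕ → attractor α → ℝ := fun n => t n - fun _ => t n (vertex α 0)
  have ht' : ∀ n, t' n ∈ cellConst α (k n) := fun n => sub_const_mem_cellConst (ht n) _
  have hC' : ∀ ε > 0, ∃ N, ∀ m ≥ N, ∀ n ≥ N, energy α (t' m - t' n) (t' m - t' n) < ε := by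
    intro ε hε
    obtain ⟨N, hN⟩ := eventually_atTop.1 (htu.eventually (gt_mem_nhds (show 0 < ε / 4 by positivity)))
    refine ⟨N, fun m hm n hn => ?_⟩
    have e : t' m - t' n = ((t m - u) + (u - t n)) +
        fun _ => t n (vertex α 0) - t m (vertex α 0) := by
      ext x
      simp only [t', Pi.sub_apply, Pi.add_apply]
      ring
    have hm1 := sub_mem_joinH1 (htJ m) huJ
    have hn1 := sub_mem_joinH1 huJ (htJ n)
    rw [e, energy_add_const (add_mem_joinH1 hm1 hn1)]
    have h3 := energy_add_le hm1 hn1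
    rw [energy_sub_comm huJ (htJ n)] at h3
    linarith [hN m hm, hN n hn]
  have hlim' : ∀ x, Tendsto (fun n => t' n x) atTop (𝓝 (u x)) := by
    intro x
    have h2 : Tendsto (fun n => t' n x - s' n x) atTop (𝓝 0) := by
      have h3 := (hst.sqrt).const_mul 8
      rw [Real.sqrt_zero, mul_zero] at h3
      refine squeeze_zero_norm (fun n => ?_) h3
      have h4 := isRegularClass_H1.osc_vertex_le
        (sub_mem_H1 (hs' n) (cellConst_subset_H1 _ (ht n))) x 0
      rw [Real.norm_eq_abs, abs_sub_comm]
      have e : s' n x - t' n x = (s' n - t n) x - (s' n - t n) (vertex α 0) := by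
        simp only [s', t', Pi.sub_apply]
        ring
      rw [e]
      exact h4
    have := h2.add (hlim x)
    simpa [s'] using this
  exact mem_H1_iff.2 ⟨huJ, fun w j => sobolev_onSide_of_tendsto h1 w j t'
    (fun n => ⟨_, ht' n⟩) hC' u huc hlim'⟩

/-! ### Separation of points -/

theorem exists_cellConst_comp (h1 : α < 1) {n : ℕ} {v : Fin 3 → attractor α → ℝ}
    (hv : ∀ i, v i ∈ cellConst α n) : ∃ u ∈ cellConst α (n + 1), ∀ i, u ∘ cellMap α i = v i := by
  have hα0 := hα.pos
  let g : Fin 3 → ℝ → ℝ := fun j t => v (j + 1) (vertex α (j + 2)) +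
    ((v (j + 2) (vertex α (j + 1)) - v (j + 1) (vertex α (j + 2))) / α) * t
  have hg : ∀ j, Sobolev α (g j) := fun j => sobolev_affine _ _ _
  obtain ⟨u, huc, huv, huj⟩ := exists_glue h1 (v := v) (g := g)
    (fun i => (cellConst_subset_joinH1 n (hv i)).1) (fun j => (hg j).continuousOn)
    (fun j => by simp [g]) (fun j => by simp only [g]; field_simp; ring)
  exact ⟨u, ⟨huc, fun i => by rw [huv]; exact hv i, fun j =>
    (memH1_onJoin_nil_iff huc j).2 ((hg j).congr (huj j).symm)⟩, huv⟩

/-- The tent function with peak at the parameter `t` of a joining segment, extended by zero. -/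
theorem exists_tent (h1 : α < 1) (j : Fin 3) {t : ℝ} (ht : t ∈ Ioo 0 α) :
    ∃ u ∈ cellConst α 1, (∀ i y, u (cellMap α i y) = 0) ∧ (∀ k ≠ j, ∀ s ∈ Icc 0 α,
      onJoin u [] k s = 0) ∧ ∀ s ∈ Icc 0 α, onJoin u [] j s = min (s / t) ((α - s) / (α - t)) := by
  have hα0 := hα.pos
  have hαt : 0 < α - t := sub_pos.2 ht.2
  let g : Fin 3 → ℝ → ℝ := fun k s => if k = j then min (s / t) ((α - s) / (α - t)) else 0
  have hg : ∀ k, Sobolev α (g k) := by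
    intro k
    by_cases hk : k = j
    · simp only [g, if_pos hk]
      refine (Sobolev.of_dist_le hα0.le (sobolev_affine α 0 (1 / t + 1 / (α - t)))
        fun x _ y _ => ?_).1
      refine (abs_min_sub_min_le_max _ _ _ _).trans ?_
      have e1 : y / t - x / t = 1 / t * (y - x) := by ring
      have e2 : (α - y) / (α - t) - (α - x) / (α - t) = -(1 / (α - t) * (y - x)) := by
        field_simp; ring
      have e3 : 0 + (1 / t + 1 / (α - t)) * y - (0 + (1 / t + 1 / (α - t)) * x) =
          (1 / t + 1 / (α - t)) * (y - x) := by ring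
      have p1 : 0 < 1 / t := one_div_pos.2 ht.1
      have p2 : 0 < 1 / (α - t) := one_div_pos.2 hαt
      rw [e1, e2, e3, abs_neg, abs_mul, abs_mul, abs_mul, abs_of_pos p1, abs_of_pos p2,
        abs_of_pos (add_pos p1 p2)]
      refine max_le ?_ ?_ <;> refine mul_le_mul_of_nonneg_right ?_ (abs_nonneg _) <;> linarith
    · simp only [g, if_neg hk]
      exact ⟨_, hasSobolevDeriv_const α 0⟩
  obtain ⟨u, huc, huv, huj⟩ := exists_glue h1 (v := fun _ _ => 0) (g := g)
    (fun i => continuous_const) (fun j => (hg j).continuousOn)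
    (fun k => by
      simp only [g]
      split_ifs
      · have := div_nonneg hα0.le hαt.le
        simpa using this
      · rfl)
    (fun k => by
      simp only [g]
      split_ifs
      · have := div_nonneg hα0.le ht.1.le
        simpa using this
      · rfl)
  refine ⟨u, ⟨huc, fun i => ⟨0, huv i⟩, fun k =>
    (memH1_onJoin_nil_iff huc k).2 ((hg k).congr (huj k).symm)⟩, fun i y => congrFun (huv i) y,
    fun k hk s hs => ?_, fun s hs => ?_⟩
  · rw [huj k hs]
    simp [g, hk]
  · rw [huj j hs]
    simp [g]

/-- The end points of a joining segment belong to cells. -/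
theorem exists_cell_or_join_interior (x : attractor α) :
    (∃ i y, x = cellMap α i y) ∨ ∃ j, ∃ t ∈ Ioo 0 α, ∃ h : joinCurve α [] j t ∈ attractor α,
      x = ⟨joinCurve α [] j t, h⟩ := by
  rcases exists_cell_or_join x with h | ⟨j, t, ht, hx⟩
  · exact Or.inl h
  have key : ∀ y : attractor α, (∀ u : attractor α → ℝ, onJoin u [] j t = u y) → x = y := by
    intro y hy
    have h1 := hy (fun z => dist z y)
    rw [dist_self, onJoin, along_eq _ (joinCurve_mem_nil ht)] at h1
    rw [← dist_eq_zero.1 h1]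
    exact Subtype.ext hx
  rcases ht.1.eq_or_lt with h0 | h0
  · exact Or.inl ⟨_, _, key _ fun u => by rw [← h0]; exact onJoin_zero u j⟩
  rcases ht.2.eq_or_lt with h1 | h1
  · exact Or.inl ⟨_, _, key _ fun u => by rw [h1]; exact onJoin_end u j⟩
  exact Or.inr ⟨j, t, ⟨h0, h1⟩, joinCurve_mem_nil ht, Subtype.ext hx⟩

theorem exists_separating_of_join (h1 : α < 1) (j : Fin 3) {t : ℝ} (ht : t ∈ Ioo 0 α)
    (h : joinCurve α [] j t ∈ attractor α) (y : attractor α) (hy : y ≠ ⟨joinCurve α [] j t, h⟩) :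
    ∃ u ∈ cellConst α 1, u ⟨joinCurve α [] j t, h⟩ ≠ u y := by
  obtain ⟨u, hu, hu0, huk, huj⟩ := exists_tent h1 j ht
  have hαt : 0 < α - t := sub_pos.2 ht.2
  refine ⟨u, hu, ?_⟩
  have e1 : u ⟨joinCurve α [] j t, h⟩ = 1 := by
    have := huj t (Ioo_subset_Icc_self ht)
    rw [div_self ht.1.ne', div_self hαt.ne', min_self, onJoin, along_eq _ h] at this
    exact this
  rw [e1]
  rcases exists_cell_or_join_interior y with ⟨i, z, rfl⟩ | ⟨k, s, hs, hm, rfl⟩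
  · rw [hu0]
    norm_num
  · have e2 : u ⟨joinCurve α [] k s, hm⟩ = onJoin u [] k s := (along_eq u hm).symm
    rw [e2]
    by_cases hk : k = j
    · subst hk
      rw [huj s (Ioo_subset_Icc_self hs)]
      intro he
      have h2 : 1 ≤ s / t := he.le.trans (min_le_left _ _)
      have h3 : 1 ≤ (α - s) / (α - t) := he.le.trans (min_le_right _ _)
      rw [one_le_div ht.1] at h2
      rw [one_le_div hαt] at h3
      have : s = t := by linarith
      subst this
      exact hy rfl
    · rw [huk k hk s (Ioo_subset_Icc_self hs)]
      norm_num

/-- Points at distance more than `r ^ n * B` do not lie in a common cell of level `n`. They are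
separated at the first level where they leave a common cell. -/
theorem exists_cellConst_separating (h1 : α < 1) {B : ℝ} (hB : ∀ x y : attractor α, dist x y ≤ B)
    (n : ℕ) : ∀ x y : attractor α, ratio α ^ n * B < dist x y →
      ∃ u ∈ cellConst α n, u x ≠ u y := by
  have hr0 : 0 < ratio α := ratio_pos h1
  have hB0 : 0 ≤ B := dist_nonneg.trans (hB (vertex α 0) (vertex α 0))
  have hone : ∀ n, cellConst α 1 ⊆ cellConst α (n + 1) := fun n =>
    cellConst_mono (Nat.le_add_left 1 n)
  induction n with
  | zero =>
    intro x y hxy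
    rw [pow_zero, one_mul] at hxy
    exact absurd (hB x y) (not_le.2 hxy)
  | succ n ih =>
    intro x y hxy
    have hne : x ≠ y := by
      rintro rfl
      rw [dist_self] at hxy
      exact absurd hxy (not_lt.2 (by positivity))
    rcases exists_cell_or_join_interior x with ⟨i, x, rfl⟩ | ⟨j, t, ht, h, rfl⟩
    · rcases exists_cell_or_join_interior y with ⟨k, y, rfl⟩ | ⟨j, t, ht, h, rfl⟩
      · by_cases hik : k = i
        · subst hik
          rw [dist_cellMap, pow_succ', mul_assoc, mul_lt_mul_iff_right₀ hr0] at hxy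
          obtain ⟨v, hv, hvne⟩ := ih x y hxy
          obtain ⟨u, hu, huv⟩ := exists_cellConst_comp h1 (v := fun _ => v) fun _ => hv
          exact ⟨u, hu, by simpa [← huv k] using hvne⟩
        · obtain ⟨u, hu, huv⟩ := exists_cellConst_comp (α := α) h1 (n := 0)
            (v := fun l _ => if l = i then 1 else 0) fun l => ⟨_, rfl⟩
          refine ⟨u, hone n hu, ?_⟩
          have e1 := congrFun (huv i) x
          have e2 := congrFun (huv k) y
          simp only [Function.comp, if_true, if_neg hik] at e1 e2
          rw [e1, e2]
          norm_num
      · obtain ⟨u, hu, hne'⟩ := exists_separating_of_join h1 j ht h _ hne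
        exact ⟨u, hone n hu, hne'.symm⟩
    · obtain ⟨u, hu, hne'⟩ := exists_separating_of_join h1 j ht h _ hne.symm
      exact ⟨u, hone n hu, hne'⟩

theorem H1_separates {x y : attractor α} (hxy : x ≠ y) : ∃ u ∈ H1 α, u x ≠ u y := by
  rcases hα.le_one.eq_or_lt with h1 | h1
  · -- for `α = 1` the barycentric coordinates have finite energy
    have hr : ratio α = 0 := by rw [ratio, h1]; norm_num
    have : ∃ i, bary i (x : Plane) ≠ bary i y := by
      by_contra! h
      exact hxy (Subtype.ext (bary_ext h))
    obtain ⟨i, hi⟩ := this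
    have hslope : ∀ j : Fin 3, ∃ c : ℝ, ∀ (z : Plane) (t : ℝ),
        bary i (z + t • sideDir j) = bary i z + c * t := by
      intro j
      have h2 := fun z t => bary_add_smul_sideDir j z t
      rcases exists_cases j i with rfl | rfl | rfl
      · exact ⟨0, fun z t => by rw [(h2 z t).1]; ring⟩
      · exact ⟨-1, fun z t => by rw [(h2 z t).2.1]; ring⟩
      · exact ⟨1, fun z t => by rw [(h2 z t).2.2]; ring⟩
    refine ⟨fun z => bary i z, joinH1_subset_H1_of_eq_one h1 ⟨(continuous_bary i).comp
      continuous_subtype_val, fun w j => ?_, summable_words.2 fun k => ?_⟩, hi⟩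
    · obtain ⟨c, hc⟩ := hslope j
      refine ((hasSobolevDeriv_affine (joinLength α w)
        (bary i (wordMap α w (simil α (j + 1) (corner (j + 2))))) c).congr fun t ht => ?_).memH1
        (joinLength_nonneg w)
      rw [onJoin, along_eq _ (joinCurve_mem hα.pos hα.le_one w j ht)]
      exact (hc _ t).symm
    · simp only [joinEnergy, joinLength_cons, hr, zero_mul, dirichlet_zero_length]
      exact summable_zero
  · obtain ⟨B, hB⟩ := Metric.isBounded_iff.1
      (Metric.isBounded_of_compactSpace (s := (univ : Set (attractor α))))
    have hlim : Tendsto (fun n : ℕ => ratio α ^ n * B) atTop (𝓝 0) := by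
      simpa using (tendsto_pow_atTop_nhds_zero_of_lt_one ratio_nonneg
        (by linarith [ratio_lt_half (α := α)])).mul_const B
    obtain ⟨n, hn⟩ := (hlim.eventually (gt_mem_nhds (dist_pos.2 hxy))).exists
    obtain ⟨u, hu, hne⟩ := exists_cellConst_separating h1
      (fun x y => hB (mem_univ x) (mem_univ y)) n x y hn
    exact ⟨u, cellConst_subset_H1 n hu, hne⟩

/-! ### The resistance form -/

theorem abs_clamp_sub_clamp_le (a b : ℝ) :
    |max 0 (min b 1) - max 0 (min a 1)| ≤ |b - a| := by
  refine (abs_max_sub_max_le_max 0 (min b 1) 0 (min a 1)).trans (max_le (by simp) ?_)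
  refine (abs_min_sub_min_le_max b 1 a 1).trans (max_le le_rfl (by simp))

theorem H1_markov {u : attractor α → ℝ} (hu : u ∈ H1 α) :
    (fun x => max 0 (min (u x) 1)) ∈ H1 α ∧
      energy α (fun x => max 0 (min (u x) 1)) (fun x => max 0 (min (u x) 1)) ≤ energy α u u := by
  have hal : ∀ (γ : ℝ → Plane) (t : ℝ), along (fun x : attractor α => max 0 (min (u x) 1)) γ t =
      max 0 (min (along u γ t) 1) := by
    intro γ t
    simp only [along]
    split_ifs <;> simp
  have hJ := (mem_H1_iff.1 hu).1
  have hjoin := fun w j => (JoinH1.sobolev hJ w j).of_dist_le (joinLength_nonneg w)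
    (f' := onJoin (fun x => max 0 (min (u x) 1)) w j) fun x _ y _ => by
      simp only [onJoin, hal]
      exact abs_clamp_sub_clamp_le _ _
  have hside := fun w j => (H1.sobolev_onSide hu w j).of_dist_le (pow_nonneg ratio_nonneg _)
    (f' := onSide (fun x => max 0 (min (u x) 1)) w j) fun x _ y _ => by
      simp only [onSide, hal]
      exact abs_clamp_sub_clamp_le _ _
  have hsum : Summable fun e : List (Fin 3) × Fin 3 => joinEnergy
      (fun x : attractor α => max 0 (min (u x) 1)) (fun x => max 0 (min (u x) 1)) e.1 e.2 :=
    Summable.of_nonneg_of_le (fun e => joinEnergy_self_nonneg _ _ _)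
      (fun e => (hjoin e.1 e.2).2) hJ.2.2
  refine ⟨⟨continuous_const.max (hu.1.min continuous_const),
    fun w j => (hside w j).1.choose_spec.memH1 (pow_nonneg ratio_nonneg _),
    fun w j => (hjoin w j).1.choose_spec.memH1 (joinLength_nonneg w), hsum⟩, ?_⟩
  exact hsum.tsum_le_tsum (fun e => (hjoin e.1 e.2).2) hJ.2.2

theorem isResistanceForm_H1 : IsResistanceForm (energy α) (H1 α) where
  const_mem := const_mem_H1
  add_mem := fun u hu v hv => add_mem_H1 hu hv
  smul_mem := fun c u hu => smul_mem_H1 c hu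
  symm := fun u _ v _ => energy_comm u v
  add_left := fun u hu v hv w hw => energy_add_left (isRegularClass_H1.subset hu)
    (isRegularClass_H1.subset hv) (isRegularClass_H1.subset hw)
  smul_left := fun c u hu v hv => energy_smul_left c (isRegularClass_H1.subset hu)
    (isRegularClass_H1.subset hv)
  nonneg := fun u _ => energy_self_nonneg u
  eq_zero_iff := fun u hu => ⟨isRegularClass_H1.eq_const hu, fun ⟨c, hc⟩ => by
    obtain rfl : u = fun _ => c := funext hc
    exact energy_const_left c (const_mem_joinH1 c)⟩
  complete := fun s hs hC => H1_complete hs hC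
  separates := fun x y hxy => H1_separates hxy
  resistance_finite := fun p q => by
    refine ⟨256, ?_⟩
    rintro _ ⟨u, hu, hne, rfl⟩
    have hpos := (energy_self_nonneg u).lt_of_ne' hne
    rw [div_le_iff₀ hpos, ← sq_abs]
    refine (pow_le_pow_left₀ (abs_nonneg _) (isRegularClass_H1.osc_le hu p q) 2).trans ?_
    rw [mul_pow, Real.sq_sqrt hpos.le]
    norm_num
  markov := fun u hu => H1_markov hu

end

/-! ### Uniqueness -/

/-- By the Cauchy–Schwarz inequality, adding a null vector does not change a nonnegative quadratic
form. -/
theorem form_add_eq_of_eq_zero {V : Type*} [AddCommGroup V] [Module ℝ V] {B : V → V → ℝ} {D : Set V}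
    (add_mem : ∀ u ∈ D, ∀ v ∈ D, u + v ∈ D) (smul_mem : ∀ (c : ℝ), ∀ u ∈ D, c • u ∈ D)
    (symm : ∀ u ∈ D, ∀ v ∈ D, B u v = B v u)
    (add_left : ∀ u ∈ D, ∀ v ∈ D, ∀ w ∈ D, B (u + v) w = B u w + B v w)
    (smul_left : ∀ (c : ℝ), ∀ u ∈ D, ∀ v ∈ D, B (c • u) v = c * B u v)
    (nonneg : ∀ u ∈ D, 0 ≤ B u u) {u s : V} (hu : u ∈ D) (hs : s ∈ D) (h : B s s = 0) :
    B (u + s) (u + s) = B u u := by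
  have key : ∀ t : ℝ, B (u + t • s) (u + t • s) = B u u + 2 * t * B s u := by
    intro t
    have ht := smul_mem t s hs
    rw [add_left u hu _ ht _ (add_mem u hu _ ht), symm u hu _ (add_mem u hu _ ht),
      symm _ ht _ (add_mem u hu _ ht), add_left u hu _ ht u hu, add_left u hu _ ht _ ht,
      symm u hu _ ht, smul_left t s hs u hu, smul_left t s hs _ ht, symm s hs _ ht,
      smul_left t s hs s hs, h]
    ring
  have h0 : B s u = 0 := by
    by_contra hne
    have h1 := nonneg _ (add_mem u hu _ (smul_mem (-(B u u + 1) / (2 * B s u)) s hs))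
    rw [key] at h1
    have e : 2 * (-(B u u + 1) / (2 * B s u)) * B s u = -(B u u + 1) := by field_simp
    rw [e] at h1
    linarith
  have := key 1
  rwa [one_smul, h0, mul_zero, add_zero] at this

section ResistanceForm

variable {X : Type*} {E : (X → ℝ) → (X → ℝ) → ℝ} {D : Set (X → ℝ)}

theorem IsResistanceForm.sub_mem (hR : IsResistanceForm E D) {u v : X → ℝ} (hu : u ∈ D)
    (hv : v ∈ D) : u - v ∈ D := by
  have := hR.add_mem u hu _ (hR.smul_mem (-1) v hv)
  rwa [neg_one_smul, ← sub_eq_add_neg] at this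

theorem IsResistanceForm.const_eq_zero (hR : IsResistanceForm E D) (c : ℝ) :
    E (fun _ => c) (fun _ => c) = 0 :=
  (hR.eq_zero_iff _ (hR.const_mem c)).2 ⟨c, fun _ => rfl⟩

theorem IsResistanceForm.add_const (hR : IsResistanceForm E D) {u : X → ℝ} (hu : u ∈ D) (c : ℝ) :
    E (u + fun _ => c) (u + fun _ => c) = E u u :=
  form_add_eq_of_eq_zero hR.add_mem hR.smul_mem hR.symm hR.add_left hR.smul_left hR.nonneg hu
    (hR.const_mem c) (hR.const_eq_zero c)

theorem IsResistanceForm.exists_sq_sub_le (hR : IsResistanceForm E D) (p q : X) :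
    ∃ c : ℝ, 0 ≤ c ∧ ∀ u ∈ D, (u p - u q) ^ 2 ≤ c * E u u := by
  obtain ⟨B, hB⟩ := hR.resistance_finite p q
  refine ⟨max B 0, le_max_right _ _, fun u hu => ?_⟩
  rcases eq_or_ne (E u u) 0 with h0 | h0
  · obtain ⟨c, hc⟩ := (hR.eq_zero_iff u hu).1 h0
    simp [hc, h0]
  · have hpos : 0 < E u u := lt_of_le_of_ne (hR.nonneg u hu) (Ne.symm h0)
    rw [← div_le_iff₀ hpos]
    exact (hB ⟨u, hu, h0, rfl⟩).trans (le_max_left _ _)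

end ResistanceForm

section Scaling

variable {α : ℝ} {E : (attractor α → ℝ) → (attractor α → ℝ) → ℝ} {D : Set (attractor α → ℝ)}
  [hα : Admissible α]

/-- The scaling relation determines the form on functions that are constant on small cells. -/
theorem cellConst_subset_of_scaling (hR : IsResistanceForm E D)
    (hS : SatisfiesScaling α E D) (n : ℕ) :
    ∀ u ∈ cellConst α n, u ∈ D ∧ E u u = energy α u u := by
  induction n with
  | zero =>
    rintro u ⟨c, rfl⟩
    exact ⟨hR.const_mem c, by
      rw [hR.const_eq_zero, energy_const_left c (const_mem_joinH1 c)]⟩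
  | succ n ih =>
    intro u hu
    have hD := ((hS u hu.1).1).2 ⟨fun i => (ih _ (hu.2.1 i)).1, hu.2.2⟩
    refine ⟨hD, ?_⟩
    rw [(hS u hu.1).2 hD, energy_eq_sum (cellConst_subset_joinH1 _ hu)]
    simp only [fun i => (ih _ (hu.2.1 i)).2]

theorem memH1_onJoin_of_scaling (hc : ∀ u ∈ D, Continuous u) (hS : SatisfiesScaling α E D)
    (w : List (Fin 3)) (j : Fin 3) :
    ∀ u ∈ D, MemH1 (joinLength α w) (onJoin u w j) := by
  induction w with
  | nil =>
    intro u hu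
    rw [joinLength_nil]
    exact ((hS u (hc u hu)).1.1 hu).2 j
  | cons i w ih =>
    intro u hu
    exact (memH1_onJoin_comp_iff (hc u hu) i w j).1 (ih _ (((hS u (hc u hu)).1.1 hu).1 i))

/-- Iterating the scaling relation `n` times bounds the energy of the first `n` generations of
joining segments. -/
theorem tsum_joinEnergy_le_of_scaling (hR : IsResistanceForm E D) (hc : ∀ u ∈ D, Continuous u)
    (hS : SatisfiesScaling α E D) (n : ℕ) : ∀ u ∈ D,
      Summable (fun e : List (Fin 3) × Fin 3 =>
        if e.1.length < n then joinEnergy u u e.1 e.2 else 0) ∧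
      ∑' e : List (Fin 3) × Fin 3, (if e.1.length < n then joinEnergy u u e.1 e.2 else 0) ≤
        E u u := by
  induction n with
  | zero =>
    intro u hu
    simp only [not_lt_zero, if_false, tsum_zero]
    exact ⟨summable_zero, hR.nonneg u hu⟩
  | succ n ih =>
    intro u hu
    have hcomp := ((hS u (hc u hu)).1.1 hu).1
    have hcons : ∀ (i : Fin 3) (e : List (Fin 3) × Fin 3),
        (if (i :: e.1).length < n + 1 then joinEnergy u u (i :: e.1) e.2 else 0) =
        (ratio α)⁻¹ * (if e.1.length < n then
          joinEnergy (u ∘ cellMap α i) (u ∘ cellMap α i) e.1 e.2 else 0) := by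
      intro i e
      simp only [List.length_cons, add_lt_add_iff_right, mul_ite, mul_zero]
      congr 1
      exact joinEnergy_cons i e.1 e.2 ((memH1_onJoin_iff (hc u hu) _ _).1
        (memH1_onJoin_of_scaling hc hS _ _ u hu))
    have hsum : Summable (fun e : List (Fin 3) × Fin 3 =>
        if e.1.length < n + 1 then joinEnergy u u e.1 e.2 else 0) := by
      refine summable_words.2 fun i => ?_
      simp only [hcons]
      exact (ih _ (hcomp i)).1.mul_left _
    refine ⟨hsum, ?_⟩
    rw [tsum_words hsum, (hS u (hc u hu)).2 hu]
    simp only [hcons, tsum_mul_left, List.length_nil, Nat.succ_pos, if_true]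
    refine add_le_add (Finset.sum_le_sum fun i _ => mul_le_mul_of_nonneg_left (ih _ (hcomp i)).2
      (inv_nonneg.2 ratio_nonneg)) (Finset.sum_le_sum fun j _ => ?_)
    rw [joinEnergy, joinLength_nil]

theorem mem_joinH1_of_scaling (hR : IsResistanceForm E D) (hc : ∀ u ∈ D, Continuous u)
    (hS : SatisfiesScaling α E D) {u : attractor α → ℝ} (hu : u ∈ D) :
    u ∈ JoinH1 α ∧ energy α u u ≤ E u u := by
  have hle : ∀ F : Finset (List (Fin 3) × Fin 3),
      ∑ e ∈ F, joinEnergy u u e.1 e.2 ≤ E u u := by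
    intro F
    set n := F.sup (fun e => e.1.length) + 1 with hn
    obtain ⟨h1, h2⟩ := tsum_joinEnergy_le_of_scaling hR hc hS n u hu
    refine le_trans (le_of_eq ?_) ((h1.sum_le_tsum F fun e _ => ?_).trans h2)
    · refine Finset.sum_congr rfl fun e he => ?_
      rw [if_pos (Nat.lt_succ_of_le (Finset.le_sup (f := fun e : List (Fin 3) × Fin 3 =>
        e.1.length) he))]
    · split_ifs
      exacts [joinEnergy_self_nonneg _ _ _, le_rfl]
  have hs : Summable fun e : List (Fin 3) × Fin 3 => joinEnergy u u e.1 e.2 :=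
    summable_of_sum_le (fun e => joinEnergy_self_nonneg _ _ _) hle
  exact ⟨⟨hc u hu, fun w j => memH1_onJoin_of_scaling hc hS w j u hu, hs⟩,
    hs.tsum_le_of_sum_le hle⟩

/-- For `α = 1` the functions `u ∘ Fᵢ` are constant, so that the left side vanishes. -/
theorem add_comp_le_of_scaling (hR : IsResistanceForm E D) (hc : ∀ u ∈ D, Continuous u)
    (hS : SatisfiesScaling α E D) (j : Fin 3) {u : attractor α → ℝ} (hu : u ∈ D) :
    E (u ∘ cellMap α (j + 1)) (u ∘ cellMap α (j + 1)) +
      E (u ∘ cellMap α (j + 2)) (u ∘ cellMap α (j + 2)) ≤ ratio α * E u u := by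
  have hcomp := ((hS u (hc u hu)).1.1 hu).1
  rcases (ratio_nonneg (α := α)).eq_or_lt with h0 | h0
  · have hconst : ∀ i, E (u ∘ cellMap α i) (u ∘ cellMap α i) = 0 := fun i =>
      (hR.eq_zero_iff _ (hcomp i)).2 ⟨u (cellMap α i (vertex α 0)), fun x => by
        have : dist (cellMap α i x) (cellMap α i (vertex α 0)) = 0 := by
          rw [dist_cellMap, ← h0, zero_mul]
        rw [Function.comp, dist_eq_zero.1 this]⟩
    rw [hconst, hconst, ← h0, zero_mul, add_zero]
  · have h1 := (hS u (hc u hu)).2 hu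
    have h2 : 0 ≤ ∑ j, dirichlet α (onJoin u [] j) (onJoin u [] j) :=
      Finset.sum_nonneg fun j _ => dirichlet_self_nonneg _ _
    have h3 : ∑ i, E (u ∘ cellMap α i) (u ∘ cellMap α i) ≤ ratio α * E u u := by
      rw [h1, ← Finset.mul_sum, mul_add, mul_inv_cancel_left₀ h0.ne']
      exact le_add_of_nonneg_right (mul_nonneg h0.le h2)
    refine le_trans ?_ h3
    have h4 := fun i => hR.nonneg _ (hcomp i)
    rw [Fin.sum_univ_three]
    fin_cases j <;> simp <;> linarith [h4 0, h4 1, h4 2]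

/-- The finite resistance between two corners is the a priori bound that the corner estimate
requires; this excludes functions of Cantor type from `D`. -/
theorem isRegularClass_of_scaling (hR : IsResistanceForm E D) (hc : ∀ u ∈ D, Continuous u)
    (hS : SatisfiesScaling α E D) : IsRegularClass D where
  subset := fun _ hu => (mem_joinH1_of_scaling hR hc hS hu).1
  comp := fun u hu => ((hS u (hc u hu)).1.1 hu).1
  corner := fun u hu j => by
    obtain ⟨c, hc0, hcle⟩ := hR.exists_sq_sub_le (vertex α (j + 2)) (vertex α (j + 1))
    refine sq_sub_vertex_le (fun _ hv => (mem_joinH1_of_scaling hR hc hS hv).1)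
      (fun v hv => ((hS v (hc v hv)).1.1 hv).1) j (fun v => c * E v v)
      (fun v hv => mul_nonneg hc0 (hR.nonneg v hv)) (fun v hv => ?_) hcle hu
    have := mul_le_mul_of_nonneg_left (add_comp_le_of_scaling hR hc hS j hv) hc0
    rw [mul_add] at this
    linarith

/-- Density, in the energy, of the functions that are constant on small cells. For `α = 1` the
three cells are points, and every function of the class is of this kind. -/
theorem IsRegularClass.exists_seq {𝒞 : Set (attractor α → ℝ)} (h : IsRegularClass 𝒞)
    {u : attractor α → ℝ} (hu : u ∈ 𝒞) : ∃ (k : ℕ → ℕ) (s : ℕ → attractor α → ℝ),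
      (∀ n, s n ∈ cellConst α (k n)) ∧
      Tendsto (fun n => energy α (s n - u) (s n - u)) atTop (𝓝 0) := by
  have key : ∀ ε > 0, ∃ n, ∃ v ∈ cellConst α n, energy α (v - u) (v - u) < ε := by
    intro ε hε
    rcases hα.le_one.eq_or_lt with h1 | h1
    · have hr : ratio α = 0 := by rw [ratio, h1]; norm_num
      have hJ := h.subset hu
      refine ⟨1, u, ⟨hJ.1, fun i => ⟨u (cellMap α i (vertex α 0)), funext fun x => ?_⟩,
        ((mem_joinH1_iff hJ.1).1 hJ).2⟩, ?_⟩
      · have : dist (cellMap α i x) (cellMap α i (vertex α 0)) = 0 := by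
          rw [dist_cellMap, hr, zero_mul]
        rw [Function.comp, dist_eq_zero.1 this]
      · have e : u - u = fun _ => (0 : ℝ) := sub_self u
        rwa [e, energy_const_left 0 (const_mem_joinH1 0)]
    · obtain ⟨n, v, hv, hlt⟩ := h.exists_cellConst_lt h1 hu hε
      exact ⟨n, v, hv, by
        rwa [energy_sub_comm (cellConst_subset_joinH1 n hv) (h.subset hu)]⟩
  choose k s hs hlt using fun n : ℕ => key (1 / ((n : ℝ) + 1)) Nat.one_div_pos_of_nat
  exact ⟨k, s, hs, squeeze_zero (fun n => energy_self_nonneg _) (fun n => (hlt n).le)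
    tendsto_one_div_add_atTop_nhds_zero_nat⟩

/-- Limits, in the energy, of functions that are constant on small cells belong to the domain of
every resistance form with the scaling relation, and there they are limits in that form. -/
theorem mem_of_tendsto_energy (hR : IsResistanceForm E D) (hc : ∀ u ∈ D, Continuous u)
    (hS : SatisfiesScaling α E D) {𝒞 : Set (attractor α → ℝ)} (h𝒞 : IsRegularClass 𝒞)
    {k : ℕ → ℕ} {s : ℕ → attractor α → ℝ} (hs : ∀ n, s n ∈ cellConst α (k n))
    {u : attractor α → ℝ} (hsu : ∀ n, s n - u ∈ 𝒞)
    (hlim : Tendsto (fun n => energy α (s n - u) (s n - u)) atTop (𝓝 0)) :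
    u ∈ D ∧ Tendsto (fun n => E (s n - u) (s n - u)) atTop (𝓝 0) := by
  have hcell := cellConst_subset_of_scaling hR hS
  have hle := fun v (hv : v ∈ D) => (mem_joinH1_of_scaling hR hc hS hv).2
  have hreg := isRegularClass_of_scaling hR hc hS
  have hsD : ∀ n, s n ∈ D := fun n => (hcell _ _ (hs n)).1
  obtain ⟨v, hv, hvlim⟩ := hR.complete s hsD fun ε hε => by
    obtain ⟨N, hN⟩ := eventually_atTop.1 
      (hlim.eventually (gt_mem_nhds (show (0 : ℝ) < ε / 4 by linarith)))
    refine ⟨N, fun m hm n hn => ?_⟩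
    have e1 : E (s m - s n) (s m - s n) = energy α (s m - s n) (s m - s n) :=
      (hcell _ _ (sub_mem_cellConst _ _ (cellConst_mono (le_max_left (k m) (k n)) (hs m)) _
        (cellConst_mono (le_max_right (k m) (k n)) (hs n)))).2
    have e2 : s m - s n = (s m - u) + (-1 : ℝ) • (s n - u) := by
      rw [neg_one_smul]; abel
    have hm1 := h𝒞.subset (hsu m)
    have hn1 := h𝒞.subset (hsu n)
    have h1 := energy_add_le hm1 (smul_mem_joinH1 (-1) hn1)
    rw [← e2, energy_smul_left _ hn1 (smul_mem_joinH1 _ hn1), energy_comm (s n - u),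
      energy_smul_left _ hn1 hn1] at h1
    have h2 := hN m hm
    have h3 := hN n hn
    rw [e1]
    linarith
  have hvlim' : Tendsto (fun n => energy α (s n - v) (s n - v)) atTop (𝓝 0) :=
    squeeze_zero (fun n => energy_self_nonneg _) (fun n => hle _ (hR.sub_mem (hsD n) hv)) hvlim
  have hosc : ∀ x y, u x - u y = v x - v y := by
    intro x y
    have hb : Tendsto (fun n => 16 * √(energy α (s n - u) (s n - u)) +
        16 * √(energy α (s n - v) (s n - v))) atTop (𝓝 0) := by
      simpa using (hlim.sqrt.const_mul 16).add (hvlim'.sqrt.const_mul 16)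
    refine sub_eq_zero.1 (abs_nonpos_iff.1 (ge_of_tendsto' hb fun n => ?_))
    have h1 := abs_le.1 (h𝒞.osc_le (hsu n) x y)
    have h2 := abs_le.1 (hreg.osc_le (hR.sub_mem (hsD n) hv) x y)
    simp only [Pi.sub_apply] at h1 h2
    exact abs_le.2 ⟨by linarith [h1.1, h1.2, h2.1, h2.2], by linarith [h1.1, h1.2, h2.1, h2.2]⟩
  have huv : u = v + fun _ => u (vertex α 0) - v (vertex α 0) := by
    ext x
    have := hosc x (vertex α 0)
    simp only [Pi.add_apply]
    linarith
  have e : ∀ n, s n - u = (s n - v) + fun _ => v (vertex α 0) - u (vertex α 0) := by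
    intro n
    ext x
    have := hosc x (vertex α 0)
    simp only [Pi.add_apply, Pi.sub_apply]
    linarith
  refine ⟨huv ▸ hR.add_mem v hv _ (hR.const_mem _), ?_⟩
  simpa only [e, fun n => hR.add_const (hR.sub_mem (hsD n) hv)] using hvlim

/-- Two resistance forms with the scaling relation have the same domain: in both of them the
functions that are constant on small cells are dense. -/
theorem domain_subset_of_scaling (hR : IsResistanceForm E D) (hc : ∀ u ∈ D, Continuous u)
    (hS : SatisfiesScaling α E D) {E' : (attractor α → ℝ) → (attractor α → ℝ) → ℝ}
    {D' : Set (attractor α → ℝ)} (hR' : IsResistanceForm E' D') (hc' : ∀ u ∈ D', Continuous u)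
    (hS' : SatisfiesScaling α E' D') : D ⊆ D' := by
  intro u hu
  have hreg := isRegularClass_of_scaling hR hc hS
  obtain ⟨k, s, hs, hlim⟩ := hreg.exists_seq hu
  exact (mem_of_tendsto_energy hR' hc' hS' hreg hs
    (fun n => hR.sub_mem (cellConst_subset_of_scaling hR hS _ _ (hs n)).1 hu) hlim).1

/-- Both `E` and the energy are limits of their common values on functions that are constant on
small cells. -/
theorem eq_energy_self_of_scaling (hR : IsResistanceForm E D) (hc : ∀ u ∈ D, Continuous u)
    (hS : SatisfiesScaling α E D) {u : attractor α → ℝ} (hu : u ∈ D) : E u u = energy α u u := by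
  have hreg := isRegularClass_of_scaling hR hc hS
  have hcell := cellConst_subset_of_scaling hR hS
  obtain ⟨k, s, hs, hlim⟩ := hreg.exists_seq hu
  have hsD : ∀ n, s n ∈ D := fun n => (hcell _ _ (hs n)).1
  obtain ⟨-, hE⟩ := mem_of_tendsto_energy hR hc hS hreg hs (fun n => hR.sub_mem (hsD n) hu) hlim
  -- The form `E - energy` is nonnegative and vanishes at `s n`, so that its value at `u` is its
  -- value at `s n - u`.
  let B : (attractor α → ℝ) → (attractor α → ℝ) → ℝ := fun v z => E v z - energy α v z
  have hBsymm : ∀ v ∈ D, ∀ z ∈ D, B v z = B z v := fun v hv z hz => by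
    simp only [B]
    rw [hR.symm v hv z hz, energy_comm]
  have hBsmul : ∀ (c : ℝ), ∀ v ∈ D, ∀ z ∈ D, B (c • v) z = c * B v z := fun c v hv z hz => by
    simp only [B]
    rw [hR.smul_left c v hv z hz, energy_smul_left c (hreg.subset hv) (hreg.subset hz), mul_sub]
  have hBadd : ∀ v ∈ D, ∀ z ∈ D, ∀ y ∈ D, B (v + z) y = B v y + B z y := fun v hv z hz y hy => by
    simp only [B]
    rw [hR.add_left v hv z hz y hy,
      energy_add_left (hreg.subset hv) (hreg.subset hz) (hreg.subset hy)]
    ring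
  have hB : ∀ n, B u u = B (s n - u) (s n - u) := by
    intro n
    have hneg := hR.smul_mem (-1) _ hu
    have e : s n - u = (-1 : ℝ) • u + s n := by
      rw [neg_one_smul]
      abel
    rw [e, form_add_eq_of_eq_zero hR.add_mem hR.smul_mem hBsymm hBadd hBsmul
      (fun v hv => sub_nonneg.2 (mem_joinH1_of_scaling hR hc hS hv).2) hneg (hsD n)
      (sub_eq_zero.2 (hcell _ _ (hs n)).2), hBsmul _ _ hu _ hneg, hBsymm _ hu _ hneg,
      hBsmul _ _ hu _ hu]
    ring
  have hlimB := hE.sub hlim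
  rw [sub_zero] at hlimB
  exact sub_eq_zero.1 (tendsto_nhds_unique tendsto_const_nhds
    (hlimB.congr fun n => (hB n).symm))

theorem eq_energy_of_scaling (hR : IsResistanceForm E D) (hc : ∀ u ∈ D, Continuous u)
    (hS : SatisfiesScaling α E D) {u v : attractor α → ℝ} (hu : u ∈ D) (hv : v ∈ D) :
    E u v = energy α u v := by
  have hq := fun {z : attractor α → ℝ} (hz : z ∈ D) => eq_energy_self_of_scaling hR hc hS hz
  have hJ := fun {z : attractor α → ℝ} (hz : z ∈ D) => (mem_joinH1_of_scaling hR hc hS hz).1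
  have huv := hR.add_mem u hu v hv
  have h1 := hq huv
  rw [hR.add_left u hu v hv _ huv, hR.symm u hu _ huv, hR.symm v hv _ huv,
    hR.add_left u hu v hv u hu, hR.add_left u hu v hv v hv, hR.symm v hv u hu, hq hu, hq hv,
    energy_add_left (hJ hu) (hJ hv) (hJ huv), energy_comm u (u + v), energy_comm v (u + v),
    energy_add_left (hJ hu) (hJ hv) (hJ hu), energy_add_left (hJ hu) (hJ hv) (hJ hv),
    energy_comm v u] at h1
  linarith

end Scaling

end Hanoi

theorem mainTheorem2 (α : ℝ) (hα₀ : 0 < α) (hα₁ : α ≤ 1) :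
    Hanoi.IsResistanceForm (Hanoi.energy α) (Hanoi.H1 α) ∧
    Hanoi.SatisfiesScaling α (Hanoi.energy α) (Hanoi.H1 α) ∧
    ∀ (E : (Hanoi.attractor α → ℝ) → (Hanoi.attractor α → ℝ) → ℝ)
      (D : Set (Hanoi.attractor α → ℝ)),
      Hanoi.IsResistanceForm E D → (∀ u ∈ D, Continuous u) → Hanoi.SatisfiesScaling α E D →
      D = Hanoi.H1 α ∧ ∀ u ∈ D, ∀ v ∈ D, E u v = Hanoi.energy α u v := by
  have : Hanoi.Admissible α := ⟨hα₀, hα₁⟩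
  have hR := Hanoi.isResistanceForm_H1 (α := α)
  have hS := Hanoi.satisfiesScaling_H1 (α := α)
  have hc : ∀ u ∈ Hanoi.H1 α, Continuous u := fun u hu => hu.1
  exact ⟨hR, hS, fun E D hE hcE hSE =>
    ⟨Subset.antisymm (Hanoi.domain_subset_of_scaling hE hcE hSE hR hc hS)
      (Hanoi.domain_subset_of_scaling hR hc hS hE hcE hSE),
    fun u hu v hv => Hanoi.eq_energy_of_scaling hE hcE hSE hu hv⟩⟩
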